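/- A \emph{biclique} of a finite simple graph $G$ is a set of vertices inducing a complete bipartite graph with both sides nonempty. $G$ is \emph{biclique-Helly} if every nonempty pairwise intersecting family of inclusion-maximal bicliques of $G$ has a common vertex, and \emph{hereditary biclique-Helly} if all its induced subgraphs are biclique-Helly. A vertex $v$ \emph{dominates} $w$ if $N(w)\subseteq N(v)$, and a cycle of length $4$ (a $C_4$, not necessarily induced) is \emph{non-dominated} if none of its vertices dominates another one. The \emph{arboricity} $\alpha(G)$ is the minimum number of edge-disjoint spanning forests into which $G$ can be decomposed. \textbf{Theorem.} Hereditary biclique-Helly graphs can be recognized in $O(n^2+\alpha(G)m)$ time and $O(n+m)$ space, where $n$ and $m$ are the numbers of vertices and edges of the input graph $G$. Precisely: there are one program for a unit-cost random access machine (instructions: constants, addition, truncated subtraction, indirect load and store, tests for zero) and one constant $C$ such that, for every graph $G$ on the vertices $0,\dots,n-1$, given by adjacency lists (in any order), the program halts after at most $C(n^2+\alpha(G)m+1)$ steps, uses only the first $C(n+m+1)$ memory words (including the input) besides a fixed number of registers, computes only numbers smaller than $C(n+m+1)$, and outputs \begin{itemize} \item the message that $G$ is hereditary biclique-Helly, if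 it is; in this case $G$ contains no triangle, no non-dominated $C_4$, no induced $C_5$ and no induced $C_6$; \item otherwise, the vertices, in cyclic order, of a triangle, a non-dominated $C_4$, an induced $C_5$ or an induced $C_6$ of $G$. \end{itemize} (The summand $1$ matters only for the graph without vertices.) -/

import Mathlib

namespace SimpleGraph

variable {V : Type*}

/-- A biclique: a set of vertices inducing a complete bipartite graph, with both sides `X`, `Y`
of the bipartition nonempty. (Completeness forces `X` and `Y` to be disjoint.) -/
def IsBiclique (G : SimpleGraph V) (B : Set V) : Prop :=
  ∃ X Y : Set V, X.Nonempty ∧ Y.Nonempty ∧ X ∪ Y = B ∧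
    G.IsIndepSet X ∧ G.IsIndepSet Y ∧ G.IsCompleteBetween X Y

/-- A family of sets has the Helly property when each of its (nonempty) pairwise intersecting
subfamilies has a common element. -/
def IsHellyFamily (F : Set (Set V)) : Prop :=
  ∀ F' ⊆ F, F'.Nonempty → (∀ S ∈ F', ∀ T ∈ F', (S ∩ T).Nonempty) → (⋂₀ F').Nonempty

/-- The family of inclusion-maximal bicliques is Helly. -/
def IsBicliqueHelly (G : SimpleGraph V) : Prop :=
  IsHellyFamily {B : Set V | Maximal G.IsBiclique B}

/-- All induced subgraphs are biclique-Helly. -/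
def IsHereditaryBicliqueHelly (G : SimpleGraph V) : Prop :=
  ∀ W : Set V, (G.induce W).IsBicliqueHelly

/-- `v` dominates `w` when `N(w) ⊆ N(v)`. -/
def Dominates (G : SimpleGraph V) (v w : V) : Prop :=
  G.neighborSet w ⊆ G.neighborSet v

/-- `l` lists, in cyclic order, the vertices of an induced cycle of length `k`. -/
def IsInducedCycleList (G : SimpleGraph V) (k : ℕ) (l : List V) : Prop :=
  ∃ f : cycleGraph k ↪g G, l = List.ofFn f

/-- `l` lists, in cyclic order, the vertices of a cycle of length `4` that is not dominated, i.e.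
none of its vertices dominates another one. -/
def IsNonDominatedC4List (G : SimpleGraph V) (l : List V) : Prop :=
  ∃ f : Copy (cycleGraph 4) G, (∀ i j, i ≠ j → ¬ G.Dominates (f i) (f j)) ∧ l = List.ofFn f

/-- `l` lists, in cyclic order, the vertices of a triangle, a non-dominated `C₄`,
an induced `C₅` or an induced `C₆`. -/
def IsObstruction (G : SimpleGraph V) (l : List V) : Prop :=
  G.IsInducedCycleList 3 l ∨ G.IsNonDominatedC4List l ∨
    G.IsInducedCycleList 5 l ∨ G.IsInducedCycleList 6 l

/-- `G` decomposes into `k` edge-disjoint spanning forests. -/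
def HasForestDecomposition (G : SimpleGraph V) (k : ℕ) : Prop :=
  ∃ F : Fin k → SimpleGraph V, (∀ i, (F i).IsAcyclic) ∧
    (∀ i j, i ≠ j → Disjoint (F i).edgeSet (F j).edgeSet) ∧ ⨆ i, F i = G

/-- The arboricity: the least number of edge-disjoint spanning forests into which `G`
decomposes. -/
noncomputable def arboricity (G : SimpleGraph V) : ℕ :=
  sInf {k : ℕ | G.HasForestDecomposition k}

/-- `N` is an adjacency-list representation of `G`: for each vertex, its neighbours are listed
exactly once each, in any order. -/
def IsAdjacencyLists {n : ℕ} (G : SimpleGraph (Fin n)) (N : Fin n → List (Fin n)) : Prop :=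
  ∀ v, (N v).Nodup ∧ ∀ w, w ∈ N v ↔ G.Adj v w

end SimpleGraph

/-! A random access machine. A program works on finitely many registers (those that it mentions)
and on a memory addressed by natural numbers; its control structure is sequencing, branching
and looping, and every elementary instruction and every test takes one step. -/
namespace RAM

/-- Programs. The arguments `r a b : ℕ` are names of registers. -/
inductive Cmd : Type
  /-- do nothing -/
  | skip : Cmd
  /-- `r := k` -/
  | const (r k : ℕ) : Cmd
  /-- `r := a + b` -/
  | add (r a b : ℕ) : Cmd
  /-- `r := a - b`, truncated at `0` -/
  | sub (r a b : ℕ) : Cmd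
  /-- `r := mem[a]` -/
  | load (r a : ℕ) : Cmd
  /-- `mem[a] := r` -/
  | store (a r : ℕ) : Cmd
  /-- first `c`, then `d` -/
  | seq (c d : Cmd) : Cmd
  /-- if `r ≠ 0` then `c` else `d` -/
  | branch (r : ℕ) (c d : Cmd) : Cmd
  /-- while `r ≠ 0` do `c` -/
  | loop (r : ℕ) (c : Cmd) : Cmd

/-- Contents of the registers and of the memory. -/
structure State : Type where
  reg : ℕ → ℕ
  mem : ℕ → ℕ

/-- Write `x` to register `r`. -/
def State.setReg (s : State) (r x : ℕ) : State :=
  { s with reg := Function.update s.reg r x }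

/-- Write `x` to memory cell `a`. -/
def State.setMem (s : State) (a x : ℕ) : State :=
  { s with mem := Function.update s.mem a x }

/-- `Exec S c s t s'`: on a machine whose memory consists of the `S` words with addresses
`0, …, S - 1`, each word (and register) being able to hold the numbers smaller than `S`,
the program `c` started in state `s` halts after exactly `t` steps in state `s'`. A run that
addresses a cell outside the memory, or computes a number that does not fit into a word, is
stuck, hence does not halt. -/
inductive Exec (S : ℕ) : Cmd → State → ℕ → State → Prop
  | skip (s : State) : Exec S .skip s 1 s
  | const (s : State) (r k : ℕ) (h : k < S) : Exec S (.const r k) s 1 (s.setReg r k)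
  | add (s : State) (r a b : ℕ) (h : s.reg a + s.reg b < S) :
      Exec S (.add r a b) s 1 (s.setReg r (s.reg a + s.reg b))
  | sub (s : State) (r a b : ℕ) (h : s.reg a - s.reg b < S) :
      Exec S (.sub r a b) s 1 (s.setReg r (s.reg a - s.reg b))
  | load (s : State) (r a : ℕ) (h : s.reg a < S) :
      Exec S (.load r a) s 1 (s.setReg r (s.mem (s.reg a)))
  | store (s : State) (a r : ℕ) (h : s.reg a < S) :
      Exec S (.store a r) s 1 (s.setMem (s.reg a) (s.reg r))
  | seq {c d : Cmd} {s s' s'' : State} {t t' : ℕ} (hc : Exec S c s t s')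
      (hd : Exec S d s' t' s'') : Exec S (.seq c d) s (t + t') s''
  | branch_true {r : ℕ} {c d : Cmd} {s s' : State} {t : ℕ} (h : s.reg r ≠ 0)
      (hc : Exec S c s t s') : Exec S (.branch r c d) s (t + 1) s'
  | branch_false {r : ℕ} {c d : Cmd} {s s' : State} {t : ℕ} (h : s.reg r = 0)
      (hd : Exec S d s t s') : Exec S (.branch r c d) s (t + 1) s'
  | loop_true {r : ℕ} {c : Cmd} {s s' s'' : State} {t t' : ℕ} (h : s.reg r ≠ 0)
      (hc : Exec S c s t s') (hl : Exec S (.loop r c) s' t' s'') :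
      Exec S (.loop r c) s (t + t' + 1) s''
  | loop_false {r : ℕ} {c : Cmd} {s : State} (h : s.reg r = 0) : Exec S (.loop r c) s 1 s

/-- The input word sequence for given adjacency lists: the number `n` of vertices, then the `n`
lengths of the lists, then the lists themselves one after the other. -/
def encode {n : ℕ} (N : Fin n → List (Fin n)) : List ℕ :=
  n :: (List.ofFn fun v => (N v).length) ++ (List.ofFn fun v => (N v).map Fin.val).flatten

/-- The initial state: the input is at the beginning of the memory; all else is `0`. -/
def initial (input : List ℕ) : State where
  reg := fun _ => 0
  mem := fun i => input.getD i 0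

/-- The output: register `0` contains its length, registers `1, 2, …` its entries. -/
def State.output (s : State) : List ℕ :=
  (List.range (s.reg 0)).map fun i => s.reg (i + 1)

end RAM

/-! The combinatorial core: a finite graph is hereditary biclique-Helly exactly when it has no
triangle, non-dominated `C₄`, induced `C₅` or induced `C₆` (`IsObstructionFree`). Each obstruction
carries pairwise intersecting stars whose maximal extensions have no common vertex
(`exists_of_stars`). Conversely, a minimal non-Helly family of maximal bicliques has three members
and three vertices `a`, `b`, `c`, each missed by just one of those members. According to the number
of edges among `a`, `b`, `c` one finds a triangle, a vertex common to the whole family, a `C₅` or a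
`C₆` (`IsObstructionFree.isBicliqueHelly`).

The time bound rests on sorting the vertices by degree. Walking from each vertex to its earlier
neighbours, and on to all neighbours of those, costs the sum over the edges of the smaller degree of
an end. Orienting each forest of a decomposition towards a root charges every edge to its child,
which bounds this sum by `2 α(G) m` (`sum_min_le_arboricity_mul`, `sum_low_le`).

Domination must be tested in constant time. In sorted order only domination of an earlier vertex by
a later one matters (`not_subset_of_lt`). For every non-isolated `w` the program finds an `Oracle`:
two neighbours of `w` such that every later vertex adjacent to both dominates `w`; failure to find
one exhibits a non-dominated `C₄`. With oracles, all non-dominated `C₄`s are excluded by comparing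
consecutive common neighbours only, since domination is transitive (`LastAt.step`).

Let `π w` be the first later vertex that dominates `w`, or `n`. Vertices with equal `π` are
incomparable, so without non-dominated `C₄`s two vertices with equal `π` have at most one common
neighbour in each class of `π` (`next_unique`). A `C₅` or `C₆` with the largest sum of indices has
constant `π` on the `C₅`, or on each side of the `C₆` (`C5.exists_next`, `C6.exists_next`). The
search may therefore stay within classes, where any vertex reached along a second path closes an
obstruction. This makes the search quadratic apart from the degree sum above.

The program is written in a small language with counted loops. A weakest precondition calculus
proves safety, correctness and a bound on loop iterations; `Stmt.exec` turns this into a run of the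
machine whose steps are at most a constant times the iterations. -/

set_option linter.unusedSectionVars false
set_option linter.constructorNameAsVariable false
set_option linter.unusedSimpArgs false

/-! ## A small imperative language with bounded loops and arrays -/

namespace RAM

/-- Arithmetic expressions over variables `V` and arrays `A`. -/
inductive Expr (V A : Type) : Type
  | lit (k : ℕ) : Expr V A
  | var (x : V) : Expr V A
  | add (e f : Expr V A) : Expr V A
  | sub (e f : Expr V A) : Expr V A
  | get (a : A) (e : Expr V A) : Expr V A

/-- Contents of variables and arrays, and a counter of loop iterations. -/
structure Store (V A : Type) : Type where
  var : V → ℕ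
  arr : A → ℕ → ℕ
  time : ℕ

/-- Array sizes, a bound for stored numbers, a time limit for early exits, and the specification
of the output of early exits. -/
structure Env (A : Type) : Type where
  size : A → ℕ
  bd : ℕ
  tmax : ℕ
  ok : List ℕ → Prop

/-- Statements. `loop x h lo hi c` runs `c` for `x = lo, …, hi - 1`, keeping the upper bound in `h`;
`report es` stops the whole program with output `es`. -/
inductive Stmt (V A : Type) : Type
  | skip : Stmt V A
  | assign (x : V) (e : Expr V A) : Stmt V A
  | store (a : A) (i e : Expr V A) : Stmt V A
  | seq (c d : Stmt V A) : Stmt V A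
  | ite (e : Expr V A) (c d : Stmt V A) : Stmt V A
  | loop (x h : V) (lo hi : Expr V A) (c : Stmt V A) : Stmt V A
  | report (es : List (Expr V A)) : Stmt V A

variable {V A : Type}

/-- Value of an expression. -/
def Expr.eval (s : Store V A) : Expr V A → ℕ
  | .lit k => k
  | .var x => s.var x
  | .add e f => e.eval s + f.eval s
  | .sub e f => e.eval s - f.eval s
  | .get a e => s.arr a (e.eval s)

/-- All array accesses of the expression are within bounds. -/
def Expr.Safe (E : Env A) (s : Store V A) : Expr V A → Prop
  | .lit _ => True
  | .var _ => True
  | .add e f => e.Safe E s ∧ f.Safe E s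
  | .sub e f => e.Safe E s ∧ f.Safe E s
  | .get a e => e.Safe E s ∧ e.eval s < E.size a

/-- Nonzero iff `e < f`. -/
def Expr.lt (e f : Expr V A) : Expr V A := .sub f e

/-- Nonzero iff `e ≠ f`. -/
def Expr.ne (e f : Expr V A) : Expr V A := .add (.sub e f) (.sub f e)

/-- Count one loop iteration. -/
def Store.tick (s : Store V A) : Store V A := { s with time := s.time + 1 }

/-- The variables that a statement may change. -/
def Stmt.vars : Stmt V A → List V
  | .skip => []
  | .assign x _ => [x]
  | .store _ _ _ => []
  | .seq c d => c.vars ++ d.vars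
  | .ite _ c d => c.vars ++ d.vars
  | .loop x h _ _ c => x :: h :: c.vars
  | .report _ => []

/-- The arrays that a statement may change. -/
def Stmt.arrs : Stmt V A → List A
  | .skip => []
  | .assign _ _ => []
  | .store a _ _ => [a]
  | .seq c d => c.arrs ++ d.arrs
  | .ite _ c d => c.arrs ++ d.arrs
  | .loop _ _ _ _ c => c.arrs
  | .report _ => []

/-- Two stores agree outside the given variables and arrays. -/
structure Frame (xs : List V) (as : List A) (s s' : Store V A) : Prop where
  var : ∀ x, x ∉ xs → s'.var x = s.var x
  arr : ∀ a, a ∉ as → s'.arr a = s.arr a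

theorem Frame.refl (xs : List V) (as : List A) (s : Store V A) : Frame xs as s s :=
  ⟨fun _ _ => rfl, fun _ _ => rfl⟩

theorem Frame.trans {xs : List V} {as : List A} {s s' s'' : Store V A} (h : Frame xs as s s')
    (h' : Frame xs as s' s'') : Frame xs as s s'' :=
  ⟨fun x hx => (h'.var x hx).trans (h.var x hx), fun a ha => (h'.arr a ha).trans (h.arr a ha)⟩

theorem Frame.mono {xs ys : List V} {as bs : List A} {s s' : Store V A} (h : Frame xs as s s')
    (hx : xs ⊆ ys) (ha : as ⊆ bs) : Frame ys bs s s' :=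
  ⟨fun x hn => h.var x fun hm => hn (hx hm), fun a hn => h.arr a fun hm => hn (ha hm)⟩

variable [DecidableEq V] [DecidableEq A]

/-- Write to a variable. -/
def Store.set (s : Store V A) (x : V) (k : ℕ) : Store V A :=
  { s with var := Function.update s.var x k }

/-- Write to an array cell. -/
def Store.put (s : Store V A) (a : A) (i k : ℕ) : Store V A :=
  { s with arr := Function.update s.arr a (Function.update (s.arr a) i k) }

section
variable (s : Store V A) (x y : V) (k i j : ℕ) (a b : A)

@[simp] theorem Store.var_set : (s.set x k).var y = if y = x then k else s.var y := by
  simp [Store.set, Function.update_apply]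
@[simp] theorem Store.arr_set : (s.set x k).arr = s.arr := rfl
@[simp] theorem Store.time_set : (s.set x k).time = s.time := rfl
@[simp] theorem Store.var_put : (s.put a i k).var = s.var := rfl
@[simp] theorem Store.time_put : (s.put a i k).time = s.time := rfl
@[simp] theorem Store.arr_put_self : (s.put a i k).arr a = Function.update (s.arr a) i k := by
  simp [Store.put]
theorem Store.arr_put_of_ne {a b : A} (h : b ≠ a) : (s.put a i k).arr b = s.arr b := by
  simp [Store.put, h]
@[simp] theorem Store.var_tick : s.tick.var = s.var := rfl
@[simp] theorem Store.arr_tick : s.tick.arr = s.arr := rfl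
@[simp] theorem Store.time_tick : s.tick.time = s.time + 1 := rfl

end

/-- Weakest precondition: from `s`, without leaving the arrays and with all stored numbers
below the bound, the statement ends in a store with property `Q`, or it reports a correct output in
time. -/
def Stmt.wp (E : Env A) : Stmt V A → (Store V A → Prop) → Store V A → Prop
  | .skip, Q, s => Q s
  | .assign x e, Q, s => e.Safe E s ∧ e.eval s < E.bd ∧ Q (s.set x (e.eval s))
  | .store a i e, Q, s => i.Safe E s ∧ e.Safe E s ∧ i.eval s < E.size a ∧ e.eval s < E.bd ∧
      Q (s.put a (i.eval s) (e.eval s))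
  | .seq c d, Q, s => c.wp E (d.wp E Q) s
  | .ite e c d, Q, s => e.Safe E s ∧ (e.eval s ≠ 0 → c.wp E Q s) ∧ (e.eval s = 0 → d.wp E Q s)
  | .loop x h lo hi c, Q, s => lo.Safe E s ∧ hi.Safe E s ∧ lo.eval s < E.bd ∧ hi.eval s < E.bd ∧
      x ∉ c.vars ∧ h ∉ c.vars ∧ x ≠ h ∧
      Nat.rec (motive := fun _ => Store V A → Prop) Q
        (fun _ R s' => c.wp E (fun s'' => R (s''.set x (s''.var x + 1))) s'.tick)
        (hi.eval s - lo.eval s) ((s.set x (lo.eval s)).set h (hi.eval s))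
  | .report es, _, s => (∀ e ∈ es, e.Safe E s) ∧ es ≠ [] ∧ es.length ≤ 6 ∧
      E.ok (es.map (Expr.eval s)) ∧ s.time ≤ E.tmax

/-- The loop part of `Stmt.wp`. -/
def Stmt.iter (E : Env A) (x : V) (c : Stmt V A) (Q : Store V A → Prop) : ℕ → Store V A → Prop
  | 0 => Q
  | k + 1 => fun s' => c.wp E (fun s'' => Stmt.iter E x c Q k (s''.set x (s''.var x + 1))) s'.tick

/-- `Stmt.wp` spells the rounds out as a bare `Nat.rec`, which keeps its recursion structural on
statements. `Stmt.iter` is the named form on which induction over the rounds can be done. -/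
theorem Stmt.wp_loop_eq (E : Env A) (x h : V) (lo hi : Expr V A) (c : Stmt V A)
    (Q : Store V A → Prop) (s : Store V A) :
    (Stmt.loop x h lo hi c).wp E Q s ↔ lo.Safe E s ∧ hi.Safe E s ∧ lo.eval s < E.bd ∧
      hi.eval s < E.bd ∧ x ∉ c.vars ∧ h ∉ c.vars ∧ x ≠ h ∧
      Stmt.iter E x c Q (hi.eval s - lo.eval s) ((s.set x (lo.eval s)).set h (hi.eval s)) := by
  have : ∀ k s', Nat.rec (motive := fun _ => Store V A → Prop) Q
        (fun _ R s' => c.wp E (fun s'' => R (s''.set x (s''.var x + 1))) s'.tick) k s' ↔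
      Stmt.iter E x c Q k s' := by
    intro k
    induction k with
    | zero => exact fun _ => Iff.rfl
    | succ k ih =>
      intro s'
      simp only [Stmt.iter, ← ih]
  simp only [Stmt.wp, this]

/-- A correct statement changes only what it may change, and never turns back the clock. -/
theorem Stmt.wp_frame {E : Env A} {c : Stmt V A} {Q R : Store V A → Prop} {s : Store V A}
    (hw : c.wp E Q s)
    (hQ : ∀ s', Q s' → Frame c.vars c.arrs s s' → s.time ≤ s'.time → R s') : c.wp E R s := by
  induction c generalizing Q R s with
  | skip => exact hQ s hw (Frame.refl _ _ _) le_rfl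
  | assign x e =>
    obtain ⟨h1, h2, h3⟩ := hw
    exact ⟨h1, h2, hQ _ h3 ⟨fun y hy => by simp_all [Stmt.vars], fun a _ => rfl⟩ le_rfl⟩
  | store a i e =>
    obtain ⟨h1, h2, h3, h4, h5⟩ := hw
    refine ⟨h1, h2, h3, h4, hQ _ h5 ⟨fun y hy => rfl, fun b hb => ?_⟩ le_rfl⟩
    exact Store.arr_put_of_ne _ _ _ (by simpa [Stmt.arrs] using hb)
  | seq c d ihc ihd =>
    refine ihc hw fun s1 h1 f1 t1 => ihd h1 fun s2 h2 f2 t2 => hQ s2 h2 ?_ (t1.trans t2)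
    exact (f1.mono (List.subset_append_left _ _) (List.subset_append_left _ _)).trans
      (f2.mono (List.subset_append_right _ _) (List.subset_append_right _ _))
  | ite e c d ihc ihd =>
    refine ⟨hw.1, fun h => ihc (hw.2.1 h) fun s1 h1 f1 t1 => hQ s1 h1 ?_ t1,
      fun h => ihd (hw.2.2 h) fun s1 h1 f1 t1 => hQ s1 h1 ?_ t1⟩
    · exact f1.mono (List.subset_append_left _ _) (List.subset_append_left _ _)
    · exact f1.mono (List.subset_append_right _ _) (List.subset_append_right _ _)
  | loop x h lo hi c ihc =>
    rw [Stmt.wp_loop_eq] at hw ⊢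
    obtain ⟨h1, h2, h3, h4, h5, h6, h7, h8⟩ := hw
    refine ⟨h1, h2, h3, h4, h5, h6, h7, ?_⟩
    have key : ∀ k s', Stmt.iter E x c Q k s' →
        Frame (Stmt.loop x h lo hi c).vars (Stmt.loop x h lo hi c).arrs s s' → s.time ≤ s'.time →
        Stmt.iter E x c R k s' := by
      intro k
      induction k with
      | zero => exact fun s' hs' hf ht => hQ s' hs' hf ht
      | succ k ih =>
        intro s' hs' hf ht
        refine ihc hs' fun s1 h1 f1 t1 => ih _ h1 (hf.trans ⟨fun y hy => ?_, fun a ha => ?_⟩) ?_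
        · simp only [Stmt.vars, List.mem_cons, not_or] at hy
          simp [hy.1, f1.var y hy.2.2]
        · simpa using f1.arr a ha
        · simp only [Store.time_tick, Store.time_set] at t1 ⊢
          omega
    refine key _ _ h8 ⟨fun y hy => ?_, fun a ha => rfl⟩ le_rfl
    simp only [Stmt.vars, List.mem_cons, not_or] at hy
    simp [hy.1, hy.2.1]
  | report es => exact hw

theorem Stmt.wp_mono {E : Env A} {c : Stmt V A} {Q R : Store V A → Prop} {s : Store V A}
    (hw : c.wp E Q s) (hQ : ∀ s', Q s' → R s') : c.wp E R s :=
  Stmt.wp_frame hw fun s' h _ _ => hQ s' h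

/-- The invariant rule for loops. -/
theorem Stmt.wp_loop {E : Env A} {x h : V} {lo hi : Expr V A} {c : Stmt V A}
    {Q : Store V A → Prop} {s : Store V A} (I : ℕ → Store V A → Prop)
    (hlo : lo.Safe E s) (hhi : hi.Safe E s) (hle : lo.eval s ≤ hi.eval s) (hbd : hi.eval s < E.bd)
    (hx : x ∉ c.vars ∧ h ∉ c.vars ∧ x ≠ h)
    (h0 : I (lo.eval s) ((s.set x (lo.eval s)).set h (hi.eval s)))
    (hstep : ∀ k s', lo.eval s ≤ k → k < hi.eval s → I k s' → s'.var x = k →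
      Frame (x :: h :: c.vars) c.arrs s s' →
      c.wp E (fun s'' => I (k + 1) (s''.set x (k + 1))) s'.tick)
    (hend : ∀ s', I (hi.eval s) s' → Frame (x :: h :: c.vars) c.arrs s s' → Q s') :
    (Stmt.loop x h lo hi c).wp E Q s := by
  rw [Stmt.wp_loop_eq]
  refine ⟨hlo, hhi, hle.trans_lt hbd, hbd, hx.1, hx.2.1, hx.2.2, ?_⟩
  have key : ∀ j k s', k + j = hi.eval s → lo.eval s ≤ k → I k s' → s'.var x = k →
      Frame (x :: h :: c.vars) c.arrs s s' → Stmt.iter E x c Q j s' := by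
    intro j
    induction j with
    | zero =>
      intro k s' hk _ hI _ hf
      have : k = hi.eval s := by omega
      exact hend s' (this ▸ hI) hf
    | succ j ih =>
      intro k s' hk hl hI hxk hf
      refine Stmt.wp_frame (hstep k s' hl (by omega) hI hxk hf) fun s1 h1 f1 t1 => ?_
      have hx1 : s1.var x = k := by rw [f1.var x hx.1]; exact hxk
      rw [hx1]
      refine ih (k + 1) _ (by omega) (by omega) h1 (by simp) (hf.trans ⟨fun y hy => ?_, fun a ha => ?_⟩)
      · simp only [List.mem_cons, not_or] at hy
        simp [hy.1, f1.var y hy.2.2]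
      · simpa using f1.arr a ha
  refine key _ _ _ (by omega) le_rfl h0 ?_ ⟨fun y hy => ?_, fun a _ => rfl⟩
  · simp [hx.2.2]
  · simp only [List.mem_cons, not_or] at hy
    simp [hy.1, hy.2.1]

/-! ### Compilation -/

/-- An upper bound, in units of the bound for stored numbers, for the numbers that occur in the
evaluation of an expression. -/
def Expr.weight : Expr V A → ℕ
  | .lit k => k + 1
  | .var _ => 1
  | .add e f => e.weight + f.weight
  | .sub e f => e.weight + f.weight
  | .get _ e => e.weight + 1

/-- Upper bound for the weights of all expressions of a statement, and for the constants that
its compiled form uses. -/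
def Stmt.weight : Stmt V A → ℕ
  | .skip => 2
  | .assign _ e => e.weight + 2
  | .store _ i e => i.weight + e.weight + 2
  | .seq c d => c.weight + d.weight
  | .ite e c d => e.weight + c.weight + d.weight
  | .loop _ _ lo hi c => lo.weight + hi.weight + c.weight + 2
  | .report es => (es.map Expr.weight).sum + 8

/-- Number of steps to evaluate an expression. -/
def Expr.cost : Expr V A → ℕ
  | .lit _ => 1
  | .var _ => 2
  | .add e f => e.cost + (f.cost + 1)
  | .sub e f => e.cost + (f.cost + 1)
  | .get _ e => e.cost + (1 + 1)

/-- Steps of a statement per loop iteration. -/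
def Stmt.cost : Stmt V A → ℕ
  | .skip => 1
  | .assign _ e => e.cost + 2
  | .store _ i e => i.cost + e.cost + 2
  | .seq c d => c.cost + d.cost + 2
  | .ite e c d => e.cost + c.cost + d.cost + 1
  | .loop _ _ lo hi c => lo.cost + hi.cost + c.cost + 20
  | .report es => (es.map fun e => e.cost + 2).sum + 2

/-- A placement of the variables in the registers and of the arrays in the memory. -/
structure Layout (V A : Type) : Type where
  code : V → ℕ
  codeArr : A → ℕ
  base : A → ℕ

namespace Layout
variable (L : Layout V A)

/-- The register of a variable. -/
def reg (x : V) : ℕ := 8 + 3 * L.code x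
/-- The register with the base address of an array. -/
def regArr (a : A) : ℕ := 7 + 3 * L.codeArr a
end Layout

/-- Registers for intermediate results. -/
def tmp (d : ℕ) : ℕ := 9 + 3 * d

/-- Code that evaluates an expression into `tmp d`. -/
def Expr.compile (L : Layout V A) : Expr V A → ℕ → Cmd
  | .lit k, d => .const (tmp d) k
  | .var x, d => .seq (.const (tmp d) 0) (.add (tmp d) (L.reg x) (tmp d))
  | .add e f, d => .seq (e.compile L d) (.seq (f.compile L (d + 1)) (.add (tmp d) (tmp d) (tmp (d + 1))))
  | .sub e f, d => .seq (e.compile L d) (.seq (f.compile L (d + 1)) (.sub (tmp d) (tmp d) (tmp (d + 1))))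
  | .get a e, d => .seq (e.compile L d)
      (.seq (.add (tmp d) (L.regArr a) (tmp d)) (.load (tmp d) (tmp d)))

/-- Code that copies `tmp 0` to register `r`. -/
def move (r : ℕ) : Cmd := .seq (.const (tmp 1) 0) (.add r (tmp 0) (tmp 1))

/-- Code that evaluates expressions into the registers `r, r + 1, …`. -/
def compileList (L : Layout V A) : List (Expr V A) → ℕ → Cmd
  | [], _ => .skip
  | e :: es, r => .seq (.seq (e.compile L 0) (move r)) (compileList L es (r + 1))

/-- Code that sets `tmp 0` to the difference of two variables. -/
def gap (L : Layout V A) (x h : V) : Cmd := .sub (tmp 0) (L.reg h) (L.reg x)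

/-- The body of a compiled loop. -/
def loopBody (L : Layout V A) (x h : V) (c : Cmd) : Cmd :=
  .seq c (.branch 0 (.const (tmp 0) 0)
    (.seq (.const (tmp 0) 1) (.seq (.add (L.reg x) (L.reg x) (tmp 0)) (gap L x h))))

/-- Compilation. Register `0` becomes nonzero when the program has reported. -/
def Stmt.compile (L : Layout V A) : Stmt V A → Cmd
  | .skip => .skip
  | .assign x e => .seq (e.compile L 0) (move (L.reg x))
  | .store a i e => .seq (i.compile L 0) (.seq (e.compile L 1)
      (.seq (.add (tmp 0) (L.regArr a) (tmp 0)) (.store (tmp 0) (tmp 1))))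
  | .seq c d => .seq (c.compile L) (.branch 0 .skip (d.compile L))
  | .ite e c d => .seq (e.compile L 0) (.branch (tmp 0) (c.compile L) (d.compile L))
  | .loop x h lo hi c => .seq (lo.compile L 0) (.seq (hi.compile L 1) (.seq (.const (tmp 2) 0)
      (.seq (.add (L.reg x) (tmp 0) (tmp 2)) (.seq (.add (L.reg h) (tmp 1) (tmp 2))
        (.seq (gap L x h) (.loop (tmp 0) (loopBody L x h (c.compile L))))))))
  | .report es => .seq (compileList L es 1) (.const 0 es.length)

end RAM

/-! ### Correctness of the compilation -/

namespace RAM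
variable {V A : Type} [DecidableEq V] [DecidableEq A]

/-- The machine state `σ` represents the store `s`. -/
structure Rel (E : Env A) (L : Layout V A) (σ : State) (s : Store V A) : Prop where
  flag : σ.reg 0 = 0
  var : ∀ x, σ.reg (L.reg x) = s.var x
  var_lt : ∀ x, s.var x < E.bd
  base : ∀ a, σ.reg (L.regArr a) = L.base a
  arr : ∀ a i, i < E.size a → σ.mem (L.base a + i) = s.arr a i
  arr_lt : ∀ a i, i < E.size a → s.arr a i < E.bd

/-- The layout is injective, and the arrays fit into a memory of `S` words. -/
structure Layout.Good (L : Layout V A) (E : Env A) (S : ℕ) : Prop where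
  code_inj : Function.Injective L.code
  fits : ∀ a, E.size a ≠ 0 → L.base a + E.size a ≤ S
  disjoint : ∀ a b i j, i < E.size a → j < E.size b → L.base a + i = L.base b + j → a = b
  pos : 0 < E.bd

section
variable {E : Env A} {L : Layout V A} {σ σ' : State} {s : Store V A} {S : ℕ}

/-- Registers `0` to `6` hold flag and output. From `7` on, the residue modulo `3` separates array
bases, variables and temporaries. -/
theorem Layout.tmp_ne_reg (L : Layout V A) (d : ℕ) (x : V) : L.reg x ≠ tmp d := by
  unfold Layout.reg tmp; omega

theorem Layout.tmp_ne_regArr (L : Layout V A) (d : ℕ) (a : A) : L.regArr a ≠ tmp d := by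
  unfold Layout.regArr tmp; omega

theorem Layout.reg_ne_regArr (L : Layout V A) (x : V) (a : A) : L.regArr a ≠ L.reg x := by
  unfold Layout.regArr Layout.reg; omega

theorem Layout.Good.reg_inj (hL : L.Good E S) {x y : V} : L.reg x = L.reg y ↔ x = y := by
  unfold Layout.reg
  constructor
  · intro h
    exact hL.code_inj (by omega)
  · rintro rfl
    rfl

/-- Temporaries are invisible to `Rel`, so evaluating expressions preserves the represented store.
-/
theorem Rel.congr (hR : Rel E L σ s) (hr : ∀ r, (∀ d, r ≠ tmp d) → σ'.reg r = σ.reg r)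
    (hm : σ'.mem = σ.mem) : Rel E L σ' s where
  flag := by rw [hr 0 fun d => by unfold tmp; omega]; exact hR.flag
  var x := by rw [hr _ fun d => L.tmp_ne_reg d x]; exact hR.var x
  var_lt := hR.var_lt
  base a := by rw [hr _ fun d => L.tmp_ne_regArr d a]; exact hR.base a
  arr a i hi := by rw [hm]; exact hR.arr a i hi
  arr_lt := hR.arr_lt

theorem Rel.set (hL : L.Good E S) (hR : Rel E L σ s) {x : V} {k : ℕ} (hk : k < E.bd) :
    Rel E L (σ.setReg (L.reg x) k) (s.set x k) where
  flag := by
    have : (0 : ℕ) ≠ L.reg x := by unfold Layout.reg; omega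
    simp [State.setReg, this, hR.flag]
  var y := by simp [State.setReg, Function.update_apply, hL.reg_inj, hR.var]
  var_lt y := by
    simp only [Store.var_set]
    split_ifs
    · exact hk
    · exact hR.var_lt y
  base a := by simp [State.setReg, L.reg_ne_regArr x a, hR.base]
  arr a i hi := by simpa [State.setReg] using hR.arr a i hi
  arr_lt := hR.arr_lt

theorem Rel.put (hL : L.Good E S) (hR : Rel E L σ s) {a : A} {i k : ℕ} (hi : i < E.size a)
    (hk : k < E.bd) : Rel E L (σ.setMem (L.base a + i) k) (s.put a i k) where
  flag := hR.flag
  var := hR.var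
  var_lt := hR.var_lt
  base := hR.base
  arr b j hj := by
    by_cases hb : b = a
    · subst hb
      simp only [State.setMem, Function.update_apply, Store.arr_put_self, Nat.add_left_cancel_iff]
      split_ifs
      · rfl
      · exact hR.arr b j hj
    · have : L.base b + j ≠ L.base a + i := fun h => hb (hL.disjoint _ _ _ _ hj hi h)
      simp only [State.setMem, Function.update_apply, this, if_false, Store.arr_put_of_ne _ _ _ hb]
      exact hR.arr b j hj
  arr_lt b j hj := by
    by_cases hb : b = a
    · subst hb
      simp only [Store.arr_put_self, Function.update_apply]
      split_ifs
      · exact hk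
      · exact hR.arr_lt b j hj
    · rw [Store.arr_put_of_ne _ _ _ hb]
      exact hR.arr_lt b j hj

/-- Variables and cells are below `E.bd`, sums add their bounds, and truncated subtraction does not
exceed its first operand. Thus intermediate results stay within a constant multiple of the bound for
stored numbers. -/
theorem Expr.eval_lt {e : Expr V A} (hs : e.Safe E s) (hR : Rel E L σ s) (hb : 0 < E.bd) :
    e.eval s < e.weight * E.bd := by
  induction e with
  | lit k => simp only [Expr.eval, Expr.weight]; nlinarith
  | var x => simpa [Expr.eval, Expr.weight] using hR.var_lt x
  | add e f ihe ihf =>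
    have := ihe hs.1
    have := ihf hs.2
    simp only [Expr.eval, Expr.weight, add_mul]; omega
  | sub e f ihe ihf =>
    have := ihe hs.1
    simp only [Expr.eval, Expr.weight, add_mul]; omega
  | get a e ihe =>
    have := hR.arr_lt a _ hs.2
    simp only [Expr.eval, Expr.weight, add_mul]; omega

theorem tmp_inj {c d : ℕ} : tmp c = tmp d ↔ c = d := by unfold tmp; omega

/-- The temporaries act as a stack: evaluation at depth `d` changes only `tmp c` with `d ≤ c`, so a
first operand in `tmp d` survives the evaluation of the second one at depth `d + 1`. -/
theorem Expr.exec (hL : L.Good E S) (e : Expr V A) (hs : e.Safe E s) (hR : Rel E L σ s)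
    (hw : e.weight * E.bd ≤ S) (d : ℕ) :
    ∃ σ', Exec S (e.compile L d) σ e.cost σ' ∧ σ'.reg (tmp d) = e.eval s ∧
      (∀ r, (∀ c, d ≤ c → r ≠ tmp c) → σ'.reg r = σ.reg r) ∧ σ'.mem = σ.mem := by
  have hpos := hL.pos
  induction e generalizing σ d with
  | lit k =>
    have : k < S := by simp only [Expr.weight] at hw; nlinarith
    exact ⟨_, .const _ _ _ this, by simp [State.setReg, Expr.eval],
      fun r hr => by simp [State.setReg, hr d le_rfl], rfl⟩
  | var x =>
    have h0 : 0 < S := by simp only [Expr.weight] at hw; omega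
    have hv := hR.var_lt x
    have h1 : (σ.setReg (tmp d) 0).reg (L.reg x) + (σ.setReg (tmp d) 0).reg (tmp d) = s.var x := by
      simp [State.setReg, L.tmp_ne_reg d x, hR.var]
    refine ⟨_, .seq (.const _ _ _ h0) (.add _ _ _ _ ?_), ?_, ?_, rfl⟩
    · rw [h1]; simp only [Expr.weight] at hw; omega
    · rw [h1]; simp [State.setReg, Expr.eval]
    · intro r hr
      simp [State.setReg, hr d le_rfl]
  | add e f ihe ihf =>
    simp only [Expr.weight, add_mul] at hw
    obtain ⟨σ1, x1, v1, r1, m1⟩ := ihe hs.1 hR (by omega) d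
    have R1 : Rel E L σ1 s := hR.congr (fun r hr => r1 r fun c _ => hr c) m1
    obtain ⟨σ2, x2, v2, r2, m2⟩ := ihf hs.2 R1 (by omega) (d + 1)
    have hd : σ2.reg (tmp d) = e.eval s := by
      rw [r2 _ fun c hc => by rw [Ne, tmp_inj]; omega]; exact v1
    have he := Expr.eval_lt hs.1 hR hpos
    have hf := Expr.eval_lt hs.2 hR hpos
    refine ⟨_, .seq x1 (.seq x2 (.add _ _ _ _ (by rw [hd, v2]; omega))), ?_, ?_, m2.trans m1⟩
    · simp [State.setReg, hd, v2, Expr.eval]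
    · intro r hr
      simp only [State.setReg, Function.update_apply, hr d le_rfl, if_false]
      rw [r2 r fun c hc => hr c (by omega), r1 r hr]
  | sub e f ihe ihf =>
    simp only [Expr.weight, add_mul] at hw
    obtain ⟨σ1, x1, v1, r1, m1⟩ := ihe hs.1 hR (by omega) d
    have R1 : Rel E L σ1 s := hR.congr (fun r hr => r1 r fun c _ => hr c) m1
    obtain ⟨σ2, x2, v2, r2, m2⟩ := ihf hs.2 R1 (by omega) (d + 1)
    have hd : σ2.reg (tmp d) = e.eval s := by
      rw [r2 _ fun c hc => by rw [Ne, tmp_inj]; omega]; exact v1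
    have he := Expr.eval_lt hs.1 hR hpos
    refine ⟨_, .seq x1 (.seq x2 (.sub _ _ _ _ (by rw [hd, v2]; omega))), ?_, ?_, m2.trans m1⟩
    · simp [State.setReg, hd, v2, Expr.eval]
    · intro r hr
      simp only [State.setReg, Function.update_apply, hr d le_rfl, if_false]
      rw [r2 r fun c hc => hr c (by omega), r1 r hr]
  | get a e ihe =>
    simp only [Expr.weight, add_mul] at hw
    obtain ⟨σ1, x1, v1, r1, m1⟩ := ihe hs.1 hR (by omega) d
    have R1 : Rel E L σ1 s := hR.congr (fun r hr => r1 r fun c _ => hr c) m1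
    have hfit := hL.fits a (by have := hs.2; omega)
    have hlt := hs.2
    have h1 : σ1.reg (L.regArr a) + σ1.reg (tmp d) = L.base a + e.eval s := by rw [R1.base, v1]
    refine ⟨_, .seq x1 (.seq (.add _ _ _ _ (by rw [h1]; omega)) (.load _ _ _ ?_)), ?_, ?_, m1⟩
    · simp only [State.setReg, Function.update_self, h1]; omega
    · simp only [State.setReg, Function.update_self, h1, Expr.eval]
      exact R1.arr a _ hlt
    · intro r hr
      simp only [State.setReg, Function.update_apply, hr d le_rfl, if_false]
      exact r1 r hr

/-- Evaluation of an expression into a register. -/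
theorem Expr.exec_move (hL : L.Good E S) (e : Expr V A) (hs : e.Safe E s) (hR : Rel E L σ s)
    (hw : e.weight * E.bd ≤ S) (r : ℕ) :
    ∃ σ' : State, Exec S (.seq (e.compile L 0) (move r)) σ (e.cost + 2) (σ'.setReg r (e.eval s)) ∧
      (∀ r, (∀ d, r ≠ tmp d) → σ'.reg r = σ.reg r) ∧ σ'.mem = σ.mem := by
  obtain ⟨σ1, x1, v1, r1, m1⟩ := e.exec hL hs hR hw 0
  have hpos := hL.pos
  have he := Expr.eval_lt hs hR hpos
  have hne : tmp 0 ≠ tmp 1 := by rw [Ne, tmp_inj]; omega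
  have h1 : (σ1.setReg (tmp 1) 0).reg (tmp 0) + (σ1.setReg (tmp 1) 0).reg (tmp 1) = e.eval s := by
    simp [State.setReg, hne, v1]
  have := Exec.seq x1 (.seq (.const (S := S) _ (tmp 1) 0 (by omega)) (.add _ r (tmp 0) (tmp 1) (by rw [h1]; omega)))
  rw [h1] at this
  refine ⟨_, this, fun q hq => ?_, m1⟩
  simp only [State.setReg, Function.update_apply, hq 1, if_false]
  exact r1 q fun c _ => hq c

/-- The bound `7` keeps the results in registers `1` to `6`, below all variables and array bases, so
later expressions still see the same store. -/
theorem exec_compileList (hL : L.Good E S) (es : List (Expr V A)) (hs : ∀ e ∈ es, e.Safe E s)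
    (hR : Rel E L σ s) (hw : (es.map Expr.weight).sum * E.bd ≤ S) (r : ℕ) (hr : 1 ≤ r)
    (hlen : r + es.length ≤ 7) :
    ∃ σ', Exec S (compileList L es r) σ ((es.map fun e => e.cost + 2).sum + 1) σ' ∧
      (∀ i < es.length, σ'.reg (r + i) = (es.map (Expr.eval s)).getD i 0) ∧
      (∀ q < r, σ'.reg q = σ.reg q) := by
  induction es generalizing σ r with
  | nil => exact ⟨σ, .skip σ, by simp, by simp⟩
  | cons e es ih =>
    simp only [List.map_cons, List.sum_cons, add_mul, List.length_cons] at hw hlen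
    obtain ⟨σ1, x1, r1, m1⟩ := e.exec_move hL (hs e (by simp)) hR (by omega) r
    have R1 : Rel E L (σ1.setReg r (e.eval s)) s := by
      have R := hR.congr r1 m1
      refine ⟨?_, fun x => ?_, R.var_lt, fun a => ?_, R.arr, R.arr_lt⟩
      · have : (0 : ℕ) ≠ r := by omega
        simp [State.setReg, this, R.flag]
      · have : L.reg x ≠ r := by unfold Layout.reg; omega
        simp [State.setReg, this, R.var]
      · have : L.regArr a ≠ r := by unfold Layout.regArr; omega
        simp [State.setReg, this, R.base]
    obtain ⟨σ2, x2, v2, r2⟩ := ih (fun e he => hs e (by simp [he])) R1 (by omega) (r + 1)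
      (by omega) (by omega)
    refine ⟨σ2, ?_, ?_, ?_⟩
    · have := Exec.seq x1 x2
      simpa [compileList, add_assoc] using this
    · intro i hi
      cases i with
      | zero =>
        rw [Nat.add_zero, r2 r (by omega)]
        simp [State.setReg]
      | succ i =>
        have := v2 i (by simpa using hi)
        simpa [add_assoc, add_comm 1 i] using this
    · intro q hq
      rw [r2 q (by omega)]
      have : q ≠ r := by omega
      simp only [State.setReg, Function.update_apply, this, if_false]
      exact r1 q fun d => by unfold tmp; omega

/-- The outcome `σ'`, after `t` steps, of a machine run for a statement with cost factor `k`
started at time `t₀`: the statement ends with property `Q`, or it has reported. -/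
def Outcome (E : Env A) (L : Layout V A) (Q : Store V A → Prop) (t₀ k t : ℕ) (σ' : State) : Prop :=
  (∃ s', Rel E L σ' s' ∧ Q s' ∧ t₀ ≤ s'.time ∧ t ≤ k * (s'.time - t₀ + 1)) ∨
  (σ'.reg 0 ≠ 0 ∧ σ'.reg 0 ≤ 6 ∧ E.ok σ'.output ∧ t₀ ≤ E.tmax ∧ t ≤ k * (E.tmax - t₀ + 1))

/-- Each round starts with a tick of the clock. That tick pays for the constant overhead of the
round (loop test, branch, increment, new difference) as well as for the fixed part of the cost of
the body; hence a factor `c.cost + 7` suffices for any number of rounds. -/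
theorem Stmt.exec_iter {c : Stmt V A} {x h : V} (hL : L.Good E S) (hS : 2 * E.bd ≤ S)
    (ih : ∀ {Q : Store V A → Prop} {σ : State} {s : Store V A}, c.wp E Q s → Rel E L σ s →
      ∃ t σ', Exec S (c.compile L) σ t σ' ∧ Outcome E L Q s.time c.cost t σ')
    (hx : x ∉ c.vars) (hh : h ∉ c.vars) (hxh : x ≠ h) {Q : Store V A → Prop} (H : ℕ) (hH : H < E.bd)
    (k : ℕ) : ∀ {σ : State} {s : Store V A}, Stmt.iter E x c Q k s → Rel E L σ s → s.var h = H →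
      H - s.var x = k → σ.reg (tmp 0) = k →
      ∃ t σ', Exec S (.loop (tmp 0) (loopBody L x h (c.compile L))) σ t σ' ∧
        Outcome E L Q s.time (c.cost + 7) t σ' := by
  have hpos := hL.pos
  induction k with
  | zero =>
    intro σ s hi hR _ _ ht
    exact ⟨1, σ, .loop_false ht, .inl ⟨s, hR, hi, le_rfl, by simp⟩⟩
  | succ k ihk =>
    intro σ s hi hR hsh hk ht
    have hi' := Stmt.wp_frame hi (R := fun s' => Stmt.iter E x c Q k (s'.set x (s'.var x + 1)) ∧
      Frame c.vars c.arrs s s' ∧ s.time + 1 ≤ s'.time) fun s' h1 f1 t1 =>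
        ⟨h1, ⟨f1.var, f1.arr⟩, t1⟩
    obtain ⟨t1, σ1, x1, o1⟩ := ih hi' (σ := σ) ⟨hR.flag, hR.var, hR.var_lt, hR.base, hR.arr, hR.arr_lt⟩
    have hne : σ.reg (tmp 0) ≠ 0 := by omega
    simp only [Store.time_tick] at o1
    rcases o1 with ⟨s1, R1, ⟨i1, f1, g1⟩, -, b1⟩ | ⟨fl, six, ok, g1, b1⟩
    · have vx : s1.var x = s.var x := f1.var x hx
      have vh : s1.var h = H := (f1.var h hh).trans hsh
      have hflag := R1.flag
      have n1 : L.reg x ≠ tmp 0 := L.tmp_ne_reg 0 x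
      have n2 : L.reg h ≠ tmp 0 := L.tmp_ne_reg 0 h
      have n3 : L.reg h ≠ L.reg x := by rw [Ne, hL.reg_inj]; exact hxh.symm
      have hxl : s.var x + 1 < E.bd := by omega
      set σ2 := (σ1.setReg (tmp 0) 1).setReg (L.reg x) (s.var x + 1) with hσ2
      have e2 : (σ1.setReg (tmp 0) 1).reg (L.reg x) + (σ1.setReg (tmp 0) 1).reg (tmp 0) =
          s.var x + 1 := by simp [State.setReg, n1, R1.var, vx]
      have e3 : σ2.reg (L.reg h) - σ2.reg (L.reg x) = k := by
        simp only [hσ2, State.setReg, Function.update_self, ne_eq, n3, not_false_eq_true,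
          Function.update_of_ne, n2, R1.var, vh]
        omega
      have body := Exec.seq (S := S) x1 (.branch_false (c := .const (tmp 0) 0) hflag
        (.seq (.const _ (tmp 0) 1 (by omega)) (.seq (.add _ (L.reg x) (L.reg x) (tmp 0) (by rw [e2]; omega))
          (.sub _ (tmp 0) (L.reg h) (L.reg x) (by rw [e2, e3]; omega)))))
      rw [e2, e3] at body
      have R2 : Rel E L σ2 (s1.set x (s1.var x + 1)) := by
        rw [vx]
        have R : Rel E L (σ1.setReg (tmp 0) 1) s1 :=
          R1.congr (fun r hr => by simp [State.setReg, hr 0]) rfl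
        exact R.set hL hxl
      have R3 : Rel E L (σ2.setReg (tmp 0) k) (s1.set x (s1.var x + 1)) :=
        R2.congr (fun r hr => by simp [State.setReg, hr 0]) rfl
      obtain ⟨t4, σ4, x4, o4⟩ := ihk i1 R3 (by simp [hxh.symm, vh]) (by simp only [Store.var_set, if_true]; omega)
        (by simp [State.setReg])
      refine ⟨_, σ4, .loop_true hne body x4, ?_⟩
      simp only [Store.time_set] at o4
      rcases o4 with ⟨s', R', q', g', b'⟩ | ⟨fl, six, ok, g', b'⟩
      · refine .inl ⟨s', R', q', by omega, ?_⟩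
        obtain ⟨p, hp⟩ := Nat.exists_eq_add_of_le g1
        obtain ⟨q, hq⟩ := Nat.exists_eq_add_of_le g'
        have a1 : s1.time - (s.time + 1) + 1 = p + 1 := by omega
        have a2 : s'.time - s1.time + 1 = q + 1 := by omega
        have a3 : s'.time - s.time + 1 = p + q + 2 := by omega
        rw [a1] at b1; rw [a2] at b'; rw [a3]
        nlinarith
      · refine .inr ⟨fl, six, ok, by omega, ?_⟩
        obtain ⟨p, hp⟩ := Nat.exists_eq_add_of_le g1
        obtain ⟨q, hq⟩ := Nat.exists_eq_add_of_le g'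
        have a1 : s1.time - (s.time + 1) + 1 = p + 1 := by omega
        have a2 : E.tmax - s1.time + 1 = q + 1 := by omega
        have a3 : E.tmax - s.time + 1 = p + q + 2 := by omega
        rw [a1] at b1; rw [a2] at b'; rw [a3]
        nlinarith
    -- The body has reported. Register `0` is nonzero, so the branch clears `tmp 0` and the loop
    -- stops; `tmp 0` is register `9`, beyond all output registers.
    · have body := Exec.seq (S := S) x1 (.branch_true (d := .seq (.const (tmp 0) 1)
        (.seq (.add (L.reg x) (L.reg x) (tmp 0)) (gap L x h))) fl (.const _ (tmp 0) 0 (by omega)))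
      have n0 : ∀ i, i < 9 → i ≠ tmp 0 := fun i hi => by unfold tmp; omega
      refine ⟨_, _, .loop_true hne body (.loop_false (by simp [State.setReg])), .inr ⟨?_, ?_, ?_, by omega, ?_⟩⟩
      · simpa [State.setReg, n0] using fl
      · simpa [State.setReg, n0] using six
      · convert ok using 1
        simp only [State.output, State.setReg, ne_eq, n0 0 (by omega), not_false_eq_true,
          Function.update_of_ne]
        refine List.map_congr_left fun i hi => ?_
        have := List.mem_range.1 hi
        rw [Function.update_of_ne (n0 _ (by omega))]
      · obtain ⟨q, hq⟩ := Nat.exists_eq_add_of_le g1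
        have a2 : E.tmax - (s.time + 1) + 1 = q + 1 := by omega
        have a3 : E.tmax - s.time + 1 = q + 2 := by omega
        rw [a2] at b1; rw [a3]
        nlinarith

/-- Soundness of the compilation. -/
theorem Stmt.exec (hL : L.Good E S) (c : Stmt V A) {Q : Store V A → Prop} (hw : c.wp E Q s)
    (hR : Rel E L σ s) (hS : c.weight * E.bd ≤ S) :
    ∃ t σ', Exec S (c.compile L) σ t σ' ∧ Outcome E L Q s.time c.cost t σ' := by
  have hpos := hL.pos
  induction c generalizing Q σ s with
  | skip => exact ⟨1, σ, .skip σ, .inl ⟨s, hR, hw, le_rfl, by simp [Stmt.cost]⟩⟩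
  | assign x e =>
    simp only [Stmt.weight, add_mul] at hS
    obtain ⟨σ1, x1, r1, m1⟩ := e.exec_move hL hw.1 hR (by omega) (L.reg x)
    exact ⟨_, _, x1, .inl ⟨_, (hR.congr r1 m1).set hL hw.2.1, hw.2.2, le_rfl, by simp [Stmt.cost]⟩⟩
  | store a i e =>
    obtain ⟨si, se, hi, he, hq⟩ := hw
    simp only [Stmt.weight, add_mul] at hS
    obtain ⟨σ1, x1, v1, r1, m1⟩ := i.exec hL si hR (by omega) 0
    have R1 : Rel E L σ1 s := hR.congr (fun r hr => r1 r fun c _ => hr c) m1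
    obtain ⟨σ2, x2, v2, r2, m2⟩ := e.exec hL se R1 (by omega) 1
    have R2 : Rel E L σ2 s := R1.congr (fun r hr => r2 r fun c _ => hr c) m2
    have h0 : σ2.reg (tmp 0) = i.eval s := by
      rw [r2 _ fun c hc => by rw [Ne, tmp_inj]; omega]; exact v1
    have hfit := hL.fits a (by omega)
    have h1 : σ2.reg (L.regArr a) + σ2.reg (tmp 0) = L.base a + i.eval s := by rw [R2.base, h0]
    have R3 : Rel E L (σ2.setReg (tmp 0) (L.base a + i.eval s)) s :=
      R2.congr (fun r hr => by simp [State.setReg, hr 0]) rfl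
    have n1 : tmp 1 ≠ tmp 0 := by rw [Ne, tmp_inj]; omega
    have x3 := Exec.seq x1 (.seq x2 (.seq (.add (S := S) _ (tmp 0) (L.regArr a) (tmp 0) (by rw [h1]; omega))
      (.store _ (tmp 0) (tmp 1) (by simp only [State.setReg, Function.update_self, h1]; omega))))
    refine ⟨_, _, x3, .inl ⟨s.put a (i.eval s) (e.eval s), ?_, hq, le_rfl, ?_⟩⟩
    · convert R3.put hL hi he using 2
      · simp [State.setReg, h1]
      · simp [State.setReg, h1]
      · simp [State.setReg, n1, v2]
    · simp [Stmt.cost]; omega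
  | seq c d ihc ihd =>
    simp only [Stmt.weight, add_mul] at hS
    obtain ⟨t1, σ1, x1, o1⟩ := ihc hw hR (by omega)
    rcases o1 with ⟨s1, R1, q1, g1, b1⟩ | ⟨fl, six, ok, g1, b1⟩
    · obtain ⟨t2, σ2, x2, o2⟩ := ihd q1 R1 (by omega)
      refine ⟨_, σ2, .seq x1 (.branch_false R1.flag x2), ?_⟩
      rcases o2 with ⟨s', R', q', g', b'⟩ | ⟨fl, six, ok, g', b'⟩
      · refine .inl ⟨s', R', q', by omega, ?_⟩
        obtain ⟨p, hp⟩ := Nat.exists_eq_add_of_le g1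
        obtain ⟨q, hq⟩ := Nat.exists_eq_add_of_le g'
        have a1 : s1.time - s.time + 1 = p + 1 := by omega
        have a2 : s'.time - s1.time + 1 = q + 1 := by omega
        have a3 : s'.time - s.time + 1 = p + q + 1 := by omega
        rw [a1] at b1; rw [a2] at b'; rw [a3]
        simp only [Stmt.cost]
        nlinarith
      · refine .inr ⟨fl, six, ok, by omega, ?_⟩
        obtain ⟨p, hp⟩ := Nat.exists_eq_add_of_le g1
        obtain ⟨q, hq⟩ := Nat.exists_eq_add_of_le g'
        have a1 : s1.time - s.time + 1 = p + 1 := by omega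
        have a2 : E.tmax - s1.time + 1 = q + 1 := by omega
        have a3 : E.tmax - s.time + 1 = p + q + 1 := by omega
        rw [a1] at b1; rw [a2] at b'; rw [a3]
        simp only [Stmt.cost]
        nlinarith
    -- After a report in `c` the nonzero flag makes the code skip `d`.
    · refine ⟨_, σ1, .seq x1 (.branch_true fl (.skip _)), .inr ⟨fl, six, ok, g1, ?_⟩⟩
      simp only [Stmt.cost]
      nlinarith
  | ite e c d ihc ihd =>
    simp only [Stmt.weight, add_mul] at hS
    obtain ⟨σ1, x1, v1, r1, m1⟩ := e.exec hL hw.1 hR (by omega) 0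
    have R1 : Rel E L σ1 s := hR.congr (fun r hr => r1 r fun c _ => hr c) m1
    by_cases he : e.eval s = 0
    · obtain ⟨t2, σ2, x2, o2⟩ := ihd (hw.2.2 he) R1 (by omega)
      refine ⟨_, σ2, .seq x1 (.branch_false (v1.trans he) x2), ?_⟩
      rcases o2 with ⟨s', R', q', g', b'⟩ | ⟨fl, six, ok, g', b'⟩
      · refine .inl ⟨s', R', q', g', ?_⟩
        simp only [Stmt.cost]; nlinarith
      · refine .inr ⟨fl, six, ok, g', ?_⟩
        simp only [Stmt.cost]; nlinarith
    · obtain ⟨t2, σ2, x2, o2⟩ := ihc (hw.2.1 he) R1 (by omega)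
      refine ⟨_, σ2, .seq x1 (.branch_true (by rw [v1]; exact he) x2), ?_⟩
      rcases o2 with ⟨s', R', q', g', b'⟩ | ⟨fl, six, ok, g', b'⟩
      · refine .inl ⟨s', R', q', g', ?_⟩
        simp only [Stmt.cost]; nlinarith
      · refine .inr ⟨fl, six, ok, g', ?_⟩
        simp only [Stmt.cost]; nlinarith
  | loop x h lo hi c ihc =>
    simp only [Stmt.weight, add_mul] at hS
    rw [Stmt.wp_loop_eq] at hw
    obtain ⟨sl, sh, bl, bh, hx, hh, hxh, hi'⟩ := hw
    obtain ⟨σ1, x1, v1, r1, m1⟩ := lo.exec hL sl hR (by omega) 0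
    have R1 : Rel E L σ1 s := hR.congr (fun r hr => r1 r fun c _ => hr c) m1
    obtain ⟨σ2, x2, v2, r2, m2⟩ := hi.exec hL sh R1 (by omega) 1
    have R2 : Rel E L σ2 s := R1.congr (fun r hr => r2 r fun c _ => hr c) m2
    have v1' : σ2.reg (tmp 0) = lo.eval s := by
      rw [r2 _ fun c hc => by rw [Ne, tmp_inj]; omega]; exact v1
    have n02 : tmp 0 ≠ tmp 2 := by rw [Ne, tmp_inj]; omega
    have n12 : tmp 1 ≠ tmp 2 := by rw [Ne, tmp_inj]; omega
    have nx : ∀ d, tmp d ≠ L.reg x := fun d => (L.tmp_ne_reg d x).symm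
    have nh : L.reg x ≠ L.reg h := by rw [Ne, hL.reg_inj]; exact hxh
    set σ3 := σ2.setReg (tmp 2) 0 with hσ3
    have R3 : Rel E L σ3 s := R2.congr (fun r hr => by simp [hσ3, State.setReg, hr 2]) rfl
    have e4 : σ3.reg (tmp 0) + σ3.reg (tmp 2) = lo.eval s := by simp [hσ3, State.setReg, n02, v1']
    set σ4 := σ3.setReg (L.reg x) (lo.eval s) with hσ4
    have R4 : Rel E L σ4 (s.set x (lo.eval s)) := R3.set hL bl
    have e5 : σ4.reg (tmp 1) + σ4.reg (tmp 2) = hi.eval s := by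
      simp [hσ4, hσ3, State.setReg, n12, v2, nx]
    set σ5 := σ4.setReg (L.reg h) (hi.eval s) with hσ5
    have R5 : Rel E L σ5 ((s.set x (lo.eval s)).set h (hi.eval s)) := R4.set hL bh
    have e6 : σ5.reg (L.reg h) - σ5.reg (L.reg x) = hi.eval s - lo.eval s := by
      simp [hσ5, hσ4, State.setReg, nh]
    have R6 : Rel E L (σ5.setReg (tmp 0) (hi.eval s - lo.eval s))
        ((s.set x (lo.eval s)).set h (hi.eval s)) :=
      R5.congr (fun r hr => by simp [State.setReg, hr 0]) rfl
    obtain ⟨t7, σ7, x7, o7⟩ := Stmt.exec_iter hL (by omega)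
      (fun hw hR => ihc hw hR (by omega)) hx hh hxh (hi.eval s) bh _ hi' R6 (by simp)
      (by simp [hxh]) (by simp [State.setReg])
    have x4 : Exec S (.add (L.reg x) (tmp 0) (tmp 2)) σ3 1 σ4 := by
      rw [hσ4, ← e4]; exact .add _ _ _ _ (by rw [e4]; omega)
    have x5 : Exec S (.add (L.reg h) (tmp 1) (tmp 2)) σ4 1 σ5 := by
      rw [hσ5, ← e5]; exact .add _ _ _ _ (by rw [e5]; omega)
    have x6 : Exec S (gap L x h) σ5 1 (σ5.setReg (tmp 0) (hi.eval s - lo.eval s)) := by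
      rw [← e6]; exact .sub _ _ _ _ (by rw [e6]; omega)
    refine ⟨_, σ7, .seq x1 (.seq x2 (.seq (.const _ (tmp 2) 0 (by omega)) (.seq x4 (.seq x5 (.seq x6 x7))))), ?_⟩
    simp only [Store.time_set] at o7
    rcases o7 with ⟨s', R', q', g', b'⟩ | ⟨fl, six, ok, g', b'⟩
    · refine .inl ⟨s', R', q', g', ?_⟩
      simp only [Stmt.cost]; nlinarith
    · refine .inr ⟨fl, six, ok, g', ?_⟩
      simp only [Stmt.cost]; nlinarith
  | report es =>
    simp only [Stmt.weight, add_mul] at hS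
    obtain ⟨hs, hne, hlen, hok, ht⟩ := hw
    obtain ⟨σ1, x1, v1, r1⟩ := exec_compileList hL es hs hR (by omega) 1 le_rfl (by omega)
    have hl : 0 < es.length := List.length_pos_iff.2 hne
    refine ⟨_, _, .seq x1 (.const _ 0 es.length (by omega)), .inr ⟨?_, ?_, ?_, ht, ?_⟩⟩
    · simp [State.setReg]; exact hne
    · simpa [State.setReg] using hlen
    · convert hok using 1
      refine List.ext_getElem (by simp [State.output, State.setReg]) fun i h1 h2 => ?_
      have hi : i < es.length := by simpa using h2
      have := v1 i hi
      simp only [State.output, State.setReg, Function.update_self, List.getElem_map,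
        List.getElem_range, ne_eq, Nat.add_eq_zero_iff, one_ne_zero, and_false, not_false_eq_true, Function.update_of_ne]
      rw [add_comm, this]
      simp [hi]
    · exact Nat.le_mul_of_pos_right _ (by omega)
end
end RAM

/-! ## Hereditary biclique-Helly graphs and their obstructions -/

namespace SimpleGraph

variable {V : Type*} {G : SimpleGraph V}

/-- The vertices `a b c d`, in cyclic order, form a non-dominated `C₄`. -/
def IsNonDominatedC4 (G : SimpleGraph V) (a b c d : V) : Prop :=
  G.Adj a b ∧ G.Adj b c ∧ G.Adj c d ∧ G.Adj d a ∧ ¬ G.Dominates a c ∧ ¬ G.Dominates c a ∧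
    ¬ G.Dominates b d ∧ ¬ G.Dominates d b

/-- The vertices form, in cyclic order, a (closed walk that is a) cycle of length `5`
in a triangle-free graph. -/
def IsC5 (G : SimpleGraph V) (a b c d e : V) : Prop :=
  G.Adj a b ∧ G.Adj b c ∧ G.Adj c d ∧ G.Adj d e ∧ G.Adj e a

/-- The vertices form, in cyclic order, a closed walk of length `6` without long chords. -/
def IsC6 (G : SimpleGraph V) (a b c d e f : V) : Prop :=
  G.Adj a b ∧ G.Adj b c ∧ G.Adj c d ∧ G.Adj d e ∧ G.Adj e f ∧ G.Adj f a ∧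
    ¬ G.Adj a d ∧ ¬ G.Adj b e ∧ ¬ G.Adj c f

/-- No three vertices are pairwise adjacent. -/
def TriangleFree (G : SimpleGraph V) : Prop := ∀ a b c, G.Adj a b → G.Adj b c → ¬ G.Adj c a

theorem forall_fin_three {p : Fin 3 → Prop} :
    (∀ i, p i) ↔ p 0 ∧ p 1 ∧ p 2 :=
  ⟨fun h => ⟨h 0, h 1, h 2⟩, fun ⟨h0, h1, h2⟩ i =>
    match i with
    | 0 => h0
    | 1 => h1
    | 2 => h2⟩

theorem forall_fin_four {p : Fin 4 → Prop} :
    (∀ i, p i) ↔ p 0 ∧ p 1 ∧ p 2 ∧ p 3 :=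
  ⟨fun h => ⟨h 0, h 1, h 2, h 3⟩, fun ⟨h0, h1, h2, h3⟩ i =>
    match i with
    | 0 => h0
    | 1 => h1
    | 2 => h2
    | 3 => h3⟩

theorem forall_fin_five {p : Fin 5 → Prop} :
    (∀ i, p i) ↔ p 0 ∧ p 1 ∧ p 2 ∧ p 3 ∧ p 4 :=
  ⟨fun h => ⟨h 0, h 1, h 2, h 3, h 4⟩, fun ⟨h0, h1, h2, h3, h4⟩ i =>
    match i with
    | 0 => h0
    | 1 => h1
    | 2 => h2
    | 3 => h3
    | 4 => h4⟩

theorem forall_fin_six {p : Fin 6 → Prop} :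
    (∀ i, p i) ↔ p 0 ∧ p 1 ∧ p 2 ∧ p 3 ∧ p 4 ∧ p 5 :=
  ⟨fun h => ⟨h 0, h 1, h 2, h 3, h 4, h 5⟩, fun ⟨h0, h1, h2, h3, h4, h5⟩ i =>
    match i with
    | 0 => h0
    | 1 => h1
    | 2 => h2
    | 3 => h3
    | 4 => h4
    | 5 => h5⟩

theorem cycleGraph_three_adj (i j : Fin 3) : (cycleGraph 3).Adj i j ↔ i ≠ j := by
  revert i j; simp only [cycleGraph_adj]; decide

theorem isObstruction_of_triangle {a b c : V} (hab : G.Adj a b) (hbc : G.Adj b c)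
    (hca : G.Adj c a) : G.IsObstruction [a, b, c] := by
  left
  have h1 := hab.ne; have h2 := hbc.ne; have h3 := hca.ne
  have adj : ∀ i j : Fin 3, G.Adj (![a, b, c] i) (![a, b, c] j) ↔ (cycleGraph 3).Adj i j := by
    simp only [cycleGraph_three_adj, forall_fin_three]
    and_intros <;>
      simp [hab, hbc, hca, hab.symm, hbc.symm, hca.symm]
  refine ⟨⟨⟨![a, b, c], ?_⟩, fun {i j} => adj i j⟩, ?_⟩
  · simp only [Function.Injective, forall_fin_three]
    and_intros <;> simp [h1, h2, h3, h1.symm, h2.symm, h3.symm]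
  · simp [List.ofFn_succ]

/-- This is why `IsNonDominatedC4` mentions only the two pairs of opposite vertices. -/
theorem not_dominates_of_adj {a b : V} (h : G.Adj a b) : ¬ G.Dominates a b := fun hd =>
  G.loopless.irrefl a (hd h.symm)

theorem cycleGraph_four_adj (i j : Fin 4) :
    (cycleGraph 4).Adj i j ↔ j = i + 1 ∨ i = j + 1 := by
  revert i j; simp only [cycleGraph_adj]; decide

theorem cycleGraph_five_adj (i j : Fin 5) :
    (cycleGraph 5).Adj i j ↔ j = i + 1 ∨ i = j + 1 := by
  revert i j; simp only [cycleGraph_adj]; decide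

theorem cycleGraph_six_adj (i j : Fin 6) :
    (cycleGraph 6).Adj i j ↔ j = i + 1 ∨ i = j + 1 := by
  revert i j; simp only [cycleGraph_adj]; decide

theorem IsNonDominatedC4.isObstruction {a b c d : V} (h : G.IsNonDominatedC4 a b c d) :
    G.IsObstruction [a, b, c, d] := by
  right; left
  obtain ⟨hab, hbc, hcd, hda, h1, h2, h3, h4⟩ := h
  have e1 := hab.ne; have e2 := hbc.ne; have e3 := hcd.ne; have e4 := hda.ne
  have e5 : a ≠ c := by rintro rfl; exact h1 (fun _ h => h)
  have e6 : b ≠ d := by rintro rfl; exact h3 (fun _ h => h)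
  refine ⟨⟨⟨![a, b, c, d], ?_⟩, ?_⟩, ?_, ?_⟩
  · intro i j
    revert i j
    simp only [cycleGraph_four_adj, forall_fin_four]
    and_intros <;> intro hij <;>
      first
      | (exfalso; revert hij; decide)
      | simp [hab, hbc, hcd, hda, hab.symm, hbc.symm, hcd.symm, hda.symm]
  · simp only [Function.Injective, forall_fin_four]
    and_intros <;>
      simp [e1, e2, e3, e4, e5, e6, e1.symm, e2.symm, e3.symm, e4.symm, e5.symm, e6.symm]
  · simp only [forall_fin_four]
    and_intros <;> intro hij <;>
      first
      | exact absurd rfl hij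
      | exact h1
      | exact h2
      | exact h3
      | exact h4
      | exact not_dominates_of_adj hab
      | exact not_dominates_of_adj hbc
      | exact not_dominates_of_adj hcd
      | exact not_dominates_of_adj hda
      | exact not_dominates_of_adj hab.symm
      | exact not_dominates_of_adj hbc.symm
      | exact not_dominates_of_adj hcd.symm
      | exact not_dominates_of_adj hda.symm
  · simp [List.ofFn_succ]

theorem TriangleFree.not_adj (hG : G.TriangleFree) {a b c : V} (hab : G.Adj a b)
    (hbc : G.Adj b c) : ¬ G.Adj a c := fun h => hG a b c hab hbc h.symm

/-- Any chord of a closed walk of length `5` would complete a triangle, so the walk is automatically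
an induced cycle. -/
theorem IsC5.isObstruction (hG : G.TriangleFree) {a b c d e : V} (h : G.IsC5 a b c d e) :
    G.IsObstruction [a, b, c, d, e] := by
  right; right; left
  obtain ⟨hab, hbc, hcd, hde, hea⟩ := h
  have n1 := hG.not_adj hab hbc; have n2 := hG.not_adj hbc hcd
  have n3 := hG.not_adj hcd hde; have n4 := hG.not_adj hde hea; have n5 := hG.not_adj hea hab
  have a1 := hab.symm; have a2 := hbc.symm; have a3 := hcd.symm
  have a4 := hde.symm; have a5 := hea.symm
  have n1' : ¬ G.Adj c a := fun h => n1 h.symm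
  have n2' : ¬ G.Adj d b := fun h => n2 h.symm
  have n3' : ¬ G.Adj e c := fun h => n3 h.symm
  have n4' : ¬ G.Adj a d := fun h => n4 h.symm
  have n5' : ¬ G.Adj b e := fun h => n5 h.symm
  have adj : ∀ i j : Fin 5, G.Adj (![a, b, c, d, e] i) (![a, b, c, d, e] j) ↔
      (cycleGraph 5).Adj i j := by
    simp only [cycleGraph_five_adj]
    simp only [forall_fin_five]
    and_intros <;>
      first
      | exact iff_of_true (by assumption) (by decide)
      | exact iff_of_false (by assumption) (by decide)
      | exact iff_of_false (G.loopless.irrefl _) (by decide)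
  -- Distinct vertices of the cycle have distinct neighbourhoods, so injectivity follows from the
  -- adjacencies alone.
  have key : ∀ i j : Fin 5, (∀ k, (cycleGraph 5).Adj i k ↔ (cycleGraph 5).Adj j k) → i = j := by
    simp only [cycleGraph_five_adj]; decide
  refine ⟨⟨⟨![a, b, c, d, e], ?_⟩, fun {i j} => adj i j⟩, ?_⟩
  · intro i j hij
    exact key i j fun k => by rw [← adj, ← adj, hij]
  · simp [List.ofFn_succ]; exact ⟨rfl, rfl, rfl, rfl, rfl⟩

/-- Short chords are excluded by triangles and long ones by hypothesis; distinctness again follows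
from the adjacencies. -/
theorem IsC6.isObstruction (hG : G.TriangleFree) {a b c d e f : V} (h : G.IsC6 a b c d e f) :
    G.IsObstruction [a, b, c, d, e, f] := by
  right; right; right
  obtain ⟨hab, hbc, hcd, hde, hef, hfa, m1, m2, m3⟩ := h
  have n1 := hG.not_adj hab hbc; have n2 := hG.not_adj hbc hcd
  have n3 := hG.not_adj hcd hde; have n4 := hG.not_adj hde hef; have n5 := hG.not_adj hef hfa
  have n6 := hG.not_adj hfa hab
  have a1 := hab.symm; have a2 := hbc.symm; have a3 := hcd.symm
  have a4 := hde.symm; have a5 := hef.symm; have a6 := hfa.symm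
  have n1' : ¬ G.Adj c a := fun h => n1 h.symm
  have n2' : ¬ G.Adj d b := fun h => n2 h.symm
  have n3' : ¬ G.Adj e c := fun h => n3 h.symm
  have n4' : ¬ G.Adj f d := fun h => n4 h.symm
  have n5' : ¬ G.Adj a e := fun h => n5 h.symm
  have n6' : ¬ G.Adj b f := fun h => n6 h.symm
  have m1' : ¬ G.Adj d a := fun h => m1 h.symm
  have m2' : ¬ G.Adj e b := fun h => m2 h.symm
  have m3' : ¬ G.Adj f c := fun h => m3 h.symm
  have adj : ∀ i j : Fin 6, G.Adj (![a, b, c, d, e, f] i) (![a, b, c, d, e, f] j) ↔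
      (cycleGraph 6).Adj i j := by
    simp only [cycleGraph_six_adj, forall_fin_six]
    and_intros <;>
      first
      | exact iff_of_true (by assumption) (by decide)
      | exact iff_of_false (by assumption) (by decide)
      | exact iff_of_false (G.loopless.irrefl _) (by decide)
  have key : ∀ i j : Fin 6, (∀ k, (cycleGraph 6).Adj i k ↔ (cycleGraph 6).Adj j k) → i = j := by
    simp only [cycleGraph_six_adj]; decide
  refine ⟨⟨⟨![a, b, c, d, e, f], ?_⟩, fun {i j} => adj i j⟩, ?_⟩
  · intro i j hij
    exact key i j fun k => by rw [← adj, ← adj, hij]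
  · simp [List.ofFn_succ]; exact ⟨rfl, rfl, rfl, rfl, rfl, rfl⟩

/-- Every obstruction contains one of the explicit configurations. -/
theorem IsObstruction.cases {l : List V} (h : G.IsObstruction l) :
    (∃ a b c, l = [a, b, c] ∧ G.Adj a b ∧ G.Adj b c ∧ G.Adj c a) ∨
    (∃ a b c d, l = [a, b, c, d] ∧ G.IsNonDominatedC4 a b c d) ∨
    (∃ a b c d e, l = [a, b, c, d, e] ∧ G.IsC5 a b c d e ∧ (¬ G.Adj a c ∧ ¬ G.Adj b d ∧ ¬ G.Adj c e
      ∧ ¬ G.Adj d a ∧ ¬ G.Adj e b) ∧ [a, b, c, d, e].Nodup) ∨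
    (∃ a b c d e f, l = [a, b, c, d, e, f] ∧ G.IsC6 a b c d e f ∧ (¬ G.Adj a c ∧ ¬ G.Adj b d ∧
      ¬ G.Adj c e ∧ ¬ G.Adj d f ∧ ¬ G.Adj e a ∧ ¬ G.Adj f b) ∧ [a, b, c, d, e, f].Nodup) := by
  rcases h with ⟨f, rfl⟩ | ⟨f, hf, rfl⟩ | ⟨f, rfl⟩ | ⟨f, rfl⟩
  · refine .inl ⟨f 0, f 1, f 2, by simp [List.ofFn_succ], ?_⟩
    simp only [f.map_adj_iff, cycleGraph_three_adj]; decide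
  · refine .inr (.inl ⟨f 0, f 1, f 2, f 3, by simp [List.ofFn_succ], ?_, ?_, ?_, ?_,
      hf _ _ (by decide), hf _ _ (by decide), hf _ _ (by decide), hf _ _ (by decide)⟩) <;>
    exact f.toHom.map_adj (by rw [cycleGraph_four_adj]; decide)
  · refine .inr (.inr (.inl ⟨f 0, f 1, f 2, f 3, f 4, by simp [List.ofFn_succ], ?_, ?_, ?_⟩))
    · simp only [IsC5, f.map_adj_iff, cycleGraph_five_adj]; decide
    · simp only [f.map_adj_iff, cycleGraph_five_adj]; decide
    · simp
  · refine .inr (.inr (.inr ⟨f 0, f 1, f 2, f 3, f 4, f 5, by simp [List.ofFn_succ], ?_, ?_, ?_⟩))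
    · simp only [IsC6, f.map_adj_iff, cycleGraph_six_adj]; decide
    · simp only [f.map_adj_iff, cycleGraph_six_adj]; decide
    · simp
end SimpleGraph

/-! ### Obstruction-free graphs are biclique-Helly -/

namespace SimpleGraph

variable {V : Type*} {G : SimpleGraph V}

/-- No triangle, no non-dominated `C₄`, no (induced) `C₅`, no induced `C₆`. -/
structure IsObstructionFree (G : SimpleGraph V) : Prop where
  tri : G.TriangleFree
  c4 : ∀ a b c d, ¬ G.IsNonDominatedC4 a b c d
  c5 : ∀ a b c d e, ¬ G.IsC5 a b c d e
  c6 : ∀ a b c d e f, ¬ G.IsC6 a b c d e f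

theorem IsObstructionFree.not_isObstruction (h : G.IsObstructionFree) :
    ¬ ∃ l, G.IsObstruction l := by
  rintro ⟨l, hl⟩
  rcases hl.cases with ⟨a, b, c, -, h1, h2, h3⟩ | ⟨a, b, c, d, -, h1⟩ | ⟨a, b, c, d, e, -, h1, -⟩ |
    ⟨a, b, c, d, e, f, -, h1, -⟩
  · exact h.tri a b c h1 h2 h3
  · exact h.c4 _ _ _ _ h1
  · exact h.c5 _ _ _ _ _ h1
  · exact h.c6 _ _ _ _ _ _ h1

/-- Domination in the whole graph restricts to induced subgraphs. Hence a `C₄` that is non-dominated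
in the subgraph is non-dominated in the graph too. -/
theorem IsObstructionFree.induce (h : G.IsObstructionFree) (W : Set V) :
    (G.induce W).IsObstructionFree where
  tri a b c h1 h2 h3 := h.tri a b c h1 h2 h3
  c4 a b c d := by
    rintro ⟨h1, h2, h3, h4, d1, d2, d3, d4⟩
    have dom : ∀ x y : W, G.Dominates x y → (G.induce W).Dominates x y :=
      fun x y hxy z hz => hxy hz
    exact h.c4 a b c d ⟨h1, h2, h3, h4, fun h => d1 (dom _ _ h), fun h => d2 (dom _ _ h),
      fun h => d3 (dom _ _ h), fun h => d4 (dom _ _ h)⟩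
  c5 a b c d e h1 := h.c5 a b c d e h1
  c6 a b c d e f h1 := h.c6 a b c d e f h1

/-- The pair of sides of a biclique. -/
structure IsSides (G : SimpleGraph V) (B X Y : Set V) : Prop where
  left : X.Nonempty
  right : Y.Nonempty
  union : X ∪ Y = B
  indep_left : G.IsIndepSet X
  indep_right : G.IsIndepSet Y
  complete : G.IsCompleteBetween X Y

theorem IsBiclique.exists_sides {B : Set V} (h : G.IsBiclique B) : ∃ X Y, G.IsSides B X Y := by
  obtain ⟨X, Y, h1, h2, h3, h4, h5, h6⟩ := h
  exact ⟨X, Y, h1, h2, h3, h4, h5, h6⟩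

theorem IsSides.isBiclique {B X Y : Set V} (h : G.IsSides B X Y) : G.IsBiclique B :=
  ⟨X, Y, h.left, h.right, h.union, h.indep_left, h.indep_right, h.complete⟩

theorem IsSides.symm {B X Y : Set V} (h : G.IsSides B X Y) : G.IsSides B Y X where
  left := h.right
  right := h.left
  union := by rw [Set.union_comm]; exact h.union
  indep_left := h.indep_right
  indep_right := h.indep_left
  complete _ hy _ hx := (h.complete hx hy).symm

theorem IsSides.not_adj_left {B X Y : Set V} (h : G.IsSides B X Y) {a b : V} (ha : a ∈ X)
    (hb : b ∈ X) : ¬ G.Adj a b := fun hab => h.indep_left ha hb hab.ne hab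

/-- Sides can be chosen so that a given vertex of the biclique is on the left. -/
theorem IsBiclique.exists_sides_mem {B : Set V} (h : G.IsBiclique B) {v : V} (hv : v ∈ B) :
    ∃ X Y, G.IsSides B X Y ∧ v ∈ X := by
  obtain ⟨X, Y, hs⟩ := h.exists_sides
  have := hs.union ▸ hv
  rcases this with h | h
  · exact ⟨X, Y, hs, h⟩
  · exact ⟨Y, X, hs.symm, h⟩

theorem IsSides.mem_right {B X Y : Set V} (h : G.IsSides B X Y) {a b : V} (ha : a ∈ X)
    (hb : b ∈ B) (hab : G.Adj a b) : b ∈ Y := by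
  have := h.union ▸ hb
  rcases this with hx | hy
  · exact absurd hab (h.not_adj_left ha hx)
  · exact hy

/-- In a triangle-free graph, a vertex that is adjacent to all of one side belongs to a maximal
biclique. -/
theorem IsSides.mem_of_adj {B X Y : Set V} (h : G.IsSides B X Y) (hG : G.TriangleFree)
    (hB : Maximal G.IsBiclique B) {v : V} (hv : ∀ y ∈ Y, G.Adj v y) : v ∈ B := by
  obtain ⟨y, hy⟩ := h.right
  have hs : G.IsSides (insert v X ∪ Y) (insert v X) Y := by
    refine ⟨⟨v, by simp⟩, h.right, rfl, ?_, h.indep_right, ?_⟩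
    -- Every vertex of the enlarged side is adjacent to `y`, so an edge inside it would give a
    -- triangle.
    · intro a ha b hb _ hab
      have h1 : ∀ c ∈ insert v X, G.Adj c y := by
        rintro c (rfl | hc)
        · exact hv y hy
        · exact h.complete hc hy
      exact hG a b y hab (h1 b hb) (h1 a ha).symm
    · rintro a (rfl | ha) b hb
      · exact hv b hb
      · exact h.complete ha hb
  have hle : B ≤ insert v X ∪ Y := by
    rw [← h.union]
    exact Set.union_subset_union_left _ (Set.subset_insert _ _)
  exact hB.2 hs.isBiclique hle (by simp)

/-- Two vertices of a biclique are adjacent or have a common neighbour. -/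
theorem IsBiclique.adj_or {B : Set V} (h : G.IsBiclique B) {a b : V} (ha : a ∈ B) (hb : b ∈ B)
    (hab : ¬ G.Adj a b) : ∃ X Y, G.IsSides B X Y ∧ a ∈ X ∧ b ∈ X := by
  obtain ⟨X, Y, hs, hx⟩ := h.exists_sides_mem ha
  have := hs.union ▸ hb
  rcases this with h | h
  · exact ⟨X, Y, hs, hx, h⟩
  · exact absurd (hs.complete hx h) hab

variable {B₁ B₂ B₃ : Set V} {a b c : V}

/-- Three maximal bicliques, each missing exactly one of three independent vertices, do not
exist in an obstruction-free graph. -/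
theorem IsObstructionFree.not_independent (h : G.IsObstructionFree)
    (m₁ : Maximal G.IsBiclique B₁) (m₂ : Maximal G.IsBiclique B₂) (m₃ : Maximal G.IsBiclique B₃)
    (b₁ : b ∈ B₁) (c₁ : c ∈ B₁) (a₁ : a ∉ B₁) (a₂ : a ∈ B₂) (c₂ : c ∈ B₂) (b₂ : b ∉ B₂)
    (a₃ : a ∈ B₃) (b₃ : b ∈ B₃) (c₃ : c ∉ B₃)
    (hab : ¬ G.Adj a b) (hbc : ¬ G.Adj b c) (hca : ¬ G.Adj c a) : False := by
  obtain ⟨X₁, Y₁, s₁, hb1, hc1⟩ := m₁.1.adj_or b₁ c₁ hbc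
  obtain ⟨X₂, Y₂, s₂, hc2, ha2⟩ := m₂.1.adj_or c₂ a₂ hca
  obtain ⟨X₃, Y₃, s₃, ha3, hb3⟩ := m₃.1.adj_or a₃ b₃ hab
  -- By maximality each of `a`, `b`, `c` misses a vertex on the side opposite to the other two in
  -- the biclique that avoids it. These three vertices alternate with `a`, `b`, `c` in a hexagon,
  -- and the missing edges are its long chords.
  have e1 : ∃ y ∈ Y₁, ¬ G.Adj a y := by
    by_contra! hc; exact a₁ (s₁.mem_of_adj h.tri m₁ hc)
  have e2 : ∃ y ∈ Y₂, ¬ G.Adj b y := by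
    by_contra! hc; exact b₂ (s₂.mem_of_adj h.tri m₂ hc)
  have e3 : ∃ y ∈ Y₃, ¬ G.Adj c y := by
    by_contra! hc; exact c₃ (s₃.mem_of_adj h.tri m₃ hc)
  obtain ⟨y₁, hy1, n1⟩ := e1
  obtain ⟨y₂, hy2, n2⟩ := e2
  obtain ⟨y₃, hy3, n3⟩ := e3
  exact h.c6 a y₃ b y₁ c y₂ ⟨s₃.complete ha3 hy3, (s₃.complete hb3 hy3).symm, s₁.complete hb1 hy1,
    (s₁.complete hc1 hy1).symm, s₂.complete hc2 hy2, (s₂.complete ha2 hy2).symm, n1,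
    fun hh => n3 hh.symm, n2⟩

/-- `B₁` supplies a common neighbour of `b` and `c`, and `B₂` one of `c` and `a`. Together with the
edge `ab` they close a walk of length `5`. -/
theorem IsObstructionFree.not_one_edge (h : G.IsObstructionFree)
    (m₁ : G.IsBiclique B₁) (m₂ : G.IsBiclique B₂)
    (b₁ : b ∈ B₁) (c₁ : c ∈ B₁) (a₂ : a ∈ B₂) (c₂ : c ∈ B₂)
    (hab : G.Adj a b) (hbc : ¬ G.Adj b c) (hca : ¬ G.Adj c a) : False := by
  obtain ⟨X₁, Y₁, s₁, hb1, hc1⟩ := m₁.adj_or b₁ c₁ hbc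
  obtain ⟨X₂, Y₂, s₂, hc2, ha2⟩ := m₂.adj_or c₂ a₂ hca
  obtain ⟨y₁, hy1⟩ := s₁.right
  obtain ⟨y₂, hy2⟩ := s₂.right
  exact h.c5 a b y₁ c y₂ ⟨hab, s₁.complete hb1 hy1, (s₁.complete hc1 hy1).symm,
    s₂.complete hc2 hy2, (s₂.complete ha2 hy2).symm⟩

/-- If `a` and `c` dominate each other's role for the edge at `b`, some vertex lies in all bicliques
through the edges `ab` and `cb` as well as in `B₂`. -/
theorem IsObstructionFree.exists_of_two_edges (h : G.IsObstructionFree)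
    (m₁ : Maximal G.IsBiclique B₁) (m₂ : Maximal G.IsBiclique B₂) (m₃ : Maximal G.IsBiclique B₃)
    (c₁ : c ∈ B₁) (a₁ : a ∉ B₁) (a₂ : a ∈ B₂) (c₂ : c ∈ B₂) (b₂ : b ∉ B₂)
    (a₃ : a ∈ B₃) (c₃ : c ∉ B₃) (hab : G.Adj a b) (hbc : G.Adj b c) : ∃ z ∈ B₂, G.Dominates z b := by
  have hac : ¬ G.Adj a c := fun hh => h.tri a b c hab hbc hh.symm
  obtain ⟨X₂, Y₂, s₂, ha2, hc2⟩ := m₂.1.adj_or a₂ c₂ hac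
  have e2 : ∃ x ∈ X₂, ¬ G.Adj b x := by
    by_contra! hc; exact b₂ (s₂.symm.mem_of_adj h.tri m₂ hc)
  obtain ⟨x, hx, nx⟩ := e2
  obtain ⟨z, hz⟩ := s₂.right
  refine ⟨z, by rw [← s₂.union]; exact .inr hz, ?_⟩
  by_contra hd
  -- In the cycle `a b c z`, domination of `c` by `a` would put `a` into `B₁`, domination of `a` by
  -- `c` would put `c` into `B₃`, and domination of `z` by `b` would join `b` to `x`. Only
  -- domination of `b` by `z` remains, which `hd` denies.
  refine h.c4 a b c z ⟨hab, hbc, s₂.complete hc2 hz, (s₂.complete ha2 hz).symm, ?_, ?_, ?_, hd⟩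
  · intro hd
    obtain ⟨X, Y, s, hX⟩ := m₁.1.exists_sides_mem c₁
    exact a₁ (s.mem_of_adj h.tri m₁ fun y hy => hd (s.complete hX hy))
  · intro hd
    obtain ⟨X, Y, s, hX⟩ := m₃.1.exists_sides_mem a₃
    exact c₃ (s.mem_of_adj h.tri m₃ fun y hy => hd (s.complete hX hy))
  · intro hd
    exact nx (hd (s₂.complete hx hz).symm)

/-- A dominating vertex is adjacent to the whole side opposite to `b`, so maximality absorbs it.
Thus a dominator of `b` lies in all members of the family that contain `b`. -/
theorem mem_of_dominates (hG : G.TriangleFree) {B : Set V} (hB : Maximal G.IsBiclique B)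
    {b z : V} (hb : b ∈ B) (hz : G.Dominates z b) : z ∈ B := by
  obtain ⟨X, Y, s, hX⟩ := hB.1.exists_sides_mem hb
  exact s.mem_of_adj hG hB fun y hy => hz (s.complete hX hy)

/-- Obstruction-free finite graphs are biclique-Helly. -/
theorem IsObstructionFree.isBicliqueHelly [Finite V] (h : G.IsObstructionFree) :
    G.IsBicliqueHelly := by
  classical
  intro F hF hne hint
  by_contra hemp
  have hfin : F.Finite := Set.toFinite F
  -- a minimal subfamily without common vertex
  have hex : ∃ k, ∃ F' : Finset (Set V), (↑F' : Set (Set V)) ⊆ F ∧ F'.card = k ∧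
      ¬ (⋂₀ (↑F' : Set (Set V))).Nonempty :=
    ⟨_, hfin.toFinset, by simp, rfl, by simpa using hemp⟩
  obtain ⟨F', hsub, hcard, hno⟩ := Nat.find_spec hex
  -- `F'` has least cardinality among the subfamilies without common vertex. Removing `B` leaves a
  -- common vertex `w`, and `B` has to miss it.
  have hmin : ∀ B ∈ F', ∃ w, w ∉ B ∧ ∀ B' ∈ F', B' ≠ B → w ∈ B' := by
    intro B hB
    have hlt : (F'.erase B).card < Nat.find hex := by
      rw [← hcard]; exact Finset.card_erase_lt_of_mem hB
    have := Nat.find_min hex hlt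
    push Not at this
    obtain ⟨w, hw⟩ := this (F'.erase B)
      (fun x hx => hsub (Finset.mem_of_mem_erase hx)) rfl
    have hw' : ∀ B' ∈ F', B' ≠ B → w ∈ B' := fun B' h' hn => hw B' (by simp [hn, h'])
    refine ⟨w, fun hwB => hno ⟨w, fun B' h' => ?_⟩, hw'⟩
    by_cases hn : B' = B
    · exact hn ▸ hwB
    · exact hw' B' h' hn
  -- Pairwise intersection already gives a common vertex for one or two members. For the empty
  -- subfamily any vertex will do, and one exists because `F` has a nonempty member.
  have hthree : 2 < F'.card := by
    by_contra hle
    have hmem : ∀ B ∈ F', B.Nonempty := fun B hB => by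
      have := hint B (hsub hB) B (hsub hB); rwa [Set.inter_self] at this
    have hc : F'.card = 0 ∨ F'.card = 1 ∨ F'.card = 2 := by omega
    rcases hc with hc | hc | hc
    · rw [Finset.card_eq_zero] at hc
      obtain ⟨B, hB⟩ := hne
      have := hint B hB B hB
      exact hno (by rw [hc]; simpa using ⟨this.some, trivial⟩)
    · obtain ⟨B, rfl⟩ := Finset.card_eq_one.1 hc
      exact hno (by simpa using hmem B (by simp))
    · obtain ⟨B, C, -, rfl⟩ := Finset.card_eq_two.1 hc
      exact hno (by simpa using hint B (hsub (by simp)) C (hsub (by simp)))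
  obtain ⟨B₁, h1, B₂, h2, B₃, h3, h12, h13, h23⟩ := Finset.two_lt_card.1 hthree
  have m : ∀ B ∈ F', Maximal G.IsBiclique B := fun B hB => hF (hsub hB)
  obtain ⟨a, a1, ha⟩ := hmin B₁ h1
  obtain ⟨b, b2, hb⟩ := hmin B₂ h2
  obtain ⟨c, c3, hc⟩ := hmin B₃ h3
  have m1 := m B₁ h1; have m2 := m B₂ h2; have m3 := m B₃ h3
  have b1 := hb B₁ h1 h12; have c1 := hc B₁ h1 h13; have a2 := ha B₂ h2 h12.symm
  have c2 := hc B₂ h2 h23; have a3 := ha B₃ h3 h13.symm; have b3 := hb B₃ h3 h23.symm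
  -- a common vertex in the presence of two edges
  have two : ∀ {B C : Set V} {z b : V}, B ∈ F' → z ∈ B → G.Dominates z b →
      (∀ B' ∈ F', B' ≠ B → b ∈ B') → False := by
    intro B C z b hB hz hd hb
    refine hno ⟨z, fun B' hB' => ?_⟩
    by_cases hn : B' = B
    · exact hn ▸ hz
    · exact mem_of_dominates h.tri (m B' hB') (hb B' hB' hn) hd
  -- Three edges among `a`, `b`, `c` form a triangle, two yield a common vertex, one yields a `C₅`
  -- and none a `C₆`. The cases with equally many edges differ by a cyclic shift.
  by_cases hab : G.Adj a b <;> by_cases hbc : G.Adj b c <;> by_cases hca : G.Adj c a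
  · exact h.tri a b c hab hbc hca
  · obtain ⟨z, hz, hd⟩ := h.exists_of_two_edges m1 m2 m3 c1 a1 a2 c2 b2 a3 c3 hab hbc
    exact two (C := B₂) h2 hz hd hb
  · obtain ⟨z, hz, hd⟩ := h.exists_of_two_edges m3 m1 m2 b3 c3 c1 b1 a1 c2 b2 hca hab
    exact two (C := B₂) h1 hz hd ha
  · exact h.not_one_edge m1.1 m2.1 b1 c1 a2 c2 hab hbc hca
  · obtain ⟨z, hz, hd⟩ := h.exists_of_two_edges m2 m3 m1 a2 b2 b3 a3 c3 b1 a1 hbc hca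
    exact two (C := B₂) h3 hz hd hc
  · exact h.not_one_edge m2.1 m3.1 c2 a2 b3 a3 hbc hca hab
  · exact h.not_one_edge m3.1 m1.1 a3 b3 c1 b1 hca hab hbc
  · exact h.not_independent m1 m2 m3 b1 c1 a1 a2 c2 b2 a3 b3 c3 hab hbc hca

theorem IsObstructionFree.isHereditaryBicliqueHelly [Finite V] (h : G.IsObstructionFree) :
    G.IsHereditaryBicliqueHelly := fun W => (h.induce W).isBicliqueHelly

/-! ### Hereditary biclique-Helly graphs have no obstruction -/

/-- Pairwise intersecting stars in a set `W` of vertices of a hereditary biclique-Helly graph: some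
vertex of `W` belongs to bicliques that contain the stars. -/
theorem IsHereditaryBicliqueHelly.exists_of_stars [Finite V] (h : G.IsHereditaryBicliqueHelly)
    (W : Set V) (T : Set (V × Set V)) (hT : T.Nonempty)
    (hstar : ∀ p ∈ T, p.1 ∈ W ∧ p.2 ⊆ W ∧ p.2.Nonempty ∧ G.IsIndepSet p.2 ∧ ∀ y ∈ p.2, G.Adj p.1 y)
    (hint : ∀ p ∈ T, ∀ q ∈ T, (insert p.1 p.2 ∩ insert q.1 q.2).Nonempty) :
    ∃ z ∈ W, ∀ p ∈ T, (G.Adj z p.1 ∧ ∀ y ∈ p.2, ¬ G.Adj z y) ∨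
      (¬ G.Adj z p.1 ∧ ∀ y ∈ p.2, G.Adj z y) := by
  classical
  -- A star with independent leaves is a biclique of the induced graph, and finiteness extends it to
  -- a maximal one. The vertex sought is the Helly vertex of these extensions.
  have hmax : ∀ p ∈ T, ∃ B : Set W, Maximal (G.induce W).IsBiclique B ∧
      ∀ x (hx : x ∈ W), x ∈ insert p.1 p.2 → (⟨x, hx⟩ : W) ∈ B := by
    intro p hp
    obtain ⟨h1, h2, ⟨y, hy⟩, h4, h5⟩ := hstar p hp
    have hb : (G.induce W).IsBiclique ({⟨p.1, h1⟩} ∪ {x : W | (x : V) ∈ p.2}) := by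
      refine ⟨_, _, Set.singleton_nonempty _, ⟨⟨y, h2 hy⟩, hy⟩, rfl, ?_, ?_, ?_⟩
      · intro a ha b hb hab
        exact absurd ((Set.mem_singleton_iff.1 ha).trans (Set.mem_singleton_iff.1 hb).symm) hab
      · intro a ha b hb hab
        exact h4 ha hb fun hh => hab (Subtype.ext hh)
      · rintro a rfl b hb
        exact h5 _ hb
    obtain ⟨B, hB, hm⟩ := Finite.exists_le_maximal hb
    refine ⟨B, hm, fun x hx hx' => hB ?_⟩
    rcases hx' with rfl | hx'
    · exact .inl rfl
    · exact .inr hx'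
  choose! B hB hsub using hmax
  obtain ⟨z, hz⟩ := h W (B '' T) (by rintro _ ⟨p, hp, rfl⟩; exact hB p hp) (hT.image B) (by
    rintro _ ⟨p, hp, rfl⟩ _ ⟨q, hq, rfl⟩
    obtain ⟨x, hx, hx'⟩ := hint p hp q hq
    have hW : x ∈ W := by
      rcases hx with rfl | hx
      · exact (hstar p hp).1
      · exact (hstar p hp).2.1 hx
    exact ⟨⟨x, hW⟩, hsub p hp x hW hx, hsub q hq x hW hx'⟩)
  refine ⟨z, z.2, fun p hp => ?_⟩
  obtain ⟨h1, h2, -, -, h5⟩ := hstar p hp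
  obtain ⟨X, Y, s, hX⟩ := (hB p hp).1.exists_sides_mem (hsub p hp p.1 h1 (by simp))
  have hY : ∀ y (hy : y ∈ p.2), (⟨y, h2 hy⟩ : W) ∈ Y := fun y hy =>
    s.mem_right hX (hsub p hp y (h2 hy) (by simp [hy])) (h5 y hy)
  have hzB : z ∈ X ∪ Y := by rw [s.union]; exact hz _ ⟨p, hp, rfl⟩
  rcases hzB with hzX | hzY
  · exact .inr ⟨fun hh => s.not_adj_left hzX hX hh, fun y hy => s.complete hzX (hY y hy)⟩
  · exact .inl ⟨(s.complete hX hzY).symm, fun y hy hh => s.symm.not_adj_left hzY (hY y hy) hh⟩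

/-- The three edges of a triangle intersect pairwise, but a corner is adjacent to both ends of the
opposite edge and so shares no biclique with that edge. -/
theorem IsHereditaryBicliqueHelly.triangleFree [Finite V] (h : G.IsHereditaryBicliqueHelly) :
    G.TriangleFree := by
  intro a b c hab hbc hca
  obtain ⟨z, hz, hs⟩ := h.exists_of_stars {a, b, c} {(a, {b}), (b, {c}), (c, {a})} (by simp)
    (by simp [hab, hbc, hca]) (by
      simp only [Set.mem_insert_iff, Set.mem_singleton_iff, forall_eq_or_imp, forall_eq]
      and_intros <;> first
        | (refine ⟨a, ?_⟩; simp; done)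
        | (refine ⟨b, ?_⟩; simp; done)
        | (refine ⟨c, ?_⟩; simp))
  simp only [Set.mem_insert_iff, Set.mem_singleton_iff, forall_eq_or_imp, forall_eq] at hs hz
  rcases hz with rfl | rfl | rfl <;> simp_all [G.adj_comm]

theorem isIndepSet_pair {a b : V} (h : ¬ G.Adj a b) : G.IsIndepSet {a, b} := by
  rintro x (rfl | rfl) y (rfl | rfl) hn
  · exact absurd rfl hn
  · exact h
  · exact fun hh => h hh.symm
  · exact absurd rfl hn

/-- The paths `a b c`, `c d e` and `d e a` meet pairwise. A vertex of the cycle outside one of these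
paths shares no biclique with it, and no vertex lies on all three. -/
theorem IsHereditaryBicliqueHelly.not_isC5 [Finite V] (h : G.IsHereditaryBicliqueHelly)
    {a b c d e : V} : ¬ G.IsC5 a b c d e := by
  rintro ⟨hab, hbc, hcd, hde, hea⟩
  have hG := h.triangleFree
  have n1 := hG.not_adj hab hbc; have n2 := hG.not_adj hbc hcd
  have n3 := hG.not_adj hcd hde; have n4 := hG.not_adj hde hea; have n5 := hG.not_adj hea hab
  obtain ⟨z, hz, hs⟩ := h.exists_of_stars {a, b, c, d, e}
    {(b, {a, c}), (d, {c, e}), (e, {d, a})} (by simp)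
    (by
      simp only [Set.mem_insert_iff, Set.mem_singleton_iff, forall_eq_or_imp, forall_eq]
      simp [hab.symm, hbc, hcd.symm, hde, hde.symm, hea, Set.insert_subset_iff, isIndepSet_pair n1, isIndepSet_pair n3,
        isIndepSet_pair n4]) (by
      simp only [Set.mem_insert_iff, Set.mem_singleton_iff, forall_eq_or_imp, forall_eq]
      and_intros <;> first
        | (refine ⟨a, ?_⟩; simp; done)
        | (refine ⟨c, ?_⟩; simp; done)
        | (refine ⟨d, ?_⟩; simp))
  simp only [Set.mem_insert_iff, Set.mem_singleton_iff, forall_eq_or_imp, forall_eq] at hs hz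
  rcases hz with rfl | rfl | rfl | rfl | rfl <;> simp_all [G.adj_comm]

/-- The argument is that for `C₅`, with the paths `a b c`, `c d e` and `e f a`. -/
theorem IsHereditaryBicliqueHelly.not_isC6 [Finite V] (h : G.IsHereditaryBicliqueHelly)
    {a b c d e f : V} : ¬ G.IsC6 a b c d e f := by
  rintro ⟨hab, hbc, hcd, hde, hef, hfa, m1, m2, m3⟩
  have hG := h.triangleFree
  have n1 := hG.not_adj hab hbc; have n2 := hG.not_adj hbc hcd
  have n3 := hG.not_adj hcd hde; have n4 := hG.not_adj hde hef; have n5 := hG.not_adj hef hfa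
  have n6 := hG.not_adj hfa hab
  obtain ⟨z, hz, hs⟩ := h.exists_of_stars {a, b, c, d, e, f}
    {(b, {a, c}), (d, {c, e}), (f, {e, a})} (by simp)
    (by
      simp only [Set.mem_insert_iff, Set.mem_singleton_iff, forall_eq_or_imp, forall_eq]
      simp [hab.symm, hbc, hcd.symm, hde, hef.symm, hfa, Set.insert_subset_iff, isIndepSet_pair n1, isIndepSet_pair n3,
        isIndepSet_pair n5]) (by
      simp only [Set.mem_insert_iff, Set.mem_singleton_iff, forall_eq_or_imp, forall_eq]
      and_intros <;> first
        | (refine ⟨a, ?_⟩; simp; done)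
        | (refine ⟨c, ?_⟩; simp; done)
        | (refine ⟨e, ?_⟩; simp))
  simp only [Set.mem_insert_iff, Set.mem_singleton_iff, forall_eq_or_imp, forall_eq] at hs hz
  rcases hz with rfl | rfl | rfl | rfl | rfl | rfl <;> simp_all [G.adj_comm]

theorem exists_of_not_dominates {a b : V} (h : ¬ G.Dominates a b) :
    ∃ x, G.Adj b x ∧ ¬ G.Adj a x := by
  by_contra! hc
  exact h fun x hx => hc x hx

/-- Non-domination gives each corner a private neighbour that the opposite corner misses; the stars
consist of a corner, its two neighbours on the cycle and its private neighbour. A Helly vertex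
adjacent to `a` must be adjacent to `c`, `xb` and `xd` as well, and to none of `b`, `d`, `xa`, `xc`;
none of the eight vertices is like that. The other case is symmetric. -/
theorem IsHereditaryBicliqueHelly.not_isNonDominatedC4 [Finite V]
    (h : G.IsHereditaryBicliqueHelly) {a b c d : V} : ¬ G.IsNonDominatedC4 a b c d := by
  rintro ⟨hab, hbc, hcd, hda, d1, d2, d3, d4⟩
  have hG := h.triangleFree
  obtain ⟨xc, c1, c2⟩ := exists_of_not_dominates d1
  obtain ⟨xa, a1, a2⟩ := exists_of_not_dominates d2
  obtain ⟨xd, e1, e2⟩ := exists_of_not_dominates d3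
  obtain ⟨xb, b1, b2⟩ := exists_of_not_dominates d4
  have ind : ∀ v x y z, G.Adj v x → G.Adj v y → G.Adj v z → G.IsIndepSet {x, y, z} := by
    intro v x y z hx hy hz p hp q hq _ hpq
    have hv : ∀ p ∈ ({x, y, z} : Set V), G.Adj v p := by
      rintro p (rfl | rfl | rfl) <;> assumption
    exact hG v p q (hv p hp) hpq (hv q hq).symm
  obtain ⟨z, hz, hs⟩ := h.exists_of_stars {a, b, c, d, xa, xb, xc, xd}
    {(a, {xa, b, d}), (b, {xb, a, c}), (c, {xc, b, d}), (d, {xd, a, c})} (by simp)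
    (by
      simp only [Set.mem_insert_iff, Set.mem_singleton_iff, forall_eq_or_imp, forall_eq]
      simp [hab, hbc, hcd, hda, hab.symm, hbc.symm, hcd.symm, hda.symm, a1, b1, c1, e1,
        Set.insert_subset_iff, ind a, ind b, ind c, ind d]) (by
      simp only [Set.mem_insert_iff, Set.mem_singleton_iff, forall_eq_or_imp, forall_eq]
      and_intros <;> first
        | (refine ⟨a, ?_⟩; simp; done)
        | (refine ⟨b, ?_⟩; simp; done)
        | (refine ⟨c, ?_⟩; simp))
  simp only [Set.mem_insert_iff, Set.mem_singleton_iff, forall_eq_or_imp, forall_eq] at hs hz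
  have l : ∀ x, ¬ G.Adj x x := G.loopless.irrefl
  have s : ∀ x y, G.Adj x y → G.Adj y x := fun _ _ h => h.symm
  clear ind hG d1 d2 d3 d4 h
  rcases hz with rfl | rfl | rfl | rfl | rfl | rfl | rfl | rfl <;> grind

theorem IsHereditaryBicliqueHelly.isObstructionFree [Finite V]
    (h : G.IsHereditaryBicliqueHelly) : G.IsObstructionFree :=
  ⟨h.triangleFree, fun _ _ _ _ => h.not_isNonDominatedC4, fun _ _ _ _ _ => h.not_isC5,
    fun _ _ _ _ _ _ => h.not_isC6⟩

theorem IsObstruction.not_isHereditaryBicliqueHelly [Finite V] {l : List V}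
    (h : G.IsObstruction l) : ¬ G.IsHereditaryBicliqueHelly := fun hh =>
  hh.isObstructionFree.not_isObstruction ⟨l, h⟩

end SimpleGraph

/-! ## Arboricity and the sum of the smaller weights of the edges -/

namespace SimpleGraph

variable {V : Type*}

/-- The edges of a forest can be oriented such that every vertex has at most one parent. -/
theorem IsAcyclic.exists_parent {F : SimpleGraph V} (hF : F.IsAcyclic) :
    ∃ f : V → V, ∀ u v, F.Adj u v → f u = v ∨ f v = u := by
  classical
  cases isEmpty_or_nonempty V
  · exact ⟨id, fun u => isEmptyElim u⟩
  -- Extending the forest to a spanning tree of the complete graph provides one root for all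
  -- components. The parent of a vertex is the last vertex but one on its path from the root.
  obtain ⟨T, hFT, -, hT⟩ := (connected_top (V := V)).exists_isTree_le_of_le_of_isAcyclic
    (H := F) le_top hF
  let r : V := Classical.arbitrary V
  choose p hp using fun v => (hT.existsUnique_path r v).exists
  refine ⟨fun v => (p v).penultimate, fun u v huv => ?_⟩
  have hT' := hFT huv
  by_cases hv : v ∈ (p u).support
  · exact .inl (hT.isAcyclic.eq_penultimate_of_adj_end (hp u) hT' hv).symm
  · exact .inr (hT.isAcyclic.eq_penultimate_of_adj_end (hp v) hT'.symm
      (hT.isAcyclic.mem_support_of_ne_mem_support_of_adj_of_isPath (hp v) (hp u) hT'.symm hv)).symm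

/-- Each edge is charged to its child end, whose weight is at least the smaller one. A vertex is the
child of at most one edge, because it has only one parent. -/
theorem IsAcyclic.sum_min_le [Fintype V] {F : SimpleGraph V} (hF : F.IsAcyclic)
    (D : Finset (V × V)) (hD : ∀ p ∈ D, F.Adj p.1 p.2 ∧ p.swap ∉ D) (d : V → ℕ) :
    ∑ p ∈ D, min (d p.1) (d p.2) ≤ ∑ v, d v := by
  classical
  obtain ⟨f, hf⟩ := hF.exists_parent
  let c : V × V → V := fun p => if f p.1 = p.2 then p.1 else p.2
  have hc : ∀ p ∈ D, p = (c p, f (c p)) ∨ p = (f (c p), c p) := by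
    rintro ⟨u, v⟩ hp
    by_cases h : f u = v
    · left; simp [c, h]
    · right
      have := (hf u v (hD _ hp).1).resolve_left h
      simp [c, h, this]
  -- An edge is recovered from its child up to orientation, and `D` contains only one of the two
  -- orientations.
  have hinj : Set.InjOn c D := by
    intro p hp q hq hpq
    have h1 := hc p hp
    have h2 := hc q hq
    rw [← hpq] at h2
    rcases h1 with h1 | h1 <;> rcases h2 with h2 | h2
    · rw [h1, h2]
    · refine absurd hp ?_
      rw [h1, show (c p, f (c p)) = q.swap by rw [h2]; rfl]
      exact (hD q hq).2
    · refine absurd hp ?_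
      rw [h1, show (f (c p), c p) = q.swap by rw [h2]; rfl]
      exact (hD q hq).2
    · rw [h1, h2]
  calc ∑ p ∈ D, min (d p.1) (d p.2) ≤ ∑ p ∈ D, d (c p) := by
        refine Finset.sum_le_sum fun p _ => ?_
        by_cases h : f p.1 = p.2
        · simp only [c, h, if_true]; exact min_le_left _ _
        · simp only [c, h, if_false]; exact min_le_right _ _
    _ = ∑ v ∈ D.image c, d v := (Finset.sum_image hinj).symm
    _ ≤ ∑ v, d v := Finset.sum_le_sum_of_subset (Finset.subset_univ _)

/-- The infimum is attained as soon as some decomposition exists; single edges form one. -/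
theorem hasForestDecomposition_arboricity [Finite V] (G : SimpleGraph V) :
    G.HasForestDecomposition G.arboricity := by
  classical
  refine Nat.sInf_mem (s := {k : ℕ | G.HasForestDecomposition k}) ?_
  obtain ⟨k, ⟨e⟩⟩ := Finite.exists_equiv_fin G.edgeSet
  refine ⟨k, fun i => fromEdgeSet {(e.symm i : Sym2 V)}, fun i => ?_, fun i j hij => ?_, ?_⟩
  · change (fromEdgeSet {(e.symm i : Sym2 V)}).IsAcyclic
    rw [← bot_sup_eq (fromEdgeSet _)]
    induction h : (e.symm i : Sym2 V) with | _ u v =>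
    have hadj : G.Adj u v := by rw [← mem_edgeSet, ← h]; exact (e.symm i).2
    refine isAcyclic_bot.sup_edge_of_not_reachable ?_
    rw [reachable_bot]
    exact hadj.ne
  · rw [edgeSet_fromEdgeSet, edgeSet_fromEdgeSet]
    refine Disjoint.mono Set.sdiff_subset Set.sdiff_subset ?_
    rw [Set.disjoint_singleton]
    exact fun h => hij (e.symm.injective (Subtype.ext h))
  · ext u v
    simp only [iSup_adj, fromEdgeSet_adj, Set.mem_singleton_iff]
    constructor
    · rintro ⟨i, hi, -⟩
      rw [← mem_edgeSet, hi]
      exact (e.symm i).2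
    · intro h
      exact ⟨e ⟨s(u, v), h⟩, by simp, h.ne⟩

/-- The sum over the edges of the smaller weight of an end is at most the arboricity times the
total weight. -/
theorem sum_min_le_arboricity_mul [Fintype V] (G : SimpleGraph V)
    (D : Finset (V × V)) (hD : ∀ p ∈ D, G.Adj p.1 p.2 ∧ p.swap ∉ D) (d : V → ℕ) :
    ∑ p ∈ D, min (d p.1) (d p.2) ≤ G.arboricity * ∑ v, d v := by
  classical
  obtain ⟨F, hF, -, hsup⟩ := G.hasForestDecomposition_arboricity
  calc ∑ p ∈ D, min (d p.1) (d p.2)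
      ≤ ∑ p ∈ D, ∑ i, if (F i).Adj p.1 p.2 then min (d p.1) (d p.2) else 0 := by
        refine Finset.sum_le_sum fun p hp => ?_
        have h := (hD p hp).1
        rw [← hsup, iSup_adj] at h
        obtain ⟨i, hi⟩ := h
        refine le_trans ?_ (Finset.single_le_sum (fun _ _ => Nat.zero_le _) (Finset.mem_univ i))
        simp [hi]
    _ = ∑ i, ∑ p ∈ D.filter (fun p => (F i).Adj p.1 p.2), min (d p.1) (d p.2) := by
        rw [Finset.sum_comm]
        simp only [Finset.sum_filter]
    _ ≤ ∑ _i : Fin G.arboricity, ∑ v, d v := by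
        refine Finset.sum_le_sum fun i _ => (hF i).sum_min_le _ (fun p hp => ?_) d
        rw [Finset.mem_filter] at hp
        exact ⟨hp.2, fun h => (hD p hp.1).2 (Finset.mem_of_mem_filter _ h)⟩
    _ = G.arboricity * ∑ v, d v := by simp

theorem arboricity_pos [Finite V] {G : SimpleGraph V} {u v : V} (h : G.Adj u v) :
    0 < G.arboricity := by
  obtain ⟨F, -, -, hsup⟩ := G.hasForestDecomposition_arboricity
  rw [← hsup, iSup_adj] at h
  obtain ⟨i, -⟩ := h
  exact i.pos
end SimpleGraph

/-! ## Graphs on an initial segment of the naturals, given by their neighbourhoods -/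

/-- `nb` gives the neighbourhoods of a graph on `0, …, n - 1` whose vertices are sorted by degree. -/
structure SortedGraph (n : ℕ) (nb : ℕ → Finset ℕ) : Prop where
  symm : ∀ {u v}, u ∈ nb v → v ∈ nb u
  irrefl : ∀ v, v ∉ nb v
  lt : ∀ {u v}, u ∈ nb v → u < n
  mono : ∀ {v w}, v ≤ w → w < n → (nb v).card ≤ (nb w).card

namespace SortedGraph

variable {n : ℕ} {nb : ℕ → Finset ℕ}

/-- The vertices form a triangle. -/
def Tri (nb : ℕ → Finset ℕ) (a b c : ℕ) : Prop := b ∈ nb a ∧ c ∈ nb b ∧ a ∈ nb c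

/-- The vertices form a non-dominated `C₄`. -/
def NdC4 (nb : ℕ → Finset ℕ) (a b c d : ℕ) : Prop :=
  b ∈ nb a ∧ c ∈ nb b ∧ d ∈ nb c ∧ a ∈ nb d ∧
    ¬ nb c ⊆ nb a ∧ ¬ nb a ⊆ nb c ∧ ¬ nb d ⊆ nb b ∧ ¬ nb b ⊆ nb d

/-- The vertices form a closed walk of length `5`. -/
def C5 (nb : ℕ → Finset ℕ) (a b c d e : ℕ) : Prop :=
  b ∈ nb a ∧ c ∈ nb b ∧ d ∈ nb c ∧ e ∈ nb d ∧ a ∈ nb e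

/-- The vertices form a closed walk of length `6` without long chords. -/
def C6 (nb : ℕ → Finset ℕ) (a b c d e f : ℕ) : Prop :=
  b ∈ nb a ∧ c ∈ nb b ∧ d ∈ nb c ∧ e ∈ nb d ∧ f ∈ nb e ∧ a ∈ nb f ∧
    d ∉ nb a ∧ e ∉ nb b ∧ f ∉ nb c

/-- The pair `a, b` of neighbours of `w` determines the later vertices that dominate `w`. -/
def Oracle (nb : ℕ → Finset ℕ) (a b w : ℕ) : Prop :=
  a ∈ nb w ∧ b ∈ nb w ∧ ∀ y, w < y → y ∈ nb a → y ∈ nb b → nb w ⊆ nb y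

/-- `π w` is the first vertex after `w` that dominates `w`, or `n` if there is none. -/
def IsNext (n : ℕ) (nb : ℕ → Finset ℕ) (π : ℕ → ℕ) : Prop :=
  ∀ w < n, (nb w).Nonempty → w < π w ∧ π w ≤ n ∧ (π w < n → nb w ⊆ nb (π w)) ∧
    ∀ y, w < y → y < π w → ¬ nb w ⊆ nb y

variable (hG : SortedGraph n nb)
include hG

theorem lt' {u v : ℕ} (h : u ∈ nb v) : v < n := hG.lt (hG.symm h)

theorem ne {u v : ℕ} (h : u ∈ nb v) : u ≠ v := by
  rintro rfl; exact hG.irrefl _ h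

/-- Degrees do not decrease along the order, so an inclusion of a later neighbourhood in an earlier
one must be an equality. Only domination of earlier vertices by later ones needs testing. -/
theorem not_subset_of_lt {v w : ℕ} (hvw : v < w) (hw : w < n) (h : ¬ nb v ⊆ nb w) :
    ¬ nb w ⊆ nb v := fun hs =>
  h (Finset.eq_of_subset_of_card_le hs (hG.mono hvw.le hw)).superset

/-- This makes domination of `w` by a later `y` a matter of two adjacency tests. -/
theorem Oracle.iff {a b w y : ℕ} (h : Oracle nb a b w) (hy : w < y) :
    (y ∈ nb a ∧ y ∈ nb b) ↔ nb w ⊆ nb y :=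
  ⟨fun hh => h.2.2 y hy hh.1 hh.2, fun hs => ⟨hG.symm (hs h.1), hG.symm (hs h.2.1)⟩⟩

theorem NdC4.rotate {a b c d : ℕ} (h : NdC4 nb a b c d) : NdC4 nb b c d a := by
  obtain ⟨h1, h2, h3, h4, h5, h6, h7, h8⟩ := h
  exact ⟨h2, h3, h4, h1, h7, h8, h6, h5⟩

theorem NdC4.reverse {a b c d : ℕ} (h : NdC4 nb a b c d) : NdC4 nb a d c b := by
  obtain ⟨h1, h2, h3, h4, h5, h6, h7, h8⟩ := h
  exact ⟨hG.symm h4, hG.symm h3, hG.symm h2, hG.symm h1, h5, h6, h8, h7⟩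

/-- It suffices to look for non-dominated `C₄`s from their last vertices. -/
theorem not_ndC4 (h : ∀ v w u u', w < v → u' < u → u < v → u ∈ nb v → u' ∈ nb v → w ∈ nb u →
    w ∈ nb u' → nb u' ⊆ nb u ∨ nb w ⊆ nb v) (a b c d : ℕ) : ¬ NdC4 nb a b c d := by
  -- Rotation puts the largest vertex first, and reflection makes the second vertex larger than the
  -- fourth. Then only two inclusions have to be refuted.
  have key : ∀ a b c d, b < a → c < a → d < a → ¬ NdC4 nb a b c d := by
    intro a b c d hb hc hd h4
    have key' : ∀ b d, d < b → b < a → ¬ NdC4 nb a b c d := by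
      rintro b d hdb hb ⟨h1, h2, h3, h4, h5, h6, h7, h8⟩
      rcases h a c b d hc hdb hb h1 (hG.symm h4) h2 (hG.symm h3) with hh | hh
      · exact h7 hh
      · exact h5 hh
    rcases lt_trichotomy b d with hbd | rfl | hbd
    · exact key' d b hbd hd (NdC4.reverse hG h4)
    · exact h4.2.2.2.2.2.2.1 subset_rfl
    · exact key' b d hbd hb h4
  intro h4
  have e1 := hG.ne h4.1; have e2 := hG.ne h4.2.1; have e3 := hG.ne h4.2.2.1; have e4 := hG.ne h4.2.2.2.1
  have e5 : a ≠ c := by rintro rfl; exact h4.2.2.2.2.1 subset_rfl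
  have e6 : b ≠ d := by rintro rfl; exact h4.2.2.2.2.2.2.1 subset_rfl
  have r1 := NdC4.rotate hG h4
  have r2 := NdC4.rotate hG r1
  have r3 := NdC4.rotate hG r2
  by_cases ha : b < a ∧ c < a ∧ d < a
  · exact key _ _ _ _ ha.1 ha.2.1 ha.2.2 h4
  by_cases hb : c < b ∧ d < b ∧ a < b
  · exact key _ _ _ _ hb.1 hb.2.1 hb.2.2 r1
  by_cases hc : d < c ∧ a < c ∧ b < c
  · exact key _ _ _ _ hc.1 hc.2.1 hc.2.2 r2
  · exact key d a b c (by omega) (by omega) (by omega) r3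

/-! ### The next dominating vertex, and `C₅`s and `C₆`s adapted to it -/

section Next
variable {π : ℕ → ℕ} (hπ : IsNext n nb π)
include hπ

/-- Vertices with the same next dominating vertex are incomparable. -/
theorem not_subset_of_next_eq {w w' : ℕ} (hw : w < n) (hw' : w' < n) (h0 : (nb w).Nonempty)
    (h0' : (nb w').Nonempty) (hne : w ≠ w') (h : π w = π w') : ¬ nb w ⊆ nb w' := by
  have key : ∀ w w', w < n → w' < n → (nb w).Nonempty → (nb w').Nonempty → w < w' → π w = π w' →
      ¬ nb w ⊆ nb w' := fun w w' hw hw' h0 h0' hlt h hs =>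
    (hπ w hw h0).2.2.2 w' hlt (h ▸ (hπ w' hw' h0').1) hs
  rcases lt_or_gt_of_ne hne with hlt | hlt
  · exact key w w' hw hw' h0 h0' hlt h
  · exact hG.not_subset_of_lt hlt hw (key w' w hw' hw h0' h0 hlt h.symm)

/-- Two vertices with equal `π` have at most one common neighbour for each value of `π`. -/
theorem next_unique (h4 : ∀ a b c d, ¬ NdC4 nb a b c d) {v w s t : ℕ} (hs : s ∈ nb v)
    (ht : t ∈ nb v) (hs' : s ∈ nb w) (ht' : t ∈ nb w) (hvw : v ≠ w) (hst : s ≠ t)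
    (h1 : π v = π w) (h2 : π s = π t) : False := by
  have nv : (nb v).Nonempty := ⟨s, hs⟩
  have nw : (nb w).Nonempty := ⟨s, hs'⟩
  have ns : (nb s).Nonempty := ⟨v, hG.symm hs⟩
  have nt : (nb t).Nonempty := ⟨v, hG.symm ht⟩
  have lv := hG.lt' hs; have lw := hG.lt' hs'; have ls := hG.lt hs; have lt := hG.lt ht
  -- Both pairs of opposite vertices have equal `π` and are therefore incomparable.
  exact h4 v s w t ⟨hs, hG.symm hs', ht', hG.symm ht,
    hG.not_subset_of_next_eq hπ lw lv nw nv hvw.symm h1.symm,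
    hG.not_subset_of_next_eq hπ lv lw nv nw hvw h1,
    hG.not_subset_of_next_eq hπ lt ls nt ns hst.symm h2.symm,
    hG.not_subset_of_next_eq hπ ls lt ns nt hst h2⟩

/-- `π` is determined by the set of later dominating vertices, since it is the first of them. -/
theorem next_eq_of_iff {a c : ℕ} (ha : a < n) (hc : c < n) (na : (nb a).Nonempty)
    (nc : (nb c).Nonempty) (h : ∀ y, y < n → ((a < y ∧ nb a ⊆ nb y) ↔ (c < y ∧ nb c ⊆ nb y))) :
    π a = π c := by
  obtain ⟨a1, a2, a3, a4⟩ := hπ a ha na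
  obtain ⟨c1, c2, c3, c4⟩ := hπ c hc nc
  rcases lt_trichotomy (π a) (π c) with hlt | heq | hlt
  · have := (h (π a) (by omega)).1 ⟨a1, a3 (by omega)⟩
    exact absurd this.2 (c4 _ this.1 hlt)
  · exact heq
  · have := (h (π c) (by omega)).2 ⟨c1, c3 (by omega)⟩
    exact absurd this.2 (a4 _ this.1 hlt)

theorem next_eq_of_forall {a : ℕ} (ha : a < n) (na : (nb a).Nonempty)
    (h : ∀ y, y < n → a < y → ¬ nb a ⊆ nb y) : π a = n := by
  obtain ⟨a1, a2, a3, a4⟩ := hπ a ha na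
  by_contra hne
  exact h (π a) (by omega) a1 (a3 (by omega))

omit hπ in
theorem C5.rotate {a b c d e : ℕ} (h : C5 nb a b c d e) : C5 nb b c d e a :=
  ⟨h.2.1, h.2.2.1, h.2.2.2.1, h.2.2.2.2, h.1⟩

omit hπ in
theorem C5.replace {a b c d e y : ℕ} (h : C5 nb a b c d e) (hy : nb a ⊆ nb y) :
    C5 nb y b c d e :=
  ⟨hy h.1, h.2.1, h.2.2.1, h.2.2.2.1, hG.symm (hy (hG.symm h.2.2.2.2))⟩

omit hG hπ in
/-- A bounded nonempty set of numbers has a greatest element. -/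
theorem exists_greatest {P : ℕ → Prop} (N : ℕ) (hP : ∀ k, P k → k ≤ N) (h : ∃ k, P k) :
    ∃ k, P k ∧ ∀ l, P l → l ≤ k := by
  classical
  obtain ⟨k, hk⟩ := h
  exact ⟨_, Nat.findGreatest_spec (hP k hk) hk, fun l hl => Nat.le_findGreatest (hP l hl) hl⟩

/-- If there is a `C₅`, then there is one without dominated vertices, starting at its last vertex. -/
theorem C5.exists_next {a b c d e : ℕ} (h : C5 nb a b c d e) :
    ∃ a b c d e, C5 nb a b c d e ∧ b < a ∧ e < a ∧ π a = n ∧ π b = n ∧ π c = n ∧ π d = n ∧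
      π e = n := by
  -- Take a `C₅` with the largest sum of indices. Replacing a vertex by a later one that dominates
  -- it keeps a `C₅` and increases the sum, so no vertex has a later dominator.
  obtain ⟨k, ⟨a, b, c, d, e, h, hk⟩, hmax⟩ := exists_greatest
    (P := fun k => ∃ a b c d e, C5 nb a b c d e ∧ a + b + c + d + e = k) (5 * n)
    (by
      rintro k ⟨a, b, c, d, e, h, rfl⟩
      have := hG.lt h.1; have := hG.lt h.2.1; have := hG.lt h.2.2.1; have := hG.lt h.2.2.2.1
      have := hG.lt h.2.2.2.2
      omega) ⟨_, a, b, c, d, e, h, rfl⟩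
  have hn : ∀ a b c d e, C5 nb a b c d e → a + b + c + d + e = k → π a = n := by
    intro a b c d e h hk
    refine hG.next_eq_of_forall hπ (hG.lt' h.1) ⟨b, h.1⟩ fun y hy hay hs => ?_
    have := hmax _ ⟨y, b, c, d, e, C5.replace hG h hs, rfl⟩
    omega
  have r1 := C5.rotate hG h
  have r2 := C5.rotate hG r1
  have r3 := C5.rotate hG r2
  have r4 := C5.rotate hG r3
  have ha := hn _ _ _ _ _ h hk
  have hb := hn _ _ _ _ _ r1 (by omega)
  have hc := hn _ _ _ _ _ r2 (by omega)
  have hd := hn _ _ _ _ _ r3 (by omega)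
  have he := hn _ _ _ _ _ r4 (by omega)
  have e1 := hG.ne h.1; have e2 := hG.ne h.2.1; have e3 := hG.ne h.2.2.1
  have e4 := hG.ne h.2.2.2.1; have e5 := hG.ne h.2.2.2.2
  by_cases c1 : b < a ∧ e < a
  · exact ⟨a, b, c, d, e, h, c1.1, c1.2, ha, hb, hc, hd, he⟩
  by_cases c2 : c < b ∧ a < b
  · exact ⟨b, c, d, e, a, r1, c2.1, c2.2, hb, hc, hd, he, ha⟩
  by_cases c3 : d < c ∧ b < c
  · exact ⟨c, d, e, a, b, r2, c3.1, c3.2, hc, hd, he, ha, hb⟩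
  by_cases c4 : e < d ∧ c < d
  · exact ⟨d, e, a, b, c, r3, c4.1, c4.2, hd, he, ha, hb, hc⟩
  · exact ⟨e, a, b, c, d, r4, by omega, by omega, he, ha, hb, hc, hd⟩

omit hπ in
theorem C6.rotate {a b c d e f : ℕ} (h : C6 nb a b c d e f) : C6 nb b c d e f a := by
  obtain ⟨h1, h2, h3, h4, h5, h6, h7, h8, h9⟩ := h
  exact ⟨h2, h3, h4, h5, h6, h1, h8, h9, fun hh => h7 (hG.symm hh)⟩

omit hπ in
theorem C6.replace {a b c d e f y : ℕ} (h : C6 nb a b c d e f) (hy : nb a ⊆ nb y) (hd : d ∉ nb y) :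
    C6 nb y b c d e f := by
  obtain ⟨h1, h2, h3, h4, h5, h6, h7, h8, h9⟩ := h
  exact ⟨hy h1, h2, h3, h4, h5, hG.symm (hy (hG.symm h6)), hd, h8, h9⟩

omit hπ in
/-- A vertex that dominates `a` and is adjacent to the opposite vertex dominates all other vertices
of the same side of the `C₆`. -/
theorem C6.dominates (h4 : ∀ a b c d, ¬ NdC4 nb a b c d) {a b c d e f y : ℕ}
    (h : C6 nb a b c d e f) (hy : nb a ⊆ nb y) (hd : d ∈ nb y) :
    (c < y ∧ nb c ⊆ nb y) ∧ (e < y ∧ nb e ⊆ nb y) := by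
  obtain ⟨h1, h2, h3, h4', h5, h6, h7, h8, h9⟩ := h
  have yb : b ∈ nb y := hy h1
  have yf : f ∈ nb y := hy (hG.symm h6)
  have ly := hG.lt' yb
  -- A proper inclusion of neighbourhoods means a larger degree, hence a later position.
  have lt : ∀ x < n, nb x ⊆ nb y → (∃ z ∈ nb y, z ∉ nb x) → x < y := by
    rintro x hxn hx ⟨z, hz, hz'⟩
    by_contra hle
    have := Finset.card_lt_card (Finset.ssubset_iff_subset_ne.2 ⟨hx, fun he => hz' (he ▸ hz)⟩)
    have := hG.mono (not_lt.1 hle) hxn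
    omega
  -- Otherwise `y b c d` is a non-dominated `C₄`, with witnesses `f` (adjacent to `y` but not `c`),
  -- `e` (to `d` but not `b`) and `a` (to `b` but not `d`).
  have hc : nb c ⊆ nb y := by
    by_contra hc
    exact h4 y b c d ⟨yb, h2, h3, hG.symm hd, hc, fun hs => h9 (hs yf),
      fun hs => h8 (hs h4'), fun hs => h7 (hG.symm (hs (hG.symm h1)))⟩
  have he : nb e ⊆ nb y := by
    by_contra hc
    exact h4 y f e d ⟨yf, hG.symm h5, hG.symm h4', hG.symm hd, hc,
      fun hs => h8 (hG.symm (hs yb)), fun hs => h9 (hG.symm (hs (hG.symm h3))),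
      fun hs => h7 (hG.symm (hs h6))⟩
  exact ⟨⟨lt c (hG.lt h2) hc ⟨f, yf, h9⟩, hc⟩, lt e (hG.lt h4') he ⟨b, yb, fun hb => h8 (hG.symm hb)⟩, he⟩

/-- If there is an induced `C₆` in a graph without non-dominated `C₄`, then there is one in which `π`
is constant on both sides, starting at its last vertex. -/
theorem C6.exists_next (h4 : ∀ a b c d, ¬ NdC4 nb a b c d) {a b c d e f : ℕ}
    (h : C6 nb a b c d e f) :
    ∃ a b c d e f, C6 nb a b c d e f ∧ b < a ∧ f < a ∧ π c = π a ∧ π e = π a ∧ π d = π b ∧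
      π f = π b := by
  obtain ⟨k, ⟨a, b, c, d, e, f, h, hk⟩, hmax⟩ := exists_greatest
    (P := fun k => ∃ a b c d e f, C6 nb a b c d e f ∧ a + b + c + d + e + f = k) (6 * n)
    (by
      rintro k ⟨a, b, c, d, e, f, h, rfl⟩
      have := hG.lt h.1; have := hG.lt h.2.1; have := hG.lt h.2.2.1; have := hG.lt h.2.2.2.1
      have := hG.lt h.2.2.2.2.1; have := hG.lt h.2.2.2.2.2.1
      omega) ⟨_, a, b, c, d, e, f, h, rfl⟩
  -- By maximality of the sum, a later dominator `y` of `a` cannot replace `a`. So `y` is adjacent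
  -- to the opposite vertex `d`, and then it dominates the whole side of `a`.
  have hn : ∀ a b c d e f, C6 nb a b c d e f → a + b + c + d + e + f = k → ∀ y, a < y →
      nb a ⊆ nb y → (c < y ∧ nb c ⊆ nb y) ∧ (e < y ∧ nb e ⊆ nb y) := by
    intro a b c d e f h hk y hay hs
    by_cases hd : d ∈ nb y
    · exact C6.dominates hG h4 h hs hd
    · have := hmax _ ⟨y, b, c, d, e, f, C6.replace hG h hs hd, rfl⟩
      omega
  -- Applied to the cycle and to its rotation by two, this shows that `a` and `c` have the same
  -- later dominators.
  have hp : ∀ a b c d e f, C6 nb a b c d e f → a + b + c + d + e + f = k → π c = π a := by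
    intro a b c d e f h hk
    have r2 := C6.rotate hG (C6.rotate hG h)
    refine hG.next_eq_of_iff hπ (hG.lt h.2.1) (hG.lt' h.1) ⟨d, h.2.2.1⟩ ⟨b, h.1⟩ fun y hy =>
      ⟨fun hh => (hn _ _ _ _ _ _ r2 (by omega) y hh.1 hh.2).2,
        fun hh => (hn _ _ _ _ _ _ h hk y hh.1 hh.2).1⟩
  have r1 := C6.rotate hG h
  have r2 := C6.rotate hG r1
  have r3 := C6.rotate hG r2
  have r4 := C6.rotate hG r3
  have r5 := C6.rotate hG r4
  have q0 := hp _ _ _ _ _ _ h hk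
  have q1 := hp _ _ _ _ _ _ r1 (by omega)
  have q2 := hp _ _ _ _ _ _ r2 (by omega)
  have q3 := hp _ _ _ _ _ _ r3 (by omega)
  have e1 := hG.ne h.1; have e2 := hG.ne h.2.1; have e3 := hG.ne h.2.2.1
  have e4 := hG.ne h.2.2.2.1; have e5 := hG.ne h.2.2.2.2.1; have e6 := hG.ne h.2.2.2.2.2.1
  by_cases c1 : b < a ∧ f < a
  · exact ⟨a, b, c, d, e, f, h, c1.1, c1.2, by omega, by omega, by omega, by omega⟩
  by_cases c2 : c < b ∧ a < b
  · exact ⟨b, c, d, e, f, a, r1, c2.1, c2.2, by omega, by omega, by omega, by omega⟩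
  by_cases c3 : d < c ∧ b < c
  · exact ⟨c, d, e, f, a, b, r2, c3.1, c3.2, by omega, by omega, by omega, by omega⟩
  by_cases c4 : e < d ∧ c < d
  · exact ⟨d, e, f, a, b, c, r3, c4.1, c4.2, by omega, by omega, by omega, by omega⟩
  by_cases c5 : f < e ∧ d < e
  · exact ⟨e, f, a, b, c, d, r4, c5.1, c5.2, by omega, by omega, by omega, by omega⟩
  · exact ⟨f, a, b, c, d, e, r5, by omega, by omega, by omega, by omega, by omega, by omega⟩

end Next
end SortedGraph

/-! ## Proof rules -/

namespace RAM

variable {V A : Type} [DecidableEq V] [DecidableEq A] {E : Env A}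

@[simp] theorem Store.arr_put (s : Store V A) (a b : A) (i k : ℕ) :
    (s.put a i k).arr b = if b = a then Function.update (s.arr a) i k else s.arr b := by
  split_ifs with h
  · subst h; simp
  · exact Store.arr_put_of_ne _ _ _ h

@[simp] theorem Expr.eval_lt_eq_zero {s : Store V A} {e f : Expr V A} :
    (e.lt f).eval s = 0 ↔ f.eval s ≤ e.eval s := Nat.sub_eq_zero_iff_le

@[simp] theorem Expr.eval_ne_eq_zero {s : Store V A} {e f : Expr V A} :
    (e.ne f).eval s = 0 ↔ e.eval s = f.eval s := by
  simp only [Expr.ne, Expr.eval]; omega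

@[simp] theorem Expr.safe_lt {s : Store V A} {e f : Expr V A} :
    (e.lt f).Safe E s ↔ f.Safe E s ∧ e.Safe E s := Iff.rfl

@[simp] theorem Expr.safe_ne {s : Store V A} {e f : Expr V A} :
    (e.ne f).Safe E s ↔ e.Safe E s ∧ f.Safe E s := by
  simp only [Expr.ne, Expr.Safe]; tauto

section
variable {Q : Store V A → Prop} {s : Store V A}

@[simp] theorem Expr.safe_lit {k : ℕ} : (Expr.lit k : Expr V A).Safe E s := trivial
@[simp] theorem Expr.safe_var {x : V} : (Expr.var x : Expr V A).Safe E s := trivial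
@[simp] theorem Expr.safe_add {e f : Expr V A} :
    (e.add f).Safe E s ↔ e.Safe E s ∧ f.Safe E s := Iff.rfl
@[simp] theorem Expr.safe_sub {e f : Expr V A} :
    (e.sub f).Safe E s ↔ e.Safe E s ∧ f.Safe E s := Iff.rfl
@[simp] theorem Expr.safe_get {a : A} {e : Expr V A} :
    (e.get a).Safe E s ↔ e.Safe E s ∧ e.eval s < E.size a := Iff.rfl
@[simp] theorem Expr.eval_lit {k : ℕ} : (Expr.lit k : Expr V A).eval s = k := rfl
@[simp] theorem Expr.eval_var {x : V} : (Expr.var x : Expr V A).eval s = s.var x := rfl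
@[simp] theorem Expr.eval_add {e f : Expr V A} : (e.add f).eval s = e.eval s + f.eval s := rfl
@[simp] theorem Expr.eval_sub {e f : Expr V A} : (e.sub f).eval s = e.eval s - f.eval s := rfl
@[simp] theorem Expr.eval_get {a : A} {e : Expr V A} : (e.get a).eval s = s.arr a (e.eval s) := rfl

@[simp] theorem Stmt.wp_skip : (Stmt.skip : Stmt V A).wp E Q s ↔ Q s := Iff.rfl
@[simp] theorem Stmt.wp_assign {x : V} {e : Expr V A} : (Stmt.assign x e).wp E Q s ↔
    e.Safe E s ∧ e.eval s < E.bd ∧ Q (s.set x (e.eval s)) := Iff.rfl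
@[simp] theorem Stmt.wp_store {a : A} {i e : Expr V A} : (Stmt.store a i e).wp E Q s ↔
    i.Safe E s ∧ e.Safe E s ∧ i.eval s < E.size a ∧ e.eval s < E.bd ∧
      Q (s.put a (i.eval s) (e.eval s)) := Iff.rfl
@[simp] theorem Stmt.wp_seq {c d : Stmt V A} : (c.seq d).wp E Q s ↔ c.wp E (d.wp E Q) s := Iff.rfl
@[simp] theorem Stmt.wp_ite {e : Expr V A} {c d : Stmt V A} : (Stmt.ite e c d).wp E Q s ↔
    e.Safe E s ∧ (e.eval s ≠ 0 → c.wp E Q s) ∧ (e.eval s = 0 → d.wp E Q s) := Iff.rfl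
@[simp] theorem Stmt.wp_report {es : List (Expr V A)} : (Stmt.report es).wp E Q s ↔
    (∀ e ∈ es, e.Safe E s) ∧ es ≠ [] ∧ es.length ≤ 6 ∧ E.ok (es.map (Expr.eval s)) ∧
      s.time ≤ E.tmax := Iff.rfl

end

/-- The loop rule with time accounting: each iteration is paid for by `cost` and by the decrease of
the potential `Φ`. -/
theorem Stmt.wp_for {x h : V} {lo hi : Expr V A} {c : Stmt V A} {Q : Store V A → Prop}
    {s : Store V A} (I : ℕ → Store V A → Prop) (Φ : (A → ℕ → ℕ) → ℕ) (cost : ℕ → ℕ)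
    {l r : ℕ} (hl : lo.eval s = l) (hr : hi.eval s = r)
    (hlo : lo.Safe E s) (hhi : hi.Safe E s) (hle : l ≤ r) (hbd : r < E.bd)
    (hx : x ∉ c.vars ∧ h ∉ c.vars ∧ x ≠ h)
    (ht : s.time + Φ s.arr + ∑ k ∈ Finset.Ico l r, cost k ≤ E.tmax)
    (h0 : I l ((s.set x l).set h r))
    (hstep : ∀ k s', l ≤ k → k < r → I k s' → s'.var x = k →
      Frame (x :: h :: c.vars) c.arrs s s' → s'.time + Φ s'.arr + cost k ≤ E.tmax →
      c.wp E (fun s'' => I (k + 1) (s''.set x (k + 1)) ∧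
        s''.time + Φ s''.arr ≤ s'.time + Φ s'.arr + cost k) s'.tick)
    (hend : ∀ s', I r s' → Frame (x :: h :: c.vars) c.arrs s s' →
      s'.time + Φ s'.arr ≤ s.time + Φ s.arr + ∑ k ∈ Finset.Ico l r, cost k → Q s') :
    (Stmt.loop x h lo hi c).wp E Q s := by
  subst hl hr
  refine Stmt.wp_loop (fun k s' => I k s' ∧ s'.time + Φ s'.arr + ∑ j ∈ Finset.Ico k (hi.eval s), cost j ≤
    s.time + Φ s.arr + ∑ j ∈ Finset.Ico (lo.eval s) (hi.eval s), cost j) hlo hhi hle hbd hx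
    ⟨h0, le_rfl⟩ ?_ ?_
  · rintro k s' h1 h2 ⟨h3, h4⟩ h5 h6
    rw [Finset.sum_eq_sum_Ico_succ_bot h2] at h4
    refine Stmt.wp_mono (hstep k s' h1 h2 h3 h5 h6 (by omega)) ?_
    rintro s'' ⟨h7, h8⟩
    refine ⟨h7, ?_⟩
    simp only [Store.time_set, Store.arr_set]
    omega
  · rintro s' ⟨h1, h2⟩ h3
    exact hend s' h1 h3 (by simpa using h2)

/-! ### Array segments that enumerate finite sets -/

/-- The values of `f` on the interval from `l` to `r` are the elements of `S`, once each. -/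
structure IsSeg (f : ℕ → ℕ) (l r : ℕ) (S : Finset ℕ) : Prop where
  le : l ≤ r
  bij : Set.BijOn f (Set.Ico l r) S

theorem IsSeg.mem {f : ℕ → ℕ} {l r i : ℕ} {S : Finset ℕ} (h : IsSeg f l r S) (h1 : l ≤ i)
    (h2 : i < r) : f i ∈ S := h.bij.mapsTo ⟨h1, h2⟩

theorem IsSeg.card {f : ℕ → ℕ} {l r : ℕ} {S : Finset ℕ} (h : IsSeg f l r S) : S.card = r - l := by
  classical
  have : S = (Finset.Ico l r).image f := by
    apply Finset.coe_injective
    rw [← h.bij.image_eq]; simp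
  rw [this, Finset.card_image_of_injOn (by simpa using h.bij.injOn)]
  simp

theorem IsSeg.congr {f g : ℕ → ℕ} {l r : ℕ} {S : Finset ℕ} (h : IsSeg f l r S)
    (hg : ∀ i, l ≤ i → i < r → g i = f i) : IsSeg g l r S :=
  ⟨h.le, h.bij.congr fun i hi => (hg i hi.1 hi.2).symm⟩

theorem IsSeg.snoc {f : ℕ → ℕ} {l r k : ℕ} {S : Finset ℕ} (h : IsSeg f l r S) (hk : k ∉ S) :
    IsSeg (Function.update f r k) l (r + 1) (insert k S) := by
  have h' := h.congr (g := Function.update f r k) fun i _ hi => by simp [hi.ne]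
  refine ⟨h.le.trans (Nat.le_succ r), ?_⟩
  rw [show Set.Ico l (r + 1) = insert r (Set.Ico l r) by
    ext i; have := h.le; simp only [Set.mem_Ico, Set.mem_insert_iff]; omega, Finset.coe_insert]
  have := h'.bij.insert (a := r) (by simpa using hk)
  simpa using this

theorem IsSeg.empty (f : ℕ → ℕ) (l : ℕ) : IsSeg f l l ∅ := ⟨le_rfl, by simp⟩

/-- Run `c` for `u = a[lo], …, a[hi - 1]`. -/
def Stmt.each (a : A) (x h u : V) (lo hi : Expr V A) (c : Stmt V A) : Stmt V A :=
  .loop x h lo hi (.seq (.assign u (.get a (.var x))) c)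

/-- The rule for loops over the values in a segment of an array. -/
theorem Stmt.wp_each {a : A} {x h u : V} {lo hi : Expr V A} {c : Stmt V A} {Q : Store V A → Prop}
    {s : Store V A} (I : Finset ℕ → Store V A → Prop) (Φ : (A → ℕ → ℕ) → ℕ) (cost : ℕ → ℕ)
    {l r : ℕ} {S : Finset ℕ} (hS : IsSeg (s.arr a) l r S) (hl : lo.eval s = l) (hr : hi.eval s = r)
    (hlo : lo.Safe E s) (hhi : hi.Safe E s) (hbd : r < E.bd) (hsz : r ≤ E.size a)
    (hSb : ∀ k ∈ S, k < E.bd) (hx : x ∉ c.vars ∧ h ∉ c.vars ∧ x ≠ h ∧ x ≠ u ∧ h ≠ u ∧ a ∉ c.arrs)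
    (ht : s.time + Φ s.arr + ∑ k ∈ S, cost k ≤ E.tmax)
    (h0 : I ∅ ((s.set x l).set h r))
    (hstep : ∀ P k s', P ⊆ S → k ∈ S → k ∉ P → I P s' →
      Frame (x :: h :: u :: c.vars) c.arrs s s' → s'.time + Φ s'.arr + cost k ≤ E.tmax →
      c.wp E (fun s'' => (∀ j, I (insert k P) (s''.set x j)) ∧
        s''.time + Φ s''.arr ≤ s'.time + Φ s'.arr + cost k) (s'.tick.set u k))
    (hend : ∀ s', I S s' → Frame (x :: h :: u :: c.vars) c.arrs s s' →
      s'.time + Φ s'.arr ≤ s.time + Φ s.arr + ∑ k ∈ S, cost k → Q s') :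
    (Stmt.each a x h u lo hi c).wp E Q s := by
  classical
  have hfull : (Finset.Ico l r).image (s.arr a) = S := by
    apply Finset.coe_injective
    rw [← hS.bij.image_eq]; simp
  have hsum : ∑ k ∈ Finset.Ico l r, cost (s.arr a k) = ∑ k ∈ S, cost k := by
    rw [← hfull, Finset.sum_image (by simpa using hS.bij.injOn)]
  refine Stmt.wp_for (fun k s' => I ((Finset.Ico l k).image (s.arr a)) s') Φ
    (fun k => cost (s.arr a k)) hl hr hlo hhi hS.le hbd ?_ (by rw [hsum]; exact ht)
    (by simpa using h0) ?_ ?_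
  · simp only [Stmt.vars, not_or, List.singleton_append,
      List.mem_cons]
    tauto
  · intro k s' h1 h2 h3 h4 h5 h6
    have ha : s'.arr a = s.arr a := h5.arr a (by simpa [Stmt.arrs] using hx.2.2.2.2.2)
    have hk : s.arr a k ∈ S := hS.mem h1 h2
    refine ⟨?_, ?_, ?_⟩
    · simp only [Expr.Safe, Expr.eval, Store.var_tick, true_and, h4]
      omega
    · simpa only [Expr.eval, Store.var_tick, Store.arr_tick, h4, ha] using hSb _ hk
    · simp only [Expr.eval, Store.var_tick, Store.arr_tick, h4, ha]
      refine Stmt.wp_mono (hstep ((Finset.Ico l k).image (s.arr a)) _ s' ?_ hk ?_ h3 ?_ h6) ?_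
      · rw [← hfull]
        exact Finset.image_subset_image (Finset.Ico_subset_Ico_right h2.le)
      · intro hm
        obtain ⟨j, hj, hjk⟩ := Finset.mem_image.1 hm
        rw [Finset.mem_Ico] at hj
        have := hS.bij.injOn ⟨hj.1, by omega⟩ ⟨h1, h2⟩ hjk
        omega
      · exact h5.mono (by simp [Stmt.vars]) (by simp [Stmt.arrs])
      · rintro s'' ⟨h7, h8⟩
        refine ⟨?_, h8⟩
        rw [show Finset.Ico l (k + 1) = insert k (Finset.Ico l k) by ext; simp; omega, Finset.image_insert]
        exact h7 _
  · intro s' h1 h2 h3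
    rw [hfull] at h1
    rw [hsum] at h3
    exact hend s' h1 (h2.mono (by simp [Stmt.vars]) (by simp [Stmt.arrs])) h3

end RAM

/-! ## The program: common parts -/

namespace BicliqueHelly

open RAM

/-- The variables of the program. -/
inductive Var : Type
  | n | m | i₁ | h₁ | i₂ | h₂ | i₃ | h₃ | i₄ | h₄ | im | hm | um | hv
  | v | u | w | x | y | z | p | q | a | b | s | t | r
  deriving DecidableEq

/-- The arrays of the program. -/
inductive Arr : Type
  | adj | off | ord | rk | st | en | mA | mB | mC | mD | pa | pb | last | next | list | fin
  | par | parV | seen | seenV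
  deriving DecidableEq

instance : Coe Var (Expr Var Arr) := ⟨.var⟩

/-- Statements of the program. -/
abbrev Prog : Type := Stmt Var Arr

/-- Stores of the program. -/
abbrev Mem : Type := Store Var Arr

infixr:50 " ;; " => Stmt.seq

/-- Run `c` for all `u` in the list of neighbours of `r`. -/
def forNbr (x h u r : Var) (c : Prog) : Prog :=
  .each .adj x h u (.get .st r) (.get .en r) c

/-- Mark the neighbours of `x` in the array `a`. -/
def mark (a : Arr) (x : Var) : Prog :=
  forNbr .im .hm .um x (.store a (.var .um) (.add (.var x) (.lit 1)))

/-- A graph on `0, …, n - 1` in sorted order, represented in memory, and the requirements on the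
output. -/
structure Ctx : Type where
  n : ℕ
  N : ℕ
  tmax : ℕ
  nb : ℕ → Finset ℕ
  adj : ℕ → ℕ
  st : ℕ → ℕ
  en : ℕ → ℕ
  ord : ℕ → ℕ
  ok : List ℕ → Prop
  graph : SortedGraph n nb
  n_lt : n < N
  seg : ∀ r < n, IsSeg adj (st r) (en r) (nb r)
  en_le : ∀ r < n, en r ≤ N
  sep : ∀ r < n, ∀ r' < n, ∀ i, st r ≤ i → i < en r → st r' ≤ i → i < en r' → r = r'
  ok_tri : ∀ a b c, SortedGraph.Tri nb a b c → ok [ord a, ord b, ord c]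
  ok_ndC4 : ∀ a b c d, SortedGraph.NdC4 nb a b c d → ok [ord a, ord b, ord c, ord d]
  ok_C5 : (∀ a b c, ¬ SortedGraph.Tri nb a b c) → ∀ a b c d e, SortedGraph.C5 nb a b c d e →
    ok [ord a, ord b, ord c, ord d, ord e]
  ok_C6 : (∀ a b c, ¬ SortedGraph.Tri nb a b c) → ∀ a b c d e f, SortedGraph.C6 nb a b c d e f →
    ok [ord a, ord b, ord c, ord d, ord e, ord f]

/-- The environment of a context. -/
def Ctx.env (X : Ctx) : Env Arr where
  size := fun _ => X.N
  bd := X.N + 1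
  tmax := X.tmax
  ok := X.ok

@[simp] theorem Ctx.env_size (X : Ctx) (a : Arr) : X.env.size a = X.N := rfl
@[simp] theorem Ctx.env_bd (X : Ctx) : X.env.bd = X.N + 1 := rfl
@[simp] theorem Ctx.env_tmax (X : Ctx) : X.env.tmax = X.tmax := rfl
@[simp] theorem Ctx.env_ok (X : Ctx) : X.env.ok = X.ok := rfl

/-- The arrays that represent the graph. -/
def Arr.isStatic : Arr → Bool
  | .adj | .st | .en | .ord => true
  | _ => false

/-- The arrays for marks. -/
def Arr.isMark : Arr → Bool
  | .mA | .mB | .mC | .mD => true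
  | _ => false

/-- The store represents the graph, and all marks refer to neighbours. -/
structure Inv (X : Ctx) (s : Mem) : Prop where
  n : s.var .n = X.n
  adj : s.arr .adj = X.adj
  st : s.arr .st = X.st
  en : s.arr .en = X.en
  ord : s.arr .ord = X.ord
  mark : ∀ a : Arr, a.isMark → ∀ y v, s.arr a y = v + 1 → y ∈ X.nb v

section
variable {X : Ctx} {s s' : Mem}

theorem Inv.of_eq (h : Inv X s) (hn : s'.var .n = s.var .n)
    (ha : ∀ a : Arr, a.isStatic ∨ a.isMark → s'.arr a = s.arr a) : Inv X s' where
  n := hn.trans h.n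
  adj := (ha _ (by decide)).trans h.adj
  st := (ha _ (by decide)).trans h.st
  en := (ha _ (by decide)).trans h.en
  ord := (ha _ (by decide)).trans h.ord
  mark a hm := by rw [ha a (.inr hm)]; exact h.mark a hm

theorem Inv.set (h : Inv X s) {x : Var} (hx : x ≠ .n) (k : ℕ) : Inv X (s.set x k) :=
  h.of_eq (by simp [hx.symm]) fun _ _ => rfl

theorem Inv.tick (h : Inv X s) : Inv X s.tick := h.of_eq rfl fun _ _ => rfl

theorem Inv.put (h : Inv X s) {a : Arr} (ha : ¬ (a.isStatic ∨ a.isMark)) (i k : ℕ) :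
    Inv X (s.put a i k) :=
  h.of_eq rfl fun b hb => Store.arr_put_of_ne _ _ _ (by rintro rfl; exact ha hb)

@[simp] theorem Inv.set_iff {x : Var} (hx : x ≠ .n) {k : ℕ} : Inv X (s.set x k) ↔ Inv X s :=
  ⟨fun h => h.of_eq (by simp [hx.symm]) fun _ _ => rfl, fun h => h.set hx k⟩

@[simp] theorem Inv.tick_iff : Inv X s.tick ↔ Inv X s :=
  ⟨fun h => h.of_eq rfl fun _ _ => rfl, fun h => h.tick⟩

/-- The loop rule in the environment of a context. -/
theorem wp_for {x h : Var} {lo hi : Expr Var Arr} {c : Prog} {Q : Mem → Prop}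
    (I : ℕ → Mem → Prop) (Φ : (Arr → ℕ → ℕ) → ℕ) (cost : ℕ → ℕ) (r : ℕ)
    (hlo : lo.Safe X.env s) (hhi : hi.Safe X.env s) (hl : lo.eval s = 0) (hr : hi.eval s = r)
    (hbd : r ≤ X.N) (hx : x ∉ c.vars ∧ h ∉ c.vars ∧ x ≠ h)
    (ht : s.time + Φ s.arr + ∑ k ∈ Finset.range r, cost k ≤ X.tmax)
    (h0 : I 0 ((s.set x 0).set h r))
    (hstep : ∀ k s', k < r → I k s' → s'.var x = k →
      Frame (x :: h :: c.vars) c.arrs s s' → s'.time + Φ s'.arr + cost k ≤ X.tmax →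
      c.wp X.env (fun s'' => I (k + 1) (s''.set x (k + 1)) ∧
        s''.time + Φ s''.arr ≤ s'.time + Φ s'.arr + cost k) s'.tick)
    (hend : ∀ s', I r s' → Frame (x :: h :: c.vars) c.arrs s s' →
      s'.time + Φ s'.arr ≤ s.time + Φ s.arr + ∑ k ∈ Finset.range r, cost k → Q s') :
    (Stmt.loop x h lo hi c).wp X.env Q s :=
  Stmt.wp_for I Φ cost hl hr hlo hhi (Nat.zero_le _) (Nat.lt_succ_of_le hbd) hx
    (by simpa using ht) h0 (fun k s' _ => hstep k s')
    (fun s' h1 h2 h3 => hend s' h1 h2 (by simpa using h3))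

/-- The rule for loops over the neighbours of a vertex. -/
theorem wp_forNbr {x h u r : Var} {c : Prog} {Q : Mem → Prop} (I : Finset ℕ → Mem → Prop)
    (Φ : (Arr → ℕ → ℕ) → ℕ) (cost : ℕ → ℕ) (v : ℕ) (hI : Inv X s) (hr : s.var r = v) (hv : v < X.n)
    (hx : x ∉ c.vars ∧ h ∉ c.vars ∧ x ≠ h ∧ x ≠ u ∧ h ≠ u ∧ .adj ∉ c.arrs)
    (ht : s.time + Φ s.arr + ∑ k ∈ X.nb v, cost k ≤ X.tmax)
    (h0 : I ∅ ((s.set x (X.st v)).set h (X.en v)))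
    (hstep : ∀ P k s', P ⊆ X.nb v → k ∈ X.nb v → k ∉ P → I P s' →
      Frame (x :: h :: u :: c.vars) c.arrs s s' → s'.time + Φ s'.arr + cost k ≤ X.tmax →
      c.wp X.env (fun s'' => (∀ j, I (insert k P) (s''.set x j)) ∧
        s''.time + Φ s''.arr ≤ s'.time + Φ s'.arr + cost k) (s'.tick.set u k))
    (hend : ∀ s', I (X.nb v) s' → Frame (x :: h :: u :: c.vars) c.arrs s s' →
      s'.time + Φ s'.arr ≤ s.time + Φ s.arr + ∑ k ∈ X.nb v, cost k → Q s') :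
    (forNbr x h u r c).wp X.env Q s := by
  have h1 := X.en_le v hv
  have := X.n_lt
  refine Stmt.wp_each I Φ cost (l := X.st v) (r := X.en v) (S := X.nb v) ?_ ?_ ?_ ?_ ?_ ?_ ?_ ?_
    hx ht h0 hstep hend
  · rw [hI.adj]; exact X.seg v hv
  · simp [Expr.eval, hr, hI.st]
  · simp [Expr.eval, hr, hI.en]
  · simp [Expr.Safe, Expr.eval, hr]; omega
  · simp [Expr.Safe, Expr.eval, hr]; omega
  · simp; omega
  · simpa using h1
  · intro k hk
    have := X.graph.lt hk
    simp; omega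

/-- Marks are never cleared. The entry for a marking vertex `v` is `v + 1`, so `0` is no mark at
all, and by `Inv.mark` a stale entry `v + 1` in cell `y` still truthfully says that `y` is a
neighbour of `v`. -/
theorem wp_mark {a : Arr} {x : Var} {Q : Mem → Prop} (v : ℕ) (hI : Inv X s) (ha : a.isMark)
    (hr : s.var x = v) (hv : v < X.n) (hx : x ≠ .im ∧ x ≠ .hm ∧ x ≠ .um)
    (ht : s.time + (X.nb v).card ≤ X.tmax)
    (hend : ∀ s', Inv X s' → Frame [.im, .hm, .um] [a] s s' → s'.time ≤ s.time + (X.nb v).card →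
      (∀ y, s'.arr a y = v + 1 ↔ y ∈ X.nb v) → Q s') :
    (mark a x).wp X.env Q s := by
  have ha' : a ≠ .adj ∧ a ≠ .st ∧ a ≠ .en ∧ a ≠ .ord := by
    refine ⟨?_, ?_, ?_, ?_⟩ <;> (rintro rfl; cases ha)
  refine wp_forNbr (fun P s' => Inv X s' ∧ ∀ y ∈ P, s'.arr a y = v + 1) (fun _ => 0) (fun _ => 1) v hI
    hr hv ?_ ?_ ?_ ?_ ?_
  · simp [Stmt.vars, Stmt.arrs, ha'.1.symm]
  · simpa using ht
  · simpa using hI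
  · rintro P k s' hP hk hkP ⟨hs', hP'⟩ hf ht
    have hkn := X.graph.lt hk
    have := X.n_lt
    have hxv : s'.var x = v := by rw [hf.var x (by simp [hx, Stmt.vars])]; exact hr
    simp only [Stmt.wp, Expr.Safe, Expr.eval, Store.var_set, hx, hxv, Ctx.env_size, Ctx.env_bd,
      if_false, if_true, Store.var_tick, true_and, and_self]
    refine ⟨by omega, by omega, fun j => ⟨⟨?_, ?_, ?_, ?_, ?_, ?_⟩, ?_⟩, by simp⟩
    · simp [hs'.n]
    · simp [ha'.1.symm, hs'.adj]
    · simp [ha'.2.1.symm, hs'.st]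
    · simp [ha'.2.2.1.symm, hs'.en]
    · simp [ha'.2.2.2.symm, hs'.ord]
    · intro b hb y v'
      simp only [Store.arr_set, Store.arr_put, Store.arr_tick]
      split_ifs with hba
      · rw [Function.update_apply]
        split_ifs with hy
        · intro h
          have : v = v' := by omega
          rw [hy, ← this]; exact hk
        · exact hs'.mark a ha y v'
      · exact hs'.mark b hb y v'
    · intro y hy
      simp only [Store.arr_set, Store.arr_put, Store.arr_tick, if_true, Function.update_apply]
      split_ifs with hyk
      · rfl
      · exact hP' y ((Finset.mem_insert.1 hy).resolve_left hyk)
  · rintro s' ⟨h1, h2⟩ h3 h4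
    exact hend s' h1 (h3.mono (by simp [Stmt.vars]) (by simp [Stmt.arrs])) (by simpa using h4)
      fun y => ⟨h1.mark a ha y v, h2 y⟩

end

/-! ### Triangles -/

section
open Var Arr

/-- Search for triangles. -/
def findTriangle : Prog :=
  .loop v hv (.lit 0) n
    (mark mA v ;;
      forNbr i₁ h₁ u v (.ite (.lt u v)
        (forNbr i₂ h₂ w u (.ite (.ne (.get mA w) (.add v (.lit 1))) .skip
          (.report [.get ord v, .get ord u, .get ord w]))) .skip))

end

/-- The number of steps from a vertex to smaller neighbours and then to all neighbours. -/
def Ctx.low (X : Ctx) (v : ℕ) : ℕ := ∑ u ∈ X.nb v with u < v, (X.nb u).card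

theorem Ctx.low_eq (X : Ctx) (v : ℕ) :
    X.low v = ∑ u ∈ X.nb v, if u < v then (X.nb u).card else 0 := by
  rw [Ctx.low, Finset.sum_filter]

/-- Every triangle has an edge with ends `u < v`; scanning all neighbours of `u` against the marks
of `v` reveals its third vertex. Marking and scanning the neighbours of `v` account for twice its
degree, the inner scans for `X.low v`. -/
theorem wp_findTriangle {X : Ctx} {s : Mem} (hI : Inv X s)
    (ht : s.time + ∑ v ∈ Finset.range X.n, (1 + 2 * (X.nb v).card + X.low v) ≤ X.tmax) :
    findTriangle.wp X.env (fun s' => Inv X s' ∧ (∀ a b c, ¬ SortedGraph.Tri X.nb a b c) ∧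
      s'.time ≤ s.time + ∑ v ∈ Finset.range X.n, (1 + 2 * (X.nb v).card + X.low v)) s := by
  have hnN := X.n_lt
  refine wp_for (fun k s' => Inv X s' ∧ ∀ v < k, ∀ u ∈ X.nb v, u < v → ∀ w ∈ X.nb u, w ∉ X.nb v)
    (fun _ => 0) (fun v => 1 + 2 * (X.nb v).card + X.low v) X.n trivial trivial rfl hI.n hnN.le
    (by decide) (by simpa using ht) (by simpa using hI) ?_ ?_
  · rintro v s' hv ⟨hI', hT⟩ hvv - ht
    have hlow := X.low_eq v
    refine wp_mark v hI'.tick rfl hvv hv (by decide) (by simp; omega) fun s1 hI1 f1 t1 hA => ?_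
    have hv1 : s1.var .v = v := (f1.var .v (by decide)).trans hvv
    simp only [Store.time_tick] at t1
    refine wp_forNbr (fun P s' => Inv X s' ∧ ∀ u ∈ P, u < v → ∀ w ∈ X.nb u, w ∉ X.nb v)
      (fun _ => 0) (fun u => 1 + if u < v then (X.nb u).card else 0) v hI1 hv1 hv (by decide)
      ?_ (by simpa using hI1) ?_ ?_
    · simp [Finset.sum_add_distrib]; omega
    · rintro P u s2 - hu - ⟨hI2, hP⟩ f2 t2
      have hv2 : s2.var .v = v := (f2.var .v (by decide)).trans hv1
      have hun := X.graph.lt hu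
      simp only [Stmt.wp_ite, Expr.safe_lt, Expr.eval_lt_eq_zero, ne_eq, not_le]
      simp only [Expr.safe_var, Expr.eval_var, Store.var_set, Store.var_tick, hv2, reduceCtorEq,
        if_true, if_false, true_and]
      refine ⟨fun huv => ?_, fun huv => ?_⟩
      · rw [if_pos huv] at t2 ⊢
        refine wp_forNbr (fun P s' => Inv X s' ∧ ∀ w ∈ P, w ∉ X.nb v) (fun _ => 0) (fun _ => 1) u
          (by simpa using hI2) (by simp) hun (by decide) (by simp; omega) (by simpa using hI2) ?_ ?_
        · rintro P' w s3 - hw - ⟨hI3, hP'⟩ f3 t3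
          have hv3 : s3.var .v = v := (f3.var .v (by decide)).trans (by simp [hv2])
          have hu3 : s3.var .u = u := (f3.var .u (by decide)).trans (by simp)
          have hA3 : s3.arr .mA = s1.arr .mA :=
            (f3.arr .mA (by decide)).trans (f2.arr .mA (by decide))
          have hwn := X.graph.lt hw
          simp [hv3, hu3, hA3, hA, hI3, hI3.ord]
          exact ⟨by omega, fun h => ⟨h, hP'⟩, fun h => ⟨by omega,
            X.ok_tri _ _ _ ⟨hu, hw, X.graph.symm h⟩, by omega⟩⟩
        · rintro s3 ⟨hI3, hP'⟩ - t3
          simp [hI3] at t3 ⊢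
          exact ⟨⟨fun _ => hP', hP⟩, by omega⟩
      · simp [hI2]
        exact ⟨fun h => absurd h (by omega), hP⟩
    · rintro s2 ⟨hI2, hP⟩ - t2
      refine ⟨⟨by simpa using hI2, fun v' hv' => ?_⟩, ?_⟩
      · rcases Nat.lt_succ_iff_lt_or_eq.1 hv' with h | rfl
        exacts [hT v' h, hP]
      · simp [Finset.sum_add_distrib] at t2 ⊢; omega
  · rintro s' ⟨hI', hT⟩ - t
    refine ⟨hI', ?_, by simpa using t⟩
    rintro a b c ⟨h1, h2, h3⟩
    rcases lt_or_gt_of_ne (X.graph.ne h1) with h | h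
    · exact hT a (X.graph.lt' h1) b h1 h c h2 (X.graph.symm h3)
    · exact hT b (X.graph.lt h1) a (X.graph.symm h1) h c (X.graph.symm h3) h2

end BicliqueHelly

namespace BicliqueHelly

open RAM SortedGraph

/-! ### Oracles -/

section
open Var Arr

/-- Compute the first neighbour `p` of `w` and the first neighbour `q` after `w`. -/
def firstNbrs : Prog :=
  .assign p n ;; .assign q n ;;
  forNbr i₁ h₁ u w
    (.ite (.lt u p) (.assign p u) .skip ;;
      .ite (.lt w u) (.ite (.lt u q) (.assign q u) .skip) .skip)

/-- Compute a pair `a, b` of neighbours of `w`, either equal or incomparable. -/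
def findPair : Prog :=
  .assign a p ;; .assign b p ;;
  forNbr i₁ h₁ u w (.ite (.lt q u) .skip (mark mB u ;;
    forNbr i₂ h₂ y p (.ite (.lt w y)
      (.ite (.ne (.get mB y) (.add u (.lit 1))) (.assign b u) .skip) .skip))) ;;
  .ite (.lt q n)
    (.assign r (.get pa q) ;; .assign t (.get pb q) ;; mark mB r ;; mark mC t ;;
      forNbr i₁ h₁ z w (.ite (.lt q z)
        (.ite (.add (.ne (.get mB z) (.add r (.lit 1))) (.ne (.get mC z) (.add t (.lit 1))))
          (.assign a q ;; .assign b z) .skip) .skip))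
    .skip

/-- Check that all later common neighbours of `a` and `b` dominate `w`. -/
def verifyPair : Prog :=
  mark mC b ;; .assign x n ;;
  forNbr i₁ h₁ y a (.ite (.lt w y) (.ite (.ne (.get mC y) (.add b (.lit 1))) .skip
    (.ite (.lt y x) (.assign x y) .skip)) .skip) ;;
  .ite (.lt x n)
    (mark mD x ;;
      forNbr i₁ h₁ u w (.ite (.ne (.get mD u) (.add x (.lit 1)))
        (.report [.get ord a, .get ord w, .get ord b, .get ord x]) .skip) ;;
      .assign r (.get pa x) ;; .assign t (.get pb x) ;; mark mB r ;; mark mD t ;;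
      forNbr i₁ h₁ y a (.ite (.lt x y) (.ite (.ne (.get mC y) (.add b (.lit 1))) .skip
        (.ite (.add (.ne (.get mB y) (.add r (.lit 1))) (.ne (.get mD y) (.add t (.lit 1))))
          (.report [.get ord a, .get ord x, .get ord b, .get ord y]) .skip)) .skip))
    .skip

/-- Compute oracles for all vertices, the last one first. -/
def findOracles : Prog :=
  .loop v hv (.lit 0) n
    (.assign w (.sub n (.add v (.lit 1))) ;;
      .ite (.lt (.get st w) (.get en w))
        (firstNbrs ;; findPair ;; .ite (.ne a b) verifyPair .skip ;;
          .store pa w a ;; .store pb w b)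
        .skip)

end

section
variable {X : Ctx} {s : Mem}

theorem Ctx.card_le (X : Ctx) (v : ℕ) : (X.nb v).card ≤ X.n :=
  (Finset.card_le_card fun _ hu => Finset.mem_range.2 (X.graph.lt hu)).trans (Finset.card_range _).le

/-- `p` is the first neighbour of `w`, and `q` is the first neighbour after `w`, or `n`. -/
structure IsFirst (X : Ctx) (w p q : ℕ) : Prop where
  mem : p ∈ X.nb w
  le : ∀ u ∈ X.nb w, p ≤ u
  mem' : q < X.n → q ∈ X.nb w ∧ w < q
  le' : ∀ u ∈ X.nb w, w < u → q ≤ u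

/-- The start value `n` is a sentinel beyond all vertices. It remains in `q` when `w` has no later
neighbour, while `p` always drops below it because `w` has a neighbour. -/
theorem wp_firstNbrs {w : ℕ} (hI : Inv X s) (hw : s.var .w = w) (hn : (X.nb w).Nonempty)
    (ht : s.time + (X.nb w).card ≤ X.tmax) :
    firstNbrs.wp X.env (fun s' => Inv X s' ∧ IsFirst X w (s'.var .p) (s'.var .q) ∧
      s'.time ≤ s.time + (X.nb w).card) s := by
  have hnN := X.n_lt
  obtain ⟨u₀, hu₀⟩ := hn
  have hwn := X.graph.lt' hu₀
  simp only [firstNbrs, Stmt.wp_seq, Stmt.wp_assign, Expr.safe_var, Expr.eval_var, Store.var_set, hI.n, true_and, ite_self,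
    Ctx.env_bd]
  refine ⟨by omega, by omega, wp_forNbr (fun P s' => Inv X s' ∧
    (s'.var .p ≤ X.n ∧ (s'.var .p < X.n → s'.var .p ∈ X.nb w) ∧ ∀ u ∈ P, s'.var .p ≤ u) ∧
    (s'.var .q ≤ X.n ∧ (s'.var .q < X.n → s'.var .q ∈ X.nb w ∧ w < s'.var .q) ∧ ∀ u ∈ P, w < u → s'.var .q ≤ u))
    (fun _ => 0) (fun _ => 1) w (by simp [hI]) (by simp [hw]) hwn (by decide) (by simpa using ht)
    (by simp [hI]) ?_ ?_⟩
  · rintro P u s1 - hu - ⟨hI1, ⟨p0, p1, p2⟩, q0, q1, q2⟩ f1 -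
    have hw1 : s1.var .w = w := (f1.var .w (by decide)).trans (by simp [hw])
    have hun := X.graph.lt hu
    have hp : ∀ k, k ≤ s1.var .p → ∀ u' ∈ P, k ≤ u' := fun k hk u' hu' => hk.trans (p2 u' hu')
    have hq : ∀ k, k ≤ s1.var .q → ∀ u' ∈ P, w < u' → k ≤ u' := fun k hk u' hu' hw' => hk.trans (q2 u' hu' hw')
    simp only [Stmt.wp_ite, Expr.safe_lt, Expr.eval_lt_eq_zero, ne_eq, not_le, Stmt.wp_seq]
    simp [hw1, hI1, hu]
    clear f1
    grind
  · rintro s' ⟨h1, ⟨p0, p1, p2⟩, q0, q1, q2⟩ - t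
    have := p2 u₀ hu₀
    have := X.graph.lt hu₀
    exact ⟨h1, ⟨p1 (by omega), p2, q1, q2⟩, by simpa using t⟩

/-- The arrays `pa` and `pb` contain oracles for the vertices from `k` on. -/
def HasOracle (X : Ctx) (k : ℕ) (s : Mem) : Prop :=
  ∀ w, k ≤ w → w < X.n → (X.nb w).Nonempty → Oracle X.nb (s.arr .pa w) (s.arr .pb w) w

theorem HasOracle.of_eq {s' : Mem} {k : ℕ} (h : HasOracle X k s) (ha : s'.arr .pa = s.arr .pa)
    (hb : s'.arr .pb = s.arr .pb) : HasOracle X k s' := by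
  intro w h1 h2 h3
  rw [ha, hb]
  exact h w h1 h2 h3

/-- The possible results of the search for a pair. -/
def IsPair (X : Ctx) (w a b : ℕ) : Prop :=
  a ∈ X.nb w ∧ b ∈ X.nb w ∧ ((a = b ∧ ∀ y, w < y → y ∈ X.nb a → X.nb w ⊆ X.nb y) ∨
    (¬ X.nb a ⊆ X.nb b ∧ ¬ X.nb b ⊆ X.nb a))

/-- The vertex `p` alone is an oracle if each later neighbour of `p` is adjacent to all neighbours
of `w`. For neighbours `u ≤ q` this is tested directly; a failure makes `p` and `u` incomparable,
since `p` comes before `u`. Neighbours `z` after `q` are only tested for dominating `q`, by means of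
the oracle of `q`, which is already known; a failure makes `q` and `z` incomparable. -/
theorem wp_findPair {w p q : ℕ} (hI : Inv X s) (hO : HasOracle X (w + 1) s) (hw : s.var .w = w)
    (hp : s.var .p = p) (hq : s.var .q = q) (hpq : IsFirst X w p q)
    (ht : s.time + (6 * X.n + 2 * X.low w) ≤ X.tmax) :
    findPair.wp X.env (fun s' => Inv X s' ∧ IsPair X w (s'.var .a) (s'.var .b) ∧
      s'.time ≤ s.time + (6 * X.n + 2 * X.low w)) s := by
  have hnN := X.n_lt
  obtain ⟨hpw, hpl, hqw, hql⟩ := hpq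
  have hwn := X.graph.lt' hpw
  have hpn := X.graph.lt hpw
  have hcw := X.card_le w
  have hlow := X.low_eq w
  -- A neighbour before `w` costs at most twice its degree. The only other one that is scanned fully
  -- is `q`, at a cost of at most `2 * X.n`.
  have hsum : ∑ u ∈ X.nb w, (1 + (if u < w then 2 * (X.nb u).card else 0) +
      if u = q then 2 * X.n else 0) ≤ 3 * X.n + 2 * X.low w := by
    have h1 : ∑ u ∈ X.nb w, (if u < w then 2 * (X.nb u).card else 0) = 2 * X.low w := by
      rw [hlow, Finset.mul_sum]
      exact Finset.sum_congr rfl fun u _ => by split_ifs <;> simp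
    have h2 : ∑ u ∈ X.nb w, (if u = q then 2 * X.n else 0) ≤ 2 * X.n := by
      rw [Finset.sum_ite_eq']; split_ifs <;> simp
    simp only [Finset.sum_add_distrib, h1, Finset.sum_const, smul_eq_mul, mul_one]
    omega
  simp only [findPair, Stmt.wp_seq, Stmt.wp_assign, Expr.safe_var, Expr.eval_var, Store.var_set, hp,
    true_and, Ctx.env_bd, reduceCtorEq, if_false]
  refine ⟨by omega, by omega, wp_forNbr (fun P s' => Inv X s' ∧ s'.var .a = p ∧ s'.var .b ∈ X.nb w ∧
      ((s'.var .b = p ∧ ∀ u ∈ P, u ≤ q → ∀ y ∈ X.nb p, w < y → y ∈ X.nb u) ∨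
      ∃ y ∈ X.nb p, y ∉ X.nb (s'.var .b)))
    (fun _ => 0) (fun u => 1 + (if u < w then 2 * (X.nb u).card else 0) + if u = q then 2 * X.n else 0)
    w (by simp [hI]) (by simp [hw]) hwn (by decide) ?_
    (by simp [hI, hpw]) ?_ ?_⟩
  · simp; omega
  · rintro P u s1 - hu - ⟨hI1, ha1, hbw, hb1⟩ f1 t1
    have hw1 : s1.var .w = w := (f1.var .w (by decide)).trans (by simp [hw])
    have hp1 : s1.var .p = p := (f1.var .p (by decide)).trans (by simp [hp])
    have hq1 : s1.var .q = q := (f1.var .q (by decide)).trans (by simp [hq])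
    have hun := X.graph.lt hu
    simp only [Stmt.wp_ite, Expr.safe_lt, Expr.eval_lt_eq_zero, ne_eq, not_le, Stmt.wp_seq]
    simp [hq1]
    refine ⟨fun hqu => ⟨⟨hI1, ha1, hbw, ?_⟩, by omega⟩, fun huq => ?_⟩
    · rcases hb1 with ⟨h1, h2⟩ | h
      · exact .inl ⟨h1, by omega, h2⟩
      · exact .inr h
    have hcu := X.card_le u
    have hpu : (X.nb p).card ≤ (X.nb u).card := X.graph.mono (hpl u hu) hun
    -- `p` is the first neighbour of `w`, so its degree is at most that of `u`.
    have hcost : (X.nb u).card + (X.nb p).card ≤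
        (if u < w then 2 * (X.nb u).card else 0) + if u = q then 2 * X.n else 0 := by
      rcases lt_or_gt_of_ne (X.graph.ne hu) with h | h
      · rw [if_pos h]; omega
      · have : u = q := le_antisymm huq (hql u hu h)
        rw [if_pos this]; omega
    refine wp_mark u (by simpa using hI1) rfl (by simp) hun (by decide) (by simp; omega)
      fun s2 hI2 f2 t2 hB => ?_
    have hw2 : s2.var .w = w := (f2.var .w (by decide)).trans (by simp [hw1])
    have hp2 : s2.var .p = p := (f2.var .p (by decide)).trans (by simp [hp1])
    have hu2 : s2.var .u = u := (f2.var .u (by decide)).trans (by simp)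
    have ha2 : s2.var .a = p := (f2.var .a (by decide)).trans (by simp [ha1])
    have hb2 : s2.var .b = s1.var .b := (f2.var .b (by decide)).trans (by simp)
    refine wp_forNbr (fun P' s' => Inv X s' ∧ s'.var .a = p ∧ s'.var .b ∈ X.nb w ∧
      ((s'.var .b = p ∧ (∀ u ∈ P, u ≤ q → ∀ y ∈ X.nb p, w < y → y ∈ X.nb u) ∧
        ∀ y ∈ P', w < y → y ∈ X.nb u) ∨
      ∃ y ∈ X.nb p, y ∉ X.nb (s'.var .b))) (fun _ => 0) (fun _ => 1) p hI2 hp2 hpn (by decide)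
      ?_ ?_ ?_ ?_
    · simp at t2 ⊢; omega
    · simp [hI2, ha2, hb2, hbw]
      exact hb1
    · rintro P' y s3 - hy - ⟨hI3, ha3, hbw3, hb3⟩ f3 t3
      have hw3 : s3.var .w = w := (f3.var .w (by decide)).trans (by simp [hw2])
      have hu3 : s3.var .u = u := (f3.var .u (by decide)).trans (by simp [hu2])
      have hB3 : s3.arr .mB = s2.arr .mB := f3.arr .mB (by decide)
      have hyn := X.graph.lt hy
      simp only [Stmt.wp_ite, Expr.safe_lt, Expr.eval_lt_eq_zero, ne_eq, not_le, Expr.safe_ne,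
        Expr.eval_ne_eq_zero]
      simp [hw3, hu3, hB3, hB, hI3, hu, ha3, hbw3]
      refine ⟨fun hwy => ⟨by omega, fun hyu => ⟨by omega, .inr ⟨y, hy, hyu⟩⟩, fun hyu => ?_⟩,
        fun hyw => ?_⟩
      · rcases hb3 with ⟨h1, h2, h3⟩ | h
        · exact .inl ⟨h1, h2, fun _ => hyu, h3⟩
        · exact .inr h
      · rcases hb3 with ⟨h1, h2, h3⟩ | h
        · exact .inl ⟨h1, h2, by omega, h3⟩
        · exact .inr h
    · rintro s3 ⟨hI3, ha3, hbw3, hb3⟩ - t3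
      simp [hI3, ha3, hbw3] at t2 t3 ⊢
      refine ⟨?_, by omega⟩
      rcases hb3 with ⟨h1, h2, h3⟩ | h
      · exact .inl ⟨h1, fun _ => h3, h2⟩
      · exact .inr h
  · rintro s1 ⟨hI1, hP1⟩ f1 t1
    have hw1 : s1.var .w = w := (f1.var .w (by decide)).trans (by simp [hw])
    have hq1 : s1.var .q = q := (f1.var .q (by decide)).trans (by simp [hq])
    have hn1 : s1.var .n = X.n := hI1.n
    have hO1 : HasOracle X (w + 1) s1 :=
      hO.of_eq (f1.arr _ (by decide)) (f1.arr _ (by decide))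
    -- A recorded `b` lacks a neighbour of `p`; being later than `p`, it cannot have its
    -- neighbourhood included in that of `p` either.
    have hfirst : IsPair X w (s1.var .a) (s1.var .b) ∨ (s1.var .a = p ∧ s1.var .b = p ∧
        ∀ u ∈ X.nb w, u ≤ q → ∀ y ∈ X.nb p, w < y → y ∈ X.nb u) := by
      obtain ⟨h1, h2, ⟨h3, h4⟩ | ⟨y, h3, h4⟩⟩ := hP1
      · exact .inr ⟨h1, h3, h4⟩
      · have h5 : ¬ X.nb p ⊆ X.nb (s1.var .b) := fun hs => h4 (hs h3)
        have h6 : p < s1.var .b := lt_of_le_of_ne (hpl _ h2) (by intro h; rw [← h] at h4; exact h4 h3)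
        exact .inl ⟨h1 ▸ hpw, h2, .inr ⟨h1 ▸ h5, h1 ▸ X.graph.not_subset_of_lt h6 (X.graph.lt h2) h5⟩⟩
    simp only [Stmt.wp_ite, Expr.safe_lt, Expr.eval_lt_eq_zero, ne_eq, not_le, Stmt.wp_seq]
    simp [hq1, hn1, hI1] at t1 ⊢
    refine ⟨fun hqn => ?_, fun hqn => ⟨?_, by omega⟩⟩
    · obtain ⟨hqw, hwq⟩ := hqw hqn
      have hq := hO1 q hwq hqn ⟨w, X.graph.symm hqw⟩
      have hr := X.graph.lt hq.1
      have ht' := X.graph.lt hq.2.1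
      have c1 := X.card_le (s1.arr .pa q)
      have c2 := X.card_le (s1.arr .pb q)
      refine ⟨by omega, by omega, by omega, by omega, ?_⟩
      refine wp_mark (s1.arr .pa q) (by simpa using hI1) rfl (by simp) hr (by decide) (by simp; omega)
        fun s2 hI2 f2 t2 hB => ?_
      have hq2 : s2.var .q = q := (f2.var .q (by decide)).trans (by simp [hq1])
      have hw2 : s2.var .w = w := (f2.var .w (by decide)).trans (by simp [hw1])
      have hr2 : s2.var .r = s1.arr .pa q := (f2.var .r (by decide)).trans (by simp)
      have ht2 : s2.var .t = s1.arr .pb q := (f2.var .t (by decide)).trans (by simp)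
      have ha2 : s2.var .a = s1.var .a := (f2.var .a (by decide)).trans (by simp)
      have hb2 : s2.var .b = s1.var .b := (f2.var .b (by decide)).trans (by simp)
      simp at t2
      refine wp_mark _ hI2 rfl ht2 ht' (by decide) (by omega) fun s3 hI3 f3 t3 hC => ?_
      refine wp_forNbr (fun P s' => Inv X s' ∧
        ((s'.var .a = s1.var .a ∧ s'.var .b = s1.var .b ∧ ∀ z ∈ P, q < z → X.nb q ⊆ X.nb z) ∨
        IsPair X w (s'.var .a) (s'.var .b))) (fun _ => 0) (fun _ => 1) w hI3
        ((f3.var .w (by decide)).trans hw2) hwn (by decide) (by simp; omega) ?_ ?_ ?_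
      · simp [hI3, f3.var, ha2, hb2]
      · rintro P z s4 - hz - ⟨hI4, hP4⟩ f4 -
        have hq4 : s4.var .q = q := (f4.var .q (by decide)).trans ((f3.var .q (by decide)).trans hq2)
        have hr4 : s4.var .r = s1.arr .pa q := (f4.var .r (by decide)).trans ((f3.var .r (by decide)).trans hr2)
        have ht4 : s4.var .t = s1.arr .pb q := (f4.var .t (by decide)).trans ((f3.var .t (by decide)).trans ht2)
        have hB4 : s4.arr .mB = s2.arr .mB := (f4.arr .mB (by decide)).trans (f3.arr .mB (by decide))
        have hC4 : s4.arr .mC = s3.arr .mC := f4.arr .mC (by decide)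
        have hzn := X.graph.lt hz
        simp only [Stmt.wp_ite, Expr.safe_lt, Expr.eval_lt_eq_zero, ne_eq, not_le, Expr.safe_ne,
          Expr.safe_add, Expr.eval_add, Nat.add_eq_zero_iff, Expr.eval_ne_eq_zero]
        simp only [Expr.safe_get, Expr.safe_lit, Expr.safe_var, Expr.eval_var,
          Expr.eval_get, Expr.eval_lit, Expr.eval_add, Store.var_set, Store.arr_set, Store.arr_tick,
          Store.var_tick, hB4, hC4, hr4, ht4, hq4, reduceCtorEq, if_true, if_false, hB, hC,
          Ctx.env_size]
        refine ⟨by simp, fun hqz => ⟨by simp; omega, fun h => ?_, fun h => ?_⟩, fun hqz => ?_⟩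
        · simp [hI4, hq4]
          refine ⟨by omega, by omega, .inr ⟨hqw, hz, .inr ?_⟩⟩
          have : ¬ X.nb q ⊆ X.nb z := fun hs => h ((hq.iff X.graph hqz).2 hs)
          exact ⟨this, X.graph.not_subset_of_lt hqz hzn this⟩
        · simp [hI4]
          rcases hP4 with ⟨h1, h2, h3⟩ | h'
          · exact .inl ⟨h1, h2, fun _ => (hq.iff X.graph hqz).1 h, h3⟩
          · exact .inr h'
        · simp [hI4]
          rcases hP4 with ⟨h1, h2, h3⟩ | h'
          · exact .inl ⟨h1, h2, by omega, h3⟩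
          · exact .inr h'
      · rintro s4 ⟨hI4, hP4⟩ - t4
        simp at t4
        refine ⟨hI4, ?_, by omega⟩
        rcases hP4 with ⟨h1, h2, h3⟩ | h
        · rw [h1, h2]
          rcases hfirst with h | ⟨h4, h5, h6⟩
          · exact h
          · refine ⟨h4 ▸ hpw, h5 ▸ hpw, .inl ⟨h4.trans h5.symm, fun y hwy hy z hz => ?_⟩⟩
            rw [h4] at hy
            -- Neighbours up to `q` were compared with `p` directly. Later ones dominate `q`, and
            -- `q` itself is adjacent to `y`.
            rcases le_or_gt z q with hzq | hzq
            · exact X.graph.symm (h6 z hz hzq y hy hwy)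
            · exact X.graph.symm (h3 z hz hzq (h6 q hqw le_rfl y hy hwy))
        · exact h
    · rcases hfirst with h | ⟨h4, h5, h6⟩
      · exact h
      · refine ⟨h4 ▸ hpw, h5 ▸ hpw, .inl ⟨h4.trans h5.symm, fun y hwy hy z hz => ?_⟩⟩
        rw [h4] at hy
        exact X.graph.symm (h6 z hz ((X.graph.lt hz).le.trans hqn) y hy hwy)

/-- Let `x` be the first common neighbour of `a` and `b` after `w`. As `a` and `b` are incomparable,
either `x` dominates `w` or `a w b x` is a non-dominated `C₄`; likewise each further common
neighbour `y` dominates `x` or yields one. By transitivity `(a, b)` is an oracle for `w`. Domination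
of `x` is tested with the oracle of the later vertex `x`. The four markings and three scans cost at
most `X.n` each. -/
theorem wp_verifyPair {w a b : ℕ} (hI : Inv X s) (hO : HasOracle X (w + 1) s) (hw : s.var .w = w)
    (ha : s.var .a = a) (hb : s.var .b = b) (haw : a ∈ X.nb w) (hbw : b ∈ X.nb w)
    (hab : ¬ X.nb a ⊆ X.nb b) (hba : ¬ X.nb b ⊆ X.nb a) (ht : s.time + 7 * X.n ≤ X.tmax) :
    verifyPair.wp X.env (fun s' => Inv X s' ∧ Oracle X.nb a b w ∧ s'.time ≤ s.time + 7 * X.n) s := by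
  have hnN := X.n_lt
  have hwn := X.graph.lt' haw
  have han := X.graph.lt haw
  have hbn := X.graph.lt hbw
  have cw := X.card_le w
  have ca := X.card_le a
  have cb := X.card_le b
  refine wp_mark b hI rfl hb hbn (by decide) (by omega) fun s1 hI1 f1 t1 hC => ?_
  have hw1 : s1.var .w = w := (f1.var .w (by decide)).trans hw
  have ha1 : s1.var .a = a := (f1.var .a (by decide)).trans ha
  have hb1 : s1.var .b = b := (f1.var .b (by decide)).trans hb
  have hO1 := hO.of_eq (f1.arr _ (by decide)) (f1.arr _ (by decide))
  refine ⟨trivial, by simp [hI1.n]; omega, wp_forNbr (fun P s' => Inv X s' ∧ s'.var .x ≤ X.n ∧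
    (s'.var .x < X.n → w < s'.var .x ∧ s'.var .x ∈ X.nb a ∧ s'.var .x ∈ X.nb b) ∧
    ∀ y ∈ P, w < y → y ∈ X.nb b → s'.var .x ≤ y) (fun _ => 0) (fun _ => 1) a (by simpa using hI1)
    (by simpa using ha1) han (by decide) (by simp; omega) (by simp [hI1, hI1.n]) ?_ ?_⟩
  · rintro P y s2 - hy - ⟨hI2, x0, x1, x2⟩ f2 -
    have hw2 : s2.var .w = w := (f2.var .w (by decide)).trans (by simp [hw1])
    have hb2 : s2.var .b = b := (f2.var .b (by decide)).trans (by simp [hb1])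
    have hC2 : s2.arr .mC = s1.arr .mC := f2.arr .mC (by decide)
    have hyn := X.graph.lt hy
    have hx : ∀ k, k ≤ s2.var .x → ∀ u' ∈ P, w < u' → u' ∈ X.nb b → k ≤ u' :=
      fun k hk u' hu' h1 h2 => hk.trans (x2 u' hu' h1 h2)
    simp only [Stmt.wp_ite, Expr.safe_lt, Expr.eval_lt_eq_zero, ne_eq, not_le, Expr.safe_ne,
      Expr.eval_ne_eq_zero]
    simp [hw2, hb2, hC2, hC, hI2, hy]
    clear f1 f2
    grind
  · rintro s2 ⟨hI2, x0, x1, x2⟩ f2 t2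
    have hw2 : s2.var .w = w := (f2.var .w (by decide)).trans (by simp [hw1])
    have ha2 : s2.var .a = a := (f2.var .a (by decide)).trans (by simp [ha1])
    have hb2 : s2.var .b = b := (f2.var .b (by decide)).trans (by simp [hb1])
    have hC2 : s2.arr .mC = s1.arr .mC := f2.arr .mC (by decide)
    have hO2 := hO1.of_eq (f2.arr _ (by decide)) (f2.arr _ (by decide))
    obtain ⟨x, hx⟩ : ∃ x, s2.var .x = x := ⟨_, rfl⟩
    rw [hx] at x0 x1 x2
    simp only [Stmt.wp_ite, Expr.safe_lt, Expr.eval_lt_eq_zero, ne_eq, not_le, Stmt.wp_seq]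
    simp at t2
    simp [hI2.n, hI2, hx]
    refine ⟨fun hxn => ?_, fun hxn => ⟨⟨haw, hbw, fun y hwy hya hyb => ?_⟩, by omega⟩⟩
    · obtain ⟨hwx, hxa, hxb⟩ := x1 hxn
      have cx := X.card_le x
      refine wp_mark x hI2 rfl hx hxn (by decide) (by omega) fun s3 hI3 f3 t3 hD => ?_
      have hw3 : s3.var .w = w := (f3.var .w (by decide)).trans hw2
      have ha3 : s3.var .a = a := (f3.var .a (by decide)).trans ha2
      have hb3 : s3.var .b = b := (f3.var .b (by decide)).trans hb2
      have hx3 : s3.var .x = x := (f3.var .x (by decide)).trans hx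
      refine wp_forNbr (fun P s' => Inv X s' ∧ ∀ u ∈ P, u ∈ X.nb x) (fun _ => 0) (fun _ => 1) w hI3
        hw3 hwn (by decide) (by simp; omega) (by simp [hI3]) ?_ ?_
      · rintro P u s4 - hu - ⟨hI4, hP⟩ f4 t4
        have hw4 : s4.var .w = w := (f4.var .w (by decide)).trans hw3
        have ha4 : s4.var .a = a := (f4.var .a (by decide)).trans ha3
        have hb4 : s4.var .b = b := (f4.var .b (by decide)).trans hb3
        have hx4 : s4.var .x = x := (f4.var .x (by decide)).trans hx3
        have hD4 : s4.arr .mD = s3.arr .mD := f4.arr .mD (by decide)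
        have hun := X.graph.lt hu
        simp [hw4, ha4, hb4, hx4, hD4, hD, hI4, hI4.ord]
        refine ⟨by omega, fun hux => ⟨by omega, X.ok_ndC4 _ _ _ _ ⟨X.graph.symm haw, hbw, hxb,
          X.graph.symm hxa, hba, hab, ?_, fun hs => hux (hs hu)⟩, by omega⟩, fun hux => ⟨hux, hP⟩⟩
        exact X.graph.not_subset_of_lt hwx hxn fun hs => hux (hs hu)
      · rintro s4 ⟨hI4, hwx'⟩ f4 t4
        have hw4 : s4.var .w = w := (f4.var .w (by decide)).trans hw3
        have ha4 : s4.var .a = a := (f4.var .a (by decide)).trans ha3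
        have hb4 : s4.var .b = b := (f4.var .b (by decide)).trans hb3
        have hx4 : s4.var .x = x := (f4.var .x (by decide)).trans hx3
        have hC4 : s4.arr .mC = s1.arr .mC :=
          (f4.arr .mC (by decide)).trans ((f3.arr .mC (by decide)).trans hC2)
        have hO4 := (hO2.of_eq (f3.arr _ (by decide)) (f3.arr _ (by decide))).of_eq
          (f4.arr _ (by decide)) (f4.arr _ (by decide))
        have hox := hO4 x hwx hxn ⟨a, X.graph.symm hxa⟩
        have hr := X.graph.lt hox.1
        have ht' := X.graph.lt hox.2.1
        have c1 := X.card_le (s4.arr .pa x)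
        have c2 := X.card_le (s4.arr .pb x)
        simp only [Stmt.wp_assign, Stmt.wp_seq]
        simp [hx4] at t4 ⊢
        refine ⟨by omega, by omega, by omega, by omega, ?_⟩
        refine wp_mark (s4.arr .pa x) (by simpa using hI4) rfl (by simp) hr (by decide)
          (by simp; omega) fun s5 hI5 f5 t5 hB => ?_
        have ha5 : s5.var .a = a := (f5.var .a (by decide)).trans (by simp [ha4])
        have hb5 : s5.var .b = b := (f5.var .b (by decide)).trans (by simp [hb4])
        have hx5 : s5.var .x = x := (f5.var .x (by decide)).trans (by simp [hx4])
        have hr5 : s5.var .r = s4.arr .pa x := (f5.var .r (by decide)).trans (by simp)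
        have ht5 : s5.var .t = s4.arr .pb x := (f5.var .t (by decide)).trans (by simp)
        simp at t5
        refine wp_mark (s4.arr .pb x) hI5 rfl ht5 ht' (by decide) (by omega) fun s6 hI6 f6 t6 hD => ?_
        refine wp_forNbr (fun P s' => Inv X s' ∧ ∀ y ∈ P, x < y → y ∈ X.nb b → X.nb x ⊆ X.nb y)
          (fun _ => 0) (fun _ => 1) a hI6 ((f6.var .a (by decide)).trans ha5) han (by decide)
          (by simp; omega) (by simp [hI6]) ?_ ?_
        · rintro P y s7 - hy - ⟨hI7, hP⟩ f7 t7
          have ha7 : s7.var .a = a := (f7.var .a (by decide)).trans ((f6.var .a (by decide)).trans ha5)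
          have hb7 : s7.var .b = b := (f7.var .b (by decide)).trans ((f6.var .b (by decide)).trans hb5)
          have hx7 : s7.var .x = x := (f7.var .x (by decide)).trans ((f6.var .x (by decide)).trans hx5)
          have hr7 : s7.var .r = s4.arr .pa x :=
            (f7.var .r (by decide)).trans ((f6.var .r (by decide)).trans hr5)
          have ht7 : s7.var .t = s4.arr .pb x :=
            (f7.var .t (by decide)).trans ((f6.var .t (by decide)).trans ht5)
          have hB7 : s7.arr .mB = s5.arr .mB := (f7.arr .mB (by decide)).trans (f6.arr .mB (by decide))
          have hD7 : s7.arr .mD = s6.arr .mD := f7.arr .mD (by decide)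
          have hC7 : s7.arr .mC = s1.arr .mC := (f7.arr .mC (by decide)).trans
            ((f6.arr .mC (by decide)).trans ((f5.arr .mC (by decide)).trans hC4))
          have hyn := X.graph.lt hy
          simp only [Stmt.wp_ite, Expr.safe_lt, Expr.eval_lt_eq_zero, ne_eq, not_le, Expr.safe_ne,
            Expr.safe_add, Expr.eval_add, Nat.add_eq_zero_iff, Expr.eval_ne_eq_zero]
          simp only [Expr.safe_get, Expr.safe_lit, Expr.safe_var, Expr.eval_var,
            Expr.eval_get, Expr.eval_lit, Store.var_set, Store.arr_set, Store.arr_tick,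
            Store.var_tick, hB7, hC7, hD7, hr7, ht7, hx7, hb7, reduceCtorEq, if_true, if_false, hB, hC, hD,
            Ctx.env_size, true_and, and_true]
          refine ⟨fun hxy => ⟨by omega, fun hyb => ?_, fun hyb => ⟨by omega, fun h => ?_, fun h => ?_⟩⟩,
            fun hyx => ?_⟩
          · simp [hI7, hyb]; exact hP
          · have hn : ¬ X.nb x ⊆ X.nb y := fun hs => h ((hox.iff X.graph hxy).2 hs)
            simp [hx7, ha7, hb7, hI7.ord]
            exact ⟨by omega, X.ok_ndC4 _ _ _ _ ⟨hxa, X.graph.symm hxb, hyb, X.graph.symm hy, hba, hab,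
              X.graph.not_subset_of_lt hxy hyn hn, hn⟩, by omega⟩
          · simp [hI7, hyb]; exact ⟨fun _ => (hox.iff X.graph hxy).1 h, hP⟩
          · simp [hI7]; exact ⟨by omega, hP⟩
        · rintro s7 ⟨hI7, hP⟩ - t7
          simp at t7
          refine ⟨hI7, ⟨haw, hbw, fun y hwy hya hyb => ?_⟩, by omega⟩
          have hsub : X.nb w ⊆ X.nb x := fun u hu => hwx' u hu
          rcases (x2 y hya hwy hyb).eq_or_lt with rfl | hxy
          · exact hsub
          · exact hsub.trans (hP y hya hxy hyb)
    · have := x2 y hya hwy hyb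
      have := X.graph.lt hya
      omega

/-- The oracle of `w` needs those of later vertices, so the vertices are treated from the last to
the first. The term `14 * X.n` collects `X.n` for the first neighbours, `6 * X.n` for the pair and
`7 * X.n` for its verification. -/
theorem wp_findOracles (hI : Inv X s)
    (ht : s.time + ∑ w ∈ Finset.range X.n, (1 + 14 * X.n + 2 * X.low w) ≤ X.tmax) :
    findOracles.wp X.env (fun s' => Inv X s' ∧ HasOracle X 0 s' ∧
      s'.time ≤ s.time + ∑ w ∈ Finset.range X.n, (1 + 14 * X.n + 2 * X.low w)) s := by
  have hnN := X.n_lt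
  -- Round `k` treats the vertex `n - 1 - k`, so the costs have to be summed in reverse.
  rw [← Finset.sum_range_reflect] at ht ⊢
  refine wp_for (fun k s' => Inv X s' ∧ HasOracle X (X.n - k) s') (fun _ => 0)
    (fun k => 1 + 14 * X.n + 2 * X.low (X.n - 1 - k)) X.n trivial trivial rfl hI.n hnN.le
    (by decide) (by simpa using ht) ?_ ?_ ?_
  · simp only [Inv.set_iff, ne_eq, reduceCtorEq, not_false_eq_true, hI, true_and]
    intro w h1 h2; omega
  · rintro k s1 hk ⟨hI1, hO1⟩ hk1 - ht1
    obtain ⟨w, hw⟩ : ∃ w, w = X.n - 1 - k := ⟨_, rfl⟩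
    have hwn : w < X.n := by omega
    have hw' : X.n - k = w + 1 := by omega
    have hw'' : X.n - (k + 1) = w := by omega
    have hcard := (X.seg w hwn).card
    have cw := X.card_le w
    rw [hw'] at hO1
    rw [hw'', ← hw]
    rw [← hw] at ht1
    simp only [Stmt.wp_assign, Stmt.wp_seq, Stmt.wp_ite, Expr.safe_lt, Expr.eval_lt_eq_zero]
    simp [hI1.n, hk1, hI1.st, hI1.en, show X.n - (k + 1) = w by omega] at ht1 ⊢
    refine ⟨by omega, by omega, fun hlt => ?_, fun hle => ⟨⟨hI1, fun w' h1 h2 h3 => ?_⟩, by omega⟩⟩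
    · have hne : (X.nb w).Nonempty := Finset.card_pos.1 (by omega)
      refine Stmt.wp_frame (wp_firstNbrs (s := s1.tick.set .w w) (w := w) (by simpa using hI1) (by simp) hne
        (by simp; omega)) ?_
      rintro s2 ⟨hI2, hF, t2⟩ f2 -
      have hO2 : HasOracle X (w + 1) s2 := hO1.of_eq (f2.arr _ (by decide)) (f2.arr _ (by decide))
      have hv2 : s2.var .v = k := (f2.var .v (by decide)).trans (by simp [hk1])
      have hw2 : s2.var .w = w := (f2.var .w (by decide)).trans (by simp)
      simp at t2
      rw [Stmt.wp_seq]
      refine Stmt.wp_frame (wp_findPair hI2 hO2 hw2 rfl rfl hF (by omega)) ?_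
      rintro s3 ⟨hI3, ⟨ha3, hb3, hab⟩, t3⟩ f3 -
      have hO3 : HasOracle X (w + 1) s3 := hO2.of_eq (f3.arr _ (by decide)) (f3.arr _ (by decide))
      have hv3 : s3.var .v = k := (f3.var .v (by decide)).trans hv2
      have hw3 : s3.var .w = w := (f3.var .w (by decide)).trans hw2
      have key : ∀ s' : Mem, Inv X s' → HasOracle X (w + 1) s' → s'.var .w = w →
          s'.var .a = s3.var .a → s'.var .b = s3.var .b → Oracle X.nb (s3.var .a) (s3.var .b) w →
          s'.time ≤ s3.time + 7 * X.n →
          (Stmt.store Arr.pa (.var .w) (.var .a) ;; Stmt.store Arr.pb (.var .w) (.var .b)).wp X.env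
            (fun s'' => (Inv X s'' ∧ HasOracle X w (s''.set .v (k + 1))) ∧
              s''.time ≤ s1.time + (1 + 14 * X.n + 2 * X.low w)) s' := by
        intro s' hI' hO' hw' ha' hb' ho ht'
        have := X.graph.lt ho.1
        have := X.graph.lt ho.2.1
        simp only [Stmt.wp_seq, Stmt.wp_store]
        simp [hw', ha', hb']
        refine ⟨by omega, by omega, by omega, by omega, ⟨(hI'.put (by decide) _ _).put (by decide) _ _, ?_⟩,
          by omega⟩
        intro w1 h1 h2 h3
        rcases h1.eq_or_lt with rfl | h1
        · simpa using ho
        · simpa [h1.ne'] using hO' w1 h1 h2 h3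
      simp only [Stmt.wp_seq, Stmt.wp_ite, Expr.safe_ne, Expr.eval_ne_eq_zero]
      refine ⟨by simp, fun hne => ?_, fun heq => ?_⟩
      · rcases hab with ⟨h, -⟩ | ⟨h1, h2⟩
        · exact (hne (Expr.eval_ne_eq_zero.2 h)).elim
        · refine Stmt.wp_frame (wp_verifyPair hI3 hO3 hw3 rfl rfl ha3 hb3 h1 h2 (by omega)) ?_
          rintro s4 ⟨hI4, ho, t4⟩ f4 -
          exact key s4 hI4 (hO3.of_eq (f4.arr _ (by decide)) (f4.arr _ (by decide)))
            ((f4.var _ (by decide)).trans hw3) (f4.var _ (by decide)) (f4.var _ (by decide)) ho t4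
      · refine key s3 hI3 hO3 hw3 rfl rfl ⟨ha3, hb3, fun y h1 h2 h3 => ?_⟩ (by omega)
        rcases hab with ⟨-, h⟩ | ⟨h, -⟩
        · exact h y h1 h2
        · exact absurd (show s3.var .a = s3.var .b from heq) (by rintro h'; rw [h'] at h; exact h subset_rfl)
    · rcases h1.eq_or_lt with rfl | h1
      · have := Finset.card_pos.2 h3; omega
      · exact hO1 w' h1 h2 h3
  · rintro s1 ⟨hI1, hO1⟩ - t1
    exact ⟨hI1, by simpa using hO1, by simpa using t1⟩

end

end BicliqueHelly

namespace BicliqueHelly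

open RAM SortedGraph

/-! ### Non-dominated `C₄`s -/

section
open Var Arr

/-- Search for a non-dominated `C₄`. -/
def findC4 : Prog :=
  .loop v hv (.lit 0) n
    (mark mA v ;; .loop w h₁ (.lit 0) n (.store last w n) ;;
      .loop u h₁ (.lit 0) v (.ite (.ne (.get mA u) (.add v (.lit 1))) .skip
        (mark mB u ;;
          forNbr i₂ h₂ w u (.ite (.lt w v)
            (.assign x (.get last w) ;;
              .ite (.lt x n)
                (.ite (.add (.ne (.get mB (.get pa x)) (.add u (.lit 1)))
                    (.ne (.get mB (.get pb x)) (.add u (.lit 1))))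
                  (.ite (.add (.ne (.get mA (.get pa w)) (.add v (.lit 1)))
                      (.ne (.get mA (.get pb w)) (.add v (.lit 1))))
                    (.report [.get ord v, .get ord u, .get ord w, .get ord x]) .skip) .skip) .skip ;;
              .store last w u) .skip))))

/-- Compute for each vertex the next one that dominates it. -/
def findNext : Prog :=
  .loop w hv (.lit 0) n
    (.store next w n ;;
      .ite (.lt (.get st w) (.get en w))
        (.assign r (.get pa w) ;; .assign t (.get pb w) ;; mark mA r ;; mark mB t ;;
          .loop y h₁ (.lit 0) n (.ite (.lt w y)
            (.ite (.lt (.get next w) n) .skip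
              (.ite (.add (.ne (.get mA y) (.add r (.lit 1))) (.ne (.get mB y) (.add t (.lit 1))))
                .skip (.store next w y))) .skip))
        .skip)

end

/-- `l` is the last common neighbour of `v` and `w` before `k`, or `n`, and the common neighbours
before `k` do not form non-dominated `C₄`s with `v` and `w`. -/
structure LastAt (X : Ctx) (v w k l : ℕ) : Prop where
  le : l ≤ X.n
  spec : l < X.n → l < k ∧ l ∈ X.nb v ∧ w ∈ X.nb l
  last : ∀ u < k, u ∈ X.nb v → w ∈ X.nb u →
    l < X.n ∧ u ≤ l ∧ (X.nb u ⊆ X.nb l ∨ X.nb w ⊆ X.nb v)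
  done : ∀ u u', u < k → u' < u → u ∈ X.nb v → u' ∈ X.nb v → w ∈ X.nb u → w ∈ X.nb u' →
    X.nb u' ⊆ X.nb u ∨ X.nb w ⊆ X.nb v

theorem LastAt.zero (X : Ctx) (v w : ℕ) : LastAt X v w 0 X.n := by
  constructor <;> intros <;> omega

theorem LastAt.skip {X : Ctx} {v w k l : ℕ} (h : LastAt X v w k l)
    (hk : k ∈ X.nb v → w ∉ X.nb k) : LastAt X v w (k + 1) l where
  le := h.le
  spec hl := ⟨(h.spec hl).1.trans (Nat.lt_succ_self k), (h.spec hl).2⟩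
  last u hu h1 h2 := by
    rcases Nat.lt_succ_iff_lt_or_eq.1 hu with hu | rfl
    · exact h.last u hu h1 h2
    · exact absurd h2 (hk h1)
  done u u' hu hu' h1 h2 h3 h4 := by
    rcases Nat.lt_succ_iff_lt_or_eq.1 hu with hu | rfl
    · exact h.done u u' hu hu' h1 h2 h3 h4
    · exact absurd h3 (hk h1)

/-- Only the latest common neighbour `l` is remembered. Earlier common neighbours are dominated by
`l`, so comparing `l` with `k` settles all of them by transitivity, unless `v` dominates `w`, when
nothing is left to check. -/
theorem LastAt.step {X : Ctx} {v w k l : ℕ} (h : LastAt X v w k l) (hk : k ∈ X.nb v)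
    (hkw : w ∈ X.nb k) (hl : l < X.n → X.nb l ⊆ X.nb k ∨ X.nb w ⊆ X.nb v) :
    LastAt X v w (k + 1) k where
  le := (X.graph.lt hk).le
  spec _ := ⟨Nat.lt_succ_self k, hk, hkw⟩
  last u hu h1 h2 := by
    rcases Nat.lt_succ_iff_lt_or_eq.1 hu with hu' | rfl
    · obtain ⟨h3, h4, h5⟩ := h.last u hu' h1 h2
      refine ⟨X.graph.lt hk, hu'.le, ?_⟩
      rcases h5 with h5 | h5
      · exact (hl h3).imp_left h5.trans
      · exact .inr h5
    · exact ⟨X.graph.lt hk, le_rfl, .inl subset_rfl⟩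
  done u u' hu hu' h1 h2 h3 h4 := by
    rcases Nat.lt_succ_iff_lt_or_eq.1 hu with hu | rfl
    · exact h.done u u' hu hu' h1 h2 h3 h4
    · obtain ⟨h5, h6, h7⟩ := h.last u' hu' h2 h4
      rcases h7 with h7 | h7
      · exact (hl h5).imp_left h7.trans
      · exact .inr h7

section
variable {X : Ctx} {s : Mem}

theorem Ctx.low_eq_range (X : Ctx) (v : ℕ) :
    X.low v = ∑ u ∈ Finset.range v, if u ∈ X.nb v then (X.nb u).card else 0 := by
  rw [Ctx.low, ← Finset.sum_filter]
  refine Finset.sum_congr ?_ fun _ _ => rfl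
  ext u; simp [and_comm]

/-- Here `v` is the last vertex of the cycle, `w` the opposite one, and the neighbours `u` of `v`
come in increasing order, so that `last w` is the previous common neighbour of `v` and `w`. Both
domination tests are adjacency tests by oracles. Marking `v`, resetting `last` and running through
the candidates `u` take `3 * X.n`; marking and scanning the actual `u` take `2 * X.low v`. -/
theorem wp_findC4 (hI : Inv X s) (hO : HasOracle X 0 s)
    (ht : s.time + ∑ v ∈ Finset.range X.n, (1 + 3 * X.n + 2 * X.low v) ≤ X.tmax) :
    findC4.wp X.env (fun s' => Inv X s' ∧ (∀ a b c d, ¬ NdC4 X.nb a b c d) ∧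
      s'.time ≤ s.time + ∑ v ∈ Finset.range X.n, (1 + 3 * X.n + 2 * X.low v)) s := by
  have hnN := X.n_lt
  refine wp_for (fun k s' => Inv X s' ∧ ∀ v < k, ∀ w < v, ∃ l, LastAt X v w v l)
    (fun _ => 0) (fun v => 1 + 3 * X.n + 2 * X.low v) X.n trivial trivial rfl hI.n hnN.le
    (by decide) (by simpa using ht) (by simpa using hI) ?_ ?_
  · rintro v s1 hv ⟨hI1, hL1⟩ hv1 f1 t1
    have hO1 : HasOracle X 0 s1 := hO.of_eq (f1.arr _ (by decide)) (f1.arr _ (by decide))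
    have hcv := X.card_le v
    have hsum : ∑ u ∈ Finset.range v, (1 + if u ∈ X.nb v then 2 * (X.nb u).card else 0) =
        v + 2 * X.low v := by
      rw [X.low_eq_range, Finset.mul_sum]
      simp [Finset.sum_add_distrib]
    refine wp_mark v hI1.tick rfl hv1 hv (by decide) (by simp; omega) fun s2 hI2 f2 t2 hA => ?_
    have hv2 : s2.var .v = v := (f2.var .v (by decide)).trans hv1
    have hO2 : HasOracle X 0 s2 := hO1.of_eq (f2.arr _ (by decide)) (f2.arr _ (by decide))
    refine wp_for (fun k s' => Inv X s' ∧ ∀ w < k, s'.arr .last w = X.n) (fun _ => 0) (fun _ => 1) X.n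
      trivial trivial rfl hI2.n hnN.le (by decide) (by simp at t2 ⊢; omega) (by simpa using hI2) ?_ ?_
    · rintro w s3 hw ⟨hI3, hW⟩ hw3 f3 -
      simp only [Stmt.wp_store]
      simp [hI3.n, hw3]
      refine ⟨by omega, by omega, hI3.tick.put (by decide) _ _, fun w' hw' => ?_⟩
      rw [Function.update_apply]
      split_ifs with h
      exacts [rfl, hW w' (by omega)]
    rintro s3 ⟨hI3, hW⟩ f3 t3
    have hv3 : s3.var .v = v := (f3.var .v (by decide)).trans hv2
    have hO3 : HasOracle X 0 s3 := hO2.of_eq (f3.arr _ (by decide)) (f3.arr _ (by decide))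
    have hA3 : s3.arr .mA = s2.arr .mA := f3.arr .mA (by decide)
    simp at t2 t3
    refine wp_for (fun k s' => Inv X s' ∧ ∀ w < v, LastAt X v w k (s'.arr .last w)) (fun _ => 0)
      (fun u => 1 + if u ∈ X.nb v then 2 * (X.nb u).card else 0) v trivial trivial rfl hv3
      (by omega) (by decide) (by rw [hsum]; simp; omega) ?_ ?_ ?_
    · simp only [Inv.set_iff, ne_eq, reduceCtorEq, not_false_eq_true, hI3, true_and]
      intro w hw
      simp only [Store.arr_set, hW w (by omega)]
      exact LastAt.zero X v w
    · rintro u s4 hu ⟨hI4, hL4⟩ hu4 f4 t4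
      have hv4 : s4.var .v = v := (f4.var .v (by decide)).trans hv3
      have hA4 : s4.arr .mA = s2.arr .mA := (f4.arr .mA (by decide)).trans hA3
      have hO4 : HasOracle X 0 s4 := hO3.of_eq (f4.arr _ (by decide)) (f4.arr _ (by decide))
      simp only [Stmt.wp_ite, Expr.safe_ne, Expr.eval_ne_eq_zero, Stmt.wp_seq]
      simp [hu4, hv4, hA4, hA]
      refine ⟨by omega, fun huv => ⟨hI4, fun w hw => (hL4 w hw).skip fun h => absurd h huv⟩,
        fun huv => ?_⟩
      rw [if_pos huv] at t4 ⊢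
      have hun := X.graph.lt huv
      simp at t4
      refine wp_mark u hI4.tick rfl hu4 hun (by decide) (by simp; omega) fun s5 hI5 f5 t5 hB => ?_
      have hv5 : s5.var .v = v := (f5.var .v (by decide)).trans hv4
      have hu5 : s5.var .u = u := (f5.var .u (by decide)).trans hu4
      have hA5 : s5.arr .mA = s2.arr .mA := (f5.arr .mA (by decide)).trans hA4
      have hlast5 : s5.arr .last = s4.arr .last := f5.arr .last (by decide)
      have hO5 : HasOracle X 0 s5 := hO4.of_eq (f5.arr _ (by decide)) (f5.arr _ (by decide))
      simp at t5
      -- In the scan of `u`, the entries of the vertices visited so far already take `u` into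
      -- account and the others do not yet; hence the bound `u + 1` or `u`.
      refine wp_forNbr (fun P s' => Inv X s' ∧
          ∀ w < v, LastAt X v w (if w ∈ P then u + 1 else u) (s'.arr .last w))
        (fun _ => 0) (fun _ => 1) u hI5 hu5 hun (by decide) (by simp; omega) ?_ ?_ ?_
      · simpa [hI5, hlast5] using hL4
      · rintro P w s6 - hw hwP ⟨hI6, hL6⟩ f6 t6
        have hv6 : s6.var .v = v := (f6.var .v (by decide)).trans hv5
        have hu6 : s6.var .u = u := (f6.var .u (by decide)).trans hu5
        have hA6 : s6.arr .mA = s2.arr .mA := (f6.arr .mA (by decide)).trans hA5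
        have hB6 : s6.arr .mB = s5.arr .mB := f6.arr .mB (by decide)
        have hO6 : HasOracle X 0 s6 := hO5.of_eq (f6.arr _ (by decide)) (f6.arr _ (by decide))
        have hwn := X.graph.lt hw
        obtain ⟨l, hl⟩ : ∃ l, s6.arr .last w = l := ⟨_, rfl⟩
        simp only [Stmt.wp_ite, Expr.safe_lt, Expr.eval_lt_eq_zero, Stmt.wp_seq, Stmt.wp_assign,
          Stmt.wp_store, ne_eq, not_le, Expr.eval_var, Store.var_set, Store.var_tick, hv6,
          reduceCtorEq, if_true, if_false]
        refine ⟨by simp, fun hwv => ?_, fun hvw => ?_⟩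
        · have hLw := hL6 w hwv
          rw [if_neg hwP, hl] at hLw
          have hln := hLw.le
          have key : ∀ s' : Mem, Inv X s' → s'.var .w = w → s'.var .u = u →
              s'.arr .last = s6.arr .last → s'.time ≤ s6.time + 1 →
              (l < X.n → X.nb l ⊆ X.nb u ∨ X.nb w ⊆ X.nb v) →
              (Stmt.store Arr.last (.var .w) (.var .u)).wp X.env (fun s'' => (∀ j,
                Inv X (s''.set .i₂ j) ∧ ∀ w' < v, LastAt X v w' (if w' ∈ insert w P then u + 1 else u)
                  ((s''.set .i₂ j).arr .last w')) ∧ s''.time + 0 ≤ s6.time + 0 + 1) s' := by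
            intro s' hI' hw' hu' hl' ht' h
            simp only [Stmt.wp_store]
            simp only [Expr.safe_var, Expr.eval_var, hw', hu', true_and, Ctx.env_size, Ctx.env_bd]
            refine ⟨by omega, by omega, fun j => ⟨(hI'.put (by decide) _ _).set (by decide) _,
              fun w' hw' => ?_⟩, by simpa using ht'⟩
            simp only [Store.arr_set, Store.arr_put, if_true, hl', Function.update_apply,
              Finset.mem_insert]
            by_cases hww : w' = w
            · subst hww
              simpa using hLw.step huv hw h
            · simpa [hww] using hL6 w' hw'
          simp only [Stmt.wp_store] at key
          have hrep : ∀ h : l < X.n, ¬ X.nb l ⊆ X.nb u → ¬ X.nb w ⊆ X.nb v →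
              X.ok [X.ord v, X.ord u, X.ord w, X.ord l] := by
            intro h h1 h2
            obtain ⟨h3, h4, h5⟩ := hLw.spec h
            exact X.ok_ndC4 _ _ _ _ ⟨huv, hw, X.graph.symm h5, X.graph.symm h4, h2,
              X.graph.not_subset_of_lt hwv hv h2, h1, X.graph.not_subset_of_lt h3 hun h1⟩
          have howl : ∀ h : l < X.n, Oracle X.nb (s6.arr .pa l) (s6.arr .pb l) l := fun h =>
            hO6 l (Nat.zero_le _) h ⟨v, X.graph.symm (hLw.spec h).2.1⟩
          have how : Oracle X.nb (s6.arr .pa w) (s6.arr .pb w) w :=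
            hO6 w (Nat.zero_le _) hwn ⟨u, X.graph.symm hw⟩
          refine ⟨by simp; omega, by simp [hl]; omega, by simp, fun hlt => ?_, fun hge => ?_⟩
          · simp [hl, hI6.n] at hlt
            have hol := howl hlt
            have e1 := X.graph.lt hol.1; have e2 := X.graph.lt hol.2.1
            have e3 := X.graph.lt how.1; have e4 := X.graph.lt how.2.1
            refine ⟨by simp [hl]; omega, fun h1 => ⟨by simp; omega, fun h2 => ?_, fun h2 => ?_⟩,
              fun h1 => ?_⟩
            · refine ⟨by simp [hl, hv6, hu6]; omega, by simp, by simp, ?_, by simp; simp at t6; omega⟩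
              simp only [Expr.eval_add, Nat.add_eq_zero_iff, Expr.eval_ne_eq_zero] at h1 h2
              simp [hl, hu6, hv6, hB6, hA6, hA, hB, -not_and] at h1 h2
              simp [hI6.ord, hl, hv6, hu6]
              refine hrep hlt (fun hs => h1 ?_) (fun hs => h2 ?_)
              · exact (hol.iff X.graph (hLw.spec hlt).1).2 hs |>.imp X.graph.symm X.graph.symm
              · exact (how.iff X.graph hwv).2 hs |>.imp X.graph.symm X.graph.symm
            · refine key _ (by simpa using hI6) (by simp) (by simp [hu6]) rfl (by simp) fun _ => .inr ?_
              simp only [Expr.eval_add, Nat.add_eq_zero_iff, Expr.eval_ne_eq_zero] at h2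
              simp [hv6, hA6, hA] at h2
              exact (how.iff X.graph hwv).1 (h2.imp X.graph.symm X.graph.symm)
            · refine key _ (by simpa using hI6) (by simp) (by simp [hu6]) rfl (by simp) fun _ => .inl ?_
              simp only [Expr.eval_add, Nat.add_eq_zero_iff, Expr.eval_ne_eq_zero] at h1
              simp [hl, hu6, hB6, hB] at h1
              exact (hol.iff X.graph (hLw.spec hlt).1).1 (h1.imp X.graph.symm X.graph.symm)
          · simp [hl, hI6.n] at hge
            exact key _ (by simpa using hI6) (by simp) (by simp [hu6]) rfl (by simp) (by omega)
        · simp [hI6]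
          intro w' hw'
          simpa [show w' ≠ w by rintro rfl; omega] using hL6 w' hw'
      · rintro s6 ⟨hI6, hL6⟩ - t6
        simp [hI6] at t6 ⊢
        refine ⟨fun w hw => ?_, by omega⟩
        by_cases h : w ∈ X.nb u
        · simpa [h] using hL6 w hw
        · have := hL6 w hw
          rw [if_neg h] at this
          exact this.skip fun _ => h
    · rintro s4 ⟨hI4, hL4⟩ - t4
      rw [hsum] at t4
      simp [hI4] at t4 ⊢
      refine ⟨fun v' hv' w hw => ?_, by omega⟩
      rcases hv'.lt_or_eq with h | rfl
      · exact hL1 v' h w hw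
      · exact ⟨_, hL4 w hw⟩
  · rintro s1 ⟨hI1, hL1⟩ - t1
    refine ⟨hI1, X.graph.not_ndC4 fun v w u u' h1 h2 h3 h4 h5 h6 h7 => ?_, by simpa using t1⟩
    obtain ⟨l, hl⟩ := hL1 v (X.graph.lt' h4) w h1
    exact hl.done u u' h3 h2 h4 h5 h6 h7

/-- `l` is the first vertex in the interval from `w + 1` to `k - 1` that dominates `w`, or `n`. -/
structure NextAt (X : Ctx) (w k l : ℕ) : Prop where
  lt : w < l
  le : l ≤ X.n
  spec : l < X.n → X.nb w ⊆ X.nb l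
  first : ∀ y, w < y → y < l → y < k → ¬ X.nb w ⊆ X.nb y

/-- Once the neighbours of both oracle vertices of `w` are marked, each later `y` takes constant
time. The first hit makes `next w` smaller than `n`, and this blocks later hits. Isolated vertices
have no oracle and keep the value `n`. -/
theorem wp_findNext (hI : Inv X s) (hO : HasOracle X 0 s)
    (ht : s.time + ∑ _w ∈ Finset.range X.n, (1 + 3 * X.n) ≤ X.tmax) :
    findNext.wp X.env (fun s' => Inv X s' ∧ IsNext X.n X.nb (s'.arr .next) ∧
      (∀ w < X.n, s'.arr .next w ≤ X.n) ∧
      s'.time ≤ s.time + ∑ _w ∈ Finset.range X.n, (1 + 3 * X.n)) s := by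
  have hnN := X.n_lt
  refine wp_for (fun k s' => Inv X s' ∧ ∀ w < k, s'.arr .next w ≤ X.n ∧
    ((X.nb w).Nonempty → NextAt X w X.n (s'.arr .next w)))
    (fun _ => 0) (fun v => 1 + 3 * X.n) X.n trivial trivial rfl hI.n hnN.le
    (by decide) (by simpa using ht) (by simpa using hI) ?_ ?_
  · rintro w s1 hw ⟨hI1, hN1⟩ hw1 f1 t1
    have hO1 : HasOracle X 0 s1 := hO.of_eq (f1.arr _ (by decide)) (f1.arr _ (by decide))
    have hcard := (X.seg w hw).card
    simp only [Stmt.wp_seq, Stmt.wp_store, Stmt.wp_assign, Stmt.wp_ite, Expr.safe_lt,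
      Expr.eval_lt_eq_zero, ne_eq, not_le]
    simp [hw1, hI1.n, hI1.st, hI1.en] at t1 ⊢
    refine ⟨by omega, by omega, by omega, fun hlt => ?_, fun hle => ⟨?_, ?_⟩⟩
    · have ho := hO1 w (Nat.zero_le _) hw (Finset.card_pos.1 (by omega))
      have hr := X.graph.lt ho.1
      have ht' := X.graph.lt ho.2.1
      have c1 := X.card_le (s1.arr .pa w)
      have c2 := X.card_le (s1.arr .pb w)
      refine ⟨by omega, by omega, by omega, by omega, ?_⟩
      refine wp_mark (s1.arr .pa w)
        (((hI1.tick.put (by decide) _ _).set (by decide) _).set (by decide) _) rfl (by simp) hr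
        (by decide) (by simp; omega) fun s2 hI2 f2 t2 hA => ?_
      have hw2 : s2.var .w = w := (f2.var .w (by decide)).trans (by simp [hw1])
      have hr2 : s2.var .r = s1.arr .pa w := (f2.var .r (by decide)).trans (by simp)
      have ht2 : s2.var .t = s1.arr .pb w := (f2.var .t (by decide)).trans (by simp)
      have hn2 : s2.arr .next = Function.update (s1.arr .next) w X.n :=
        (f2.arr .next (by decide)).trans (by simp)
      simp at t2
      refine wp_mark (s1.arr .pb w) hI2 rfl ht2 ht' (by decide) (by omega) fun s3 hI3 f3 t3 hB => ?_
      have hw3 : s3.var .w = w := (f3.var .w (by decide)).trans hw2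
      have hr3 : s3.var .r = s1.arr .pa w := (f3.var .r (by decide)).trans hr2
      have ht3 : s3.var .t = s1.arr .pb w := (f3.var .t (by decide)).trans ht2
      have hA3 : s3.arr .mA = s2.arr .mA := f3.arr .mA (by decide)
      have hn3 : s3.arr .next = Function.update (s1.arr .next) w X.n :=
        (f3.arr .next (by decide)).trans hn2
      refine wp_for (fun k s' => Inv X s' ∧ NextAt X w k (s'.arr .next w) ∧
        (s'.arr .next w < X.n → s'.arr .next w < k) ∧
        ∀ w' < w, s'.arr .next w' = s1.arr .next w') (fun _ => 0) (fun _ => 1) X.n trivial trivial rfl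
        hI3.n hnN.le (by decide) (by simp; omega) ?_ ?_ ?_
      · simp [hI3, hn3]
        refine ⟨⟨hw, le_rfl, by omega, by omega⟩, fun w' hw' => by simp [hw'.ne]⟩
      · rintro y s4 hy ⟨hI4, hN4, hlt4, he4⟩ hy4 f4 -
        have hw4 : s4.var .w = w := (f4.var .w (by decide)).trans hw3
        have hr4 : s4.var .r = s1.arr .pa w := (f4.var .r (by decide)).trans hr3
        have ht4 : s4.var .t = s1.arr .pb w := (f4.var .t (by decide)).trans ht3
        have hA4 : s4.arr .mA = s2.arr .mA := (f4.arr .mA (by decide)).trans hA3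
        have hB4 : s4.arr .mB = s3.arr .mB := f4.arr .mB (by decide)
        obtain ⟨h1, h2, h3, h4⟩ := hN4
        have hskip : (w < y → y < s4.arr .next w → ¬ X.nb w ⊆ X.nb y) →
            NextAt X w (y + 1) (s4.arr .next w) := fun h => ⟨h1, h2, h3, fun y' g1 g2 g3 => by
          rcases Nat.lt_succ_iff_lt_or_eq.1 g3 with g | rfl
          exacts [h4 y' g1 g2 g, h g1 g2]⟩
        simp only [Stmt.wp_ite, Stmt.wp_store, Expr.safe_lt, Expr.eval_lt_eq_zero, ne_eq, not_le,
          Expr.safe_ne, Expr.safe_add, Expr.eval_add, Nat.add_eq_zero_iff, Expr.eval_ne_eq_zero]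
        simp only [Expr.safe_get, Expr.safe_lit, Expr.safe_var, Expr.eval_var,
          Expr.eval_get, Expr.eval_lit, Expr.eval_add, Store.var_set, Store.arr_set, Store.arr_tick,
          Store.var_tick, hA4, hB4, hr4, ht4, hw4, hy4, hA, hB, hI4.n, Ctx.env_size, true_and]
        refine ⟨fun hwy => ⟨by omega, fun hlt => ?_, fun hge => ⟨by simp; omega,
          fun h => ?_, fun h => ?_⟩⟩, fun hyw => ?_⟩
        · simp [hI4]
          exact ⟨hskip fun _ hh => absurd (hlt4 hlt) (by omega), by omega, he4⟩
        · simp [hI4]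
          exact ⟨hskip fun _ _ hs => h ((ho.iff X.graph hwy).2 hs), by omega, he4⟩
        · have hdom := (ho.iff X.graph hwy).1 h
          refine ⟨by omega, by simp; omega, ⟨(hI4.tick.put (by decide) _ _).set (by decide) _, ?_, ?_, ?_⟩,
            by simp⟩
          · simp
            exact ⟨hwy, hy.le, fun _ => hdom, fun y' g1 g2 _ => h4 y' g1 (by omega) g2⟩
          · simp
          · intro w' hw'
            simpa [hw'.ne] using he4 w' hw'
        · simp [hI4]
          exact ⟨hskip (by omega), by omega, he4⟩
      · rintro s4 ⟨hI4, hN4, -, he4⟩ - t4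
        simp [hI4] at t4 ⊢
        refine ⟨fun w' hw' => ?_, by omega⟩
        rcases hw'.lt_or_eq with h | rfl
        · rw [he4 w' h]; exact hN1 w' h
        · exact ⟨hN4.le, fun _ => hN4⟩
    · exact hI1.tick.put (by decide) _ _
    · intro w' hw'
      rw [Function.update_apply]
      split_ifs with h
      · exact ⟨le_rfl, fun h' => by have := Finset.card_pos.2 h'; subst h; omega⟩
      · exact hN1 w' (by omega)
  · rintro s1 ⟨hI1, hN1⟩ - t1
    refine ⟨hI1, fun w hw hne => ?_, fun w hw => (hN1 w hw).1, by simpa using t1⟩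
    have h := (hN1 w hw).2 hne
    exact ⟨h.lt, h.le, h.spec, fun y h1 h2 => h.first y h1 h2 (h2.trans_le h.le)⟩

end

end BicliqueHelly

namespace BicliqueHelly

open RAM SortedGraph

/-! ### Induced `C₅`s and `C₆`s -/

section
open Var Arr

/-- List for each vertex its neighbours with next dominating vertex `z`. -/
def buildLists : Prog :=
  .loop w h₁ (.lit 0) n
    (.store fin w (.get st w) ;; .store parV w (.lit 0) ;; .store seenV w (.lit 0)) ;;
  .loop t h₁ (.lit 0) n (.ite (.ne (.get next t) z) .skip
    (forNbr i₂ h₂ w t (.store list (.get fin w) t ;; .store fin w (.add (.get fin w) (.lit 1)))))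

/-- The search for `C₅`s and `C₆`s that start with the path `v, s, w`. -/
def searchPath : Prog :=
  .store parV w (.add v (.lit 1)) ;; .store par w s ;;
  .each list i₄ h₄ t (.get st w) (.get fin w) (.ite (.ne t s)
    (.ite (.ne (.get parV t) (.add v (.lit 1)))
      (.ite (.ne (.get seenV t) (.add v (.lit 1)))
        (.store seenV t (.add v (.lit 1)) ;; .store seen t w)
        (.report [.get ord v, .get ord s, .get ord w, .get ord t, .get ord (.get seen t),
          .get ord (.get par (.get seen t))]))
      (.report [.get ord v, .get ord s, .get ord w, .get ord t, .get ord (.get par t)])) .skip)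

/-- The search for `C₅`s and `C₆`s with last vertex `v`. -/
def searchFrom : Prog :=
  .each list i₂ h₂ s (.get st v) (.get fin v) (.ite (.lt s v)
    (forNbr i₃ h₃ w s (.ite (.ne (.get next w) (.get next v)) .skip
      (.ite (.ne w v) searchPath .skip))) .skip)

/-- Search for an induced `C₅` or `C₆`. -/
def findC5C6 : Prog :=
  .loop z hv (.lit 0) (.add n (.lit 1)) (buildLists ;; .loop v h₁ (.lit 0) n searchFrom)

end

/-- The neighbours of `v` with next dominating vertex `β`. -/
def Ctx.part (X : Ctx) (π : ℕ → ℕ) (β v : ℕ) : Finset ℕ := {t ∈ X.nb v | π t = β}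

/-- The lists of the neighbours with next dominating vertex `β` are in memory. -/
def HasLists (X : Ctx) (π : ℕ → ℕ) (β : ℕ) (s : Mem) : Prop :=
  ∀ w < X.n, s.arr .fin w ≤ X.en w ∧ IsSeg (s.arr .list) (X.st w) (s.arr .fin w) (X.part π β w)

section
variable {X : Ctx} {s : Mem} {π : ℕ → ℕ} {β : ℕ}

/-- The list of `w` is a subset of its neighbourhood, so it fits into the positions of its adjacency
list, and different lists never overlap. Appending each `t` of the class to the lists of its
neighbours costs only the degrees in the class. The stamps are cleared because the same vertices `v`
recur for the next class. -/
theorem wp_buildLists (hI : Inv X s) (hπ : s.arr .next = π) (hz : s.var .z = β)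
    (ht : s.time + (2 * X.n + ∑ t ∈ Finset.range X.n with π t = β, (X.nb t).card) ≤ X.tmax) :
    buildLists.wp X.env (fun s' => Inv X s' ∧ HasLists X π β s' ∧
      (∀ w < X.n, s'.arr .parV w = 0 ∧ s'.arr .seenV w = 0) ∧
      s'.time ≤ s.time + (2 * X.n + ∑ t ∈ Finset.range X.n with π t = β, (X.nb t).card)) s := by
  have hnN := X.n_lt
  rw [Finset.sum_filter] at ht ⊢
  refine wp_for (fun k s' => Inv X s' ∧ ∀ w < k, s'.arr .fin w = X.st w ∧ s'.arr .parV w = 0 ∧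
    s'.arr .seenV w = 0) (fun _ => 0) (fun _ => 1) X.n trivial trivial rfl hI.n hnN.le
    (by decide) (by simp; omega) (by simpa using hI) ?_ ?_
  · rintro w s1 hw ⟨hI1, h1⟩ hw1 - -
    have := (X.seg w hw).le
    have := X.en_le w hw
    simp only [Stmt.wp_seq, Stmt.wp_store]
    simp [hw1, hI1.st]
    refine ⟨by omega, by omega, by omega, ((hI1.tick.put (by decide) _ _).put (by decide) _ _).put (by decide) _ _,
      fun w' hw' => ?_⟩
    simp only [Function.update_apply]
    split_ifs with h
    · simp [h]
    · exact h1 w' (by omega)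
  rintro s1 ⟨hI1, h1⟩ f1 t1
  have hz1 : s1.var .z = β := (f1.var .z (by decide)).trans hz
  have hπ1 : s1.arr .next = π := (f1.arr .next (by decide)).trans hπ
  simp at t1
  -- A list of distinct neighbours that starts where the adjacency list starts cannot outrun it.
  have hfin : ∀ w < X.n, ∀ S ⊆ X.nb w, ∀ f r, IsSeg f (X.st w) r S → r ≤ X.en w := by
    intro w hw S hS f r hseg
    have := hseg.card
    have := (X.seg w hw).card
    have := Finset.card_le_card hS
    have := (X.seg w hw).le
    have := hseg.le
    omega
  refine wp_for (fun k s' => Inv X s' ∧ (∀ w < X.n, s'.arr .parV w = 0 ∧ s'.arr .seenV w = 0) ∧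
    ∀ w < X.n, IsSeg (s'.arr .list) (X.st w) (s'.arr .fin w) {t ∈ X.part π β w | t < k}) (fun _ => 0)
    (fun t => 1 + if π t = β then (X.nb t).card else 0) X.n trivial trivial rfl hI1.n hnN.le
    (by decide) (by simp [Finset.sum_add_distrib]; omega) ?_ ?_ ?_
  · simp only [Inv.set_iff, ne_eq, reduceCtorEq, not_false_eq_true, hI1, true_and, Store.arr_set]
    exact ⟨fun w hw => (h1 w hw).2, fun w hw => by rw [(h1 w hw).1]; simpa using IsSeg.empty _ _⟩
  · rintro t s2 ht ⟨hI2, hV2, hL2⟩ ht2 f2 t2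
    have hz2 : s2.var .z = β := (f2.var .z (by decide)).trans hz1
    have hπ2 : s2.arr .next = π := (f2.arr .next (by decide)).trans hπ1
    simp only [Stmt.wp_ite, Expr.safe_ne, Expr.eval_ne_eq_zero]
    simp [ht2, hz2, hπ2]
    refine ⟨by omega, fun hne => ⟨hI2, hV2, fun w hw => ?_⟩, fun heq => ?_⟩
    · convert hL2 w hw using 1
      ext t'
      simp only [Finset.mem_filter, Ctx.part]
      refine and_congr_right fun h => ⟨fun h' => lt_of_le_of_ne h' ?_, fun h' => by omega⟩
      rintro rfl; exact hne h.2
    · rw [if_pos heq] at t2 ⊢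
      refine wp_forNbr (fun P s' => Inv X s' ∧ (∀ w < X.n, s'.arr .parV w = 0 ∧ s'.arr .seenV w = 0) ∧
        ∀ w < X.n, IsSeg (s'.arr .list) (X.st w) (s'.arr .fin w)
          {t' ∈ X.part π β w | t' < t ∨ (t' = t ∧ w ∈ P)}) (fun _ => 0) (fun _ => 1) t hI2.tick
        ht2 ht (by decide) (by simp at t2 ⊢; omega) ?_ ?_ ?_
      · simpa [hI2] using ⟨hV2, hL2⟩
      · rintro P w s3 - hw hwP ⟨hI3, hV3, hL3⟩ f3 -
        have ht3 : s3.var .t = t := (f3.var .t (by decide)).trans ht2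
        have hwn := X.graph.lt hw
        have hseg := (hL3 w hwn).snoc (k := t) (by simp [hwP])
        have hSeq : insert t ({t' ∈ X.part π β w | t' < t ∨ (t' = t ∧ w ∈ P)} : Finset ℕ) =
            {t' ∈ X.part π β w | t' < t ∨ (t' = t ∧ w ∈ insert w P)} := by
          ext t'
          simp only [Finset.mem_insert, Finset.mem_filter, Ctx.part]
          constructor
          · rintro (rfl | ⟨h1, h2⟩)
            · exact ⟨⟨X.graph.symm hw, heq⟩, .inr ⟨rfl, .inl trivial⟩⟩
            · exact ⟨h1, h2.imp id fun h => ⟨h.1, .inl trivial⟩⟩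
          · rintro ⟨h1, h2 | h2⟩
            · exact .inr ⟨h1, .inl h2⟩
            · exact .inl h2.1
        rw [hSeq] at hseg
        have hpart : ∀ w, X.part π β w ⊆ X.nb w := fun w => Finset.filter_subset _ _
        have hle := hfin w hwn _ ((Finset.filter_subset _ _).trans (hpart w)) _ _ hseg
        have hle' := X.en_le w hwn
        have hst := (hL3 w hwn).le
        simp only [Stmt.wp_seq, Stmt.wp_store]
        simp [ht3]
        refine ⟨by omega, by omega, by omega, by omega, by omega,
          ((hI3.tick.set (by decide) _).put (by decide) _ _).put (by decide) _ _, hV3, fun w' hw' => ?_⟩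
        by_cases hww : w' = w
        · subst hww
          simpa using hseg
        · have hold := hL3 w' hw'
          have hle2 := hfin w' hw' _ ((Finset.filter_subset _ _).trans (hpart w')) _ _ hold
          simp only [ne_eq, hww, not_false_eq_true, Function.update_of_ne, false_or]
          refine hold.congr fun i h1 h2 => Function.update_of_ne ?_ _ _
          rintro rfl
          exact hww (X.sep w' hw' w hwn _ h1 (by omega) hst (by omega))
      · rintro s3 ⟨hI3, hV3, hL3⟩ - t3
        simp [hI3] at t3 ⊢
        refine ⟨⟨hV3, fun w hw => ?_⟩, by omega⟩
        convert hL3 w hw using 1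
        ext t'
        simp only [Finset.mem_filter, Ctx.part]
        refine and_congr_right fun h => ?_
        constructor
        · intro h'
          rcases h'.lt_or_eq with h' | rfl
          exacts [.inl h', .inr ⟨rfl, X.graph.symm h.1⟩]
        · rintro (h' | h')
          exacts [h'.le, h'.1.le]
  · rintro s2 ⟨hI2, hV2, hL2⟩ - t2
    simp [Finset.sum_add_distrib] at t2
    refine ⟨hI2, fun w hw => ?_, hV2, by omega⟩
    have h : ({t ∈ X.part π β w | t < X.n} : Finset ℕ) = X.part π β w :=
      Finset.filter_true_of_mem fun t ht => X.graph.lt (Finset.mem_filter.1 ht).1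
    have := hL2 w hw
    rw [h] at this
    exact ⟨hfin w hw _ (Finset.filter_subset _ _) _ _ this, this⟩

/-- The state of the search for `C₅`s and `C₆`s with last vertex `v`, when the pairs in `D` have been
treated. -/
structure Good (X : Ctx) (π : ℕ → ℕ) (β v : ℕ) (D : ℕ → ℕ → Prop) (s' : Mem) : Prop where
  valid : ∀ s w, D s w → s ∈ X.nb v ∧ π s = β ∧ s < v ∧ w ∈ X.nb s ∧ π w = π v ∧ w ≠ v
  parV : ∀ s w, D s w → s'.arr .parV w = v + 1
  par : ∀ w < X.n, s'.arr .parV w = v + 1 → D (s'.arr .par w) w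
  seen : ∀ t < X.n, s'.arr .seenV t = v + 1 →
    s'.arr .parV (s'.arr .seen t) = v + 1 ∧ t ∈ X.nb (s'.arr .seen t) ∧ π t = β
  cmp : ∀ s w t, D s w → t ∈ X.nb w → π t = β → t ≠ s →
    s'.arr .parV t ≠ v + 1 ∧ s'.arr .seenV t = v + 1 ∧ s'.arr .seen t = w
  le : ∀ w < X.n, s'.arr .parV w ≤ v + 1 ∧ s'.arr .seenV w ≤ v + 1

theorem Good.of_eq {v : ℕ} {D D' : ℕ → ℕ → Prop} {s' : Mem} (h : Good X π β v D s)
    (hD : ∀ s w, D s w ↔ D' s w) (h1 : s'.arr .parV = s.arr .parV) (h2 : s'.arr .par = s.arr .par)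
    (h3 : s'.arr .seenV = s.arr .seenV) (h4 : s'.arr .seen = s.arr .seen) : Good X π β v D' s' := by
  obtain rfl : D = D' := by ext; exact hD _ _
  obtain ⟨a1, a2, a3, a4, a5, a6⟩ := h
  constructor <;> (try simp only [h1, h2, h3, h4]) <;> assumption

/-- The facts that hold when the search for `C₅`s and `C₆`s starts. -/
structure Ready (X : Ctx) (π : ℕ → ℕ) : Prop where
  tri : ∀ a b c, ¬ Tri X.nb a b c
  ndC4 : ∀ a b c d, ¬ NdC4 X.nb a b c d
  next : IsNext X.n X.nb π

/-- The number of vertices that can still be seen, plus one. -/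
def unseen (X : Ctx) (π : ℕ → ℕ) (β v : ℕ) (f : Arr → ℕ → ℕ) : ℕ :=
  ({t ∈ Finset.range X.n | π t = β ∧ f .seenV t ≠ v + 1} : Finset ℕ).card + 1

theorem unseen_update {v t : ℕ} {f g : Arr → ℕ → ℕ} (ht : t < X.n) (hπt : π t = β)
    (hf : f .seenV t ≠ v + 1) (hg : g .seenV = Function.update (f .seenV) t (v + 1)) :
    unseen X π β v g + 1 ≤ unseen X π β v f := by
  refine Nat.succ_le_succ (Finset.card_lt_card ?_)
  rw [Finset.ssubset_iff_of_subset]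
  · exact ⟨t, by simp [ht, hπt, hf], by simp [hg]⟩
  · intro t' h
    simp only [Finset.mem_filter, hg, Function.update_apply] at h ⊢
    refine ⟨h.1, h.2.1, ?_⟩
    have := h.2.2
    split_ifs at this
    · exact absurd rfl this
    · exact this

/-- A vertex `t` reached from `w` that was itself reached as a middle vertex closes a `C₅` through
its parent. If `t` was already seen from another `w'`, it closes a `C₆` through `w'` and the parent
of `w'`. Otherwise `t` is new and gets stamped, so every vertex of the class is stamped at most once
for given `v` and `β`. -/
theorem wp_searchPath {v w b : ℕ} {D : ℕ → ℕ → Prop} (hR : Ready X π) (hI : Inv X s)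
    (hL : HasLists X π β s) (hG : Good X π β v D s) (hv : s.var .v = v) (hw : s.var .w = w)
    (hb : s.var .s = b) (hbv : b ∈ X.nb v) (hπb : π b = β) (hlt : b < v) (hwb : w ∈ X.nb b)
    (hπw : π w = π v) (hwv : w ≠ v) (hD : ∀ b', ¬ D b' w)
    (ht : s.time + unseen X π β v s.arr + 1 ≤ X.tmax) :
    searchPath.wp X.env (fun s' => Inv X s' ∧
      Good X π β v (fun b' w' => D b' w' ∨ (b' = b ∧ w' = w)) s' ∧
      s'.time + unseen X π β v s'.arr ≤ s.time + unseen X π β v s.arr + 1) s := by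
  have hnN := X.n_lt
  have hwn := X.graph.lt hwb
  have hvn := X.graph.lt' hbv
  have hbn := X.graph.lt hbv
  have hen := X.en_le w hwn
  obtain ⟨hfin, hseg⟩ := hL w hwn
  simp only [searchPath, Stmt.wp_seq, Stmt.wp_store]
  simp [hv, hw, hb]
  refine ⟨by omega, by omega, by omega, by omega, ?_⟩
  -- No pair with second component `w` has been treated, so the stamp at `w` is not current and
  -- overwriting it loses nothing.
  have hpV : s.arr .parV w ≠ v + 1 := fun h => hD _ (hG.par w hwn h)
  -- A round with `t ≠ b` is paid for by the drop of `unseen`, or ends in a report, for which the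
  -- extra one in `unseen` is reserved. Only the round `t = b` has a cost of its own.
  refine Stmt.wp_each (S := X.part π β w) (l := X.st w) (r := s.arr .fin w) (fun P s' => Inv X s' ∧
    (∀ t < X.n, s'.arr .seenV t = v + 1 →
      Function.update (s.arr .parV) w (v + 1) (s'.arr .seen t) = v + 1 ∧ t ∈ X.nb (s'.arr .seen t) ∧
        π t = β ∧ (s'.arr .seen t = w → t ∈ P)) ∧
    (∀ t ∈ P, t ≠ b → s'.arr .seenV t = v + 1 ∧ s'.arr .seen t = w ∧ s.arr .parV t ≠ v + 1) ∧
    (∀ b' w' t, D b' w' → t ∈ X.nb w' → π t = β → t ≠ b' → s'.arr .seenV t = v + 1 ∧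
      s'.arr .seen t = w') ∧ ∀ t < X.n, s'.arr .seenV t ≤ v + 1) (unseen X π β v)
    (fun t => if t = b then 1 else 0) ?_ ?_ ?_ ?_ ?_ ?_ ?_ ?_ ?_ ?_ ?_ ?_ ?_
  · simpa using hseg
  · simp [hI.st, hw]
  · simp [hw]
  · simp [hw]; omega
  · simp [hw]; omega
  · simp; omega
  · simp; omega
  · intro t ht
    have := X.graph.lt (Finset.mem_filter.1 ht).1
    simp; omega
  · decide
  · have h1 : unseen X π β v ((s.put .parV w (v + 1)).put .par w b).arr = unseen X π β v s.arr := by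
      simp [unseen]
    have h2 : ∑ t ∈ X.part π β w, (if t = b then 1 else 0) ≤ 1 := by
      rw [Finset.sum_ite_eq']; split_ifs <;> simp
    rw [h1]
    simp only [Store.time_put, Ctx.env_tmax]; omega
  · refine ⟨(((hI.put (by decide) _ _).put (by decide) _ _).set (by decide) _).set (by decide) _,
      ?_, by simp, ?_, ?_⟩
    · intro t ht h
      simp at h ⊢
      obtain ⟨h1, h2, h3⟩ := hG.seen t ht h
      have : s.arr .seen t ≠ w := fun h' => hpV (h' ▸ h1)
      exact ⟨by simp [this, h1], h2, h3, this⟩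
    · intro b' w' t h1 h2 h3 h4
      simpa using (hG.cmp b' w' t h1 h2 h3 h4).2
    · intro t ht
      simpa using (hG.le t ht).2
  · rintro P t s1 - htP htP' ⟨hI1, j1, j2, j3, j4⟩ f1 t1
    obtain ⟨htw, hπt⟩ := Finset.mem_filter.1 htP
    have htn := X.graph.lt htw
    have hv1 : s1.var .v = v := (f1.var .v (by decide)).trans (by simp [hv])
    have hw1 : s1.var .w = w := (f1.var .w (by decide)).trans (by simp [hw])
    have hb1 : s1.var .s = b := (f1.var .s (by decide)).trans (by simp [hb])
    have hpV1 : s1.arr .parV = Function.update (s.arr .parV) w (v + 1) :=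
      (f1.arr .parV (by decide)).trans (by simp)
    have hpar1 : s1.arr .par = Function.update (s.arr .par) w b :=
      (f1.arr .par (by decide)).trans (by simp)
    have htw' : t ≠ w := X.graph.ne htw
    simp only [Stmt.wp_seq, Stmt.wp_store, Stmt.wp_ite, Expr.safe_ne, Expr.eval_ne_eq_zero, Expr.safe_lit,
      Expr.safe_var, Expr.safe_add, Expr.safe_get, Expr.eval_var, Expr.eval_get, Expr.eval_lit,
      Expr.eval_add, ne_eq, Store.var_set, Store.arr_set, Store.var_tick, Store.arr_tick, hv1, hw1, hb1,
      hpV1, Function.update_of_ne htw', reduceCtorEq, if_true, if_false, true_and, and_true, Ctx.env_size,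
      Store.var_put, Store.arr_put, Ctx.env_bd, Stmt.wp_skip]
    refine ⟨fun htb => ⟨by omega, fun hp => ⟨by omega, fun hs => ?_, fun hs => ?_⟩, fun hp => ?_⟩,
      fun htb => ?_⟩
    · refine ⟨by omega, by omega, by omega, by omega, fun j => ⟨?_, ?_, ?_, ?_, ?_⟩, ?_⟩
      · exact (((hI1.tick.set (by decide) _).put (by decide) _ _).put (by decide) _ _).set (by decide) _
      · intro t' ht'
        simp only [Function.update_apply]
        split_ifs with h1 h2 h2
        · subst h1; intro _; exact ⟨rfl, htw, hπt, fun _ => by simp⟩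
        · exact absurd rfl h2
        · intro h
          obtain ⟨g1, g2, g3, g4⟩ := j1 t' ht' h
          exact ⟨rfl, g2, g3, fun h => by simp [g4 h]⟩
        · intro h
          obtain ⟨g1, g2, g3, g4⟩ := j1 t' ht' h
          rw [Function.update_of_ne h2] at g1
          exact ⟨g1, g2, g3, fun h => by simp [g4 h]⟩
      · intro t' ht' h
        simp only [Function.update_apply]
        split_ifs with h1
        · subst h1; exact ⟨rfl, rfl, hp⟩
        · exact j2 t' ((Finset.mem_insert.1 ht').resolve_left h1) h
      · intro b' w' t' h1 h2 h3 h4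
        have h5 := j3 b' w' t' h1 h2 h3 h4
        have : t' ≠ t := by rintro rfl; exact hs h5.1
        simpa [this] using h5
      · intro t' ht'
        simp only [Function.update_apply]
        split_ifs
        exacts [le_rfl, j4 t' ht']
      · have := unseen_update (X := X) (π := π) (f := s1.arr)
          (g := (((s1.tick.set .t t).put .seenV t (v + 1)).put .seen t w).arr) htn hπt hs (by simp)
        simp [htb]
        omega
    · obtain ⟨g1, g2, g3, g4⟩ := j1 t htn hs
      obtain ⟨w', hw'⟩ : ∃ w', s1.arr .seen t = w' := ⟨_, rfl⟩
      rw [hw'] at g1 g2 g4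
      have hww : w' ≠ w := fun h => htP' (g4 h)
      have hwn' := X.graph.lt' g2
      rw [Function.update_of_ne hww] at g1
      obtain ⟨b', hb'⟩ : ∃ b', s.arr .par w' = b' := ⟨_, rfl⟩
      have hDb := hG.par w' hwn' g1
      rw [hb'] at hDb
      obtain ⟨k1, k2, k3, k4, k5, k6⟩ := hG.valid _ _ hDb
      have hpar' : s1.arr .par w' = b' := by rw [hpar1, Function.update_of_ne hww, hb']
      have hbn' := X.graph.lt k1
      -- Any long chord of the hexagon `v b w t w' b'` would give two vertices of equal `π` two
      -- common neighbours of equal `π`, against `next_unique`. If `b = b'`, the edge from `b` to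
      -- `w'` is already such a chord.
      have e1 : w' ∉ X.nb b := fun h => X.graph.next_unique hR.next hR.ndC4 (v := w) (w := w') (s := b)
        (t := t) (X.graph.symm hwb) htw (X.graph.symm h) g2 hww.symm (Ne.symm htb)
        (hπw.trans k5.symm) (hπb.trans hπt.symm)
      have e2 : t ∉ X.nb v := fun h => X.graph.next_unique hR.next hR.ndC4 (v := v) (w := w) (s := b)
        (t := t) hbv h (X.graph.symm hwb) htw hwv.symm (Ne.symm htb) hπw.symm (hπb.trans hπt.symm)
      have e3 : b' ∉ X.nb w := by
        intro h
        by_cases hbb : b = b'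
        · subst hbb; exact e1 k4
        · exact X.graph.next_unique hR.next hR.ndC4 (v := v) (w := w) (s := b) (t := b') hbv k1
            (X.graph.symm hwb) h hwv.symm hbb hπw.symm (hπb.trans k2.symm)
      simp [hv1, hw1, hb1, hw', hpar', hI1.ord]
      refine ⟨by omega, X.ok_C6 hR.tri _ _ _ _ _ _ ⟨hbv, hwb, htw, X.graph.symm g2, X.graph.symm k4,
        X.graph.symm k1, e2, e1, e3⟩, ?_⟩
      simp [unseen] at t1; omega
    · obtain ⟨b', hb'⟩ : ∃ b', s.arr .par t = b' := ⟨_, rfl⟩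
      have hDb := hG.par t htn hp
      rw [hb'] at hDb
      obtain ⟨k1, k2, k3, k4, k5, k6⟩ := hG.valid _ _ hDb
      have hpar' : s1.arr .par t = b' := by rw [hpar1, Function.update_of_ne htw', hb']
      have hbn' := X.graph.lt k1
      simp [hv1, hw1, hb1, hpar', hI1.ord]
      refine ⟨by omega, X.ok_C5 hR.tri _ _ _ _ _ ⟨hbv, hwb, htw, X.graph.symm k4, X.graph.symm k1⟩, ?_⟩
      simp [unseen] at t1; omega
    · subst htb
      simp [hI1, unseen] at t1 ⊢
      refine ⟨⟨fun t' ht' h => ?_, j2, j3, j4⟩, by omega⟩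
      obtain ⟨g1, g2, g3, g4⟩ := j1 t' ht' h
      exact ⟨g1, g2, g3, fun h => .inr (g4 h)⟩
  · rintro s1 ⟨hI1, j1, j2, j3, j4⟩ f1 t1
    have hpV1 : s1.arr .parV = Function.update (s.arr .parV) w (v + 1) :=
      (f1.arr .parV (by decide)).trans (by simp)
    have hpar1 : s1.arr .par = Function.update (s.arr .par) w b :=
      (f1.arr .par (by decide)).trans (by simp)
    refine ⟨hI1, ⟨?_, ?_, ?_, ?_, ?_, ?_⟩, ?_⟩
    · rintro b' w' (h | ⟨rfl, rfl⟩)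
      · exact hG.valid _ _ h
      · exact ⟨hbv, hπb, hlt, hwb, hπw, hwv⟩
    · rintro b' w' (h | ⟨rfl, rfl⟩)
      · have := hG.parV _ _ h
        rw [hpV1, Function.update_apply]; split_ifs <;> simp [this]
      · simp [hpV1]
    · intro w' hwn' h
      rw [hpar1, Function.update_apply]
      by_cases hww : w' = w
      · simp [hww]
      · rw [hpV1, Function.update_of_ne hww] at h
        rw [if_neg hww]
        exact .inl (hG.par w' hwn' h)
    · intro t htn h
      obtain ⟨g1, g2, g3, -⟩ := j1 t htn h
      exact ⟨hpV1 ▸ g1, g2, g3⟩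
    · rintro b' w' t (h | ⟨rfl, rfl⟩) h1 h2 h3
      · refine ⟨?_, j3 b' w' t h h1 h2 h3⟩
        rw [hpV1]
        -- The new stamp at `w` could spoil an earlier pair `(b', w')` with `w'` adjacent to `w`.
        -- But then `w'` is in the list of `w` and the scan would have reported it as a stamped
        -- vertex, except for `w' = b`, where `v`, `b'`, `b` form a triangle.
        by_cases htw : t = w
        · subst htw
          obtain ⟨k1, k2, k3, k4, k5, k6⟩ := hG.valid _ _ h
          have hw't : w' ∈ X.part π β t :=
            Finset.mem_filter.2 ⟨X.graph.symm h1, k5.trans (hπw.symm.trans h2)⟩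
          by_cases hwb' : w' = b
          · subst hwb'
            exact absurd ⟨k1, k4, X.graph.symm hbv⟩ (hR.tri v b' w')
          · exact absurd (hG.parV _ _ h) (j2 w' hw't hwb').2.2
        · rw [Function.update_of_ne htw]
          exact (hG.cmp b' w' t h h1 h2 h3).1
      · obtain ⟨g1, g2, g3⟩ := j2 t (Finset.mem_filter.2 ⟨h1, h2⟩) h3
        rw [hpV1, Function.update_of_ne (X.graph.ne h1)]
        exact ⟨g3, g1, g2⟩
    · intro w' hwn'
      refine ⟨?_, j4 w' hwn'⟩
      rw [hpV1, Function.update_apply]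
      split_ifs
      exacts [le_rfl, (hG.le w' hwn').1]
    · have h1 : unseen X π β v ((s.put .parV w (v + 1)).put .par w b).arr = unseen X π β v s.arr := by
        simp [unseen]
      have h2 : ∑ t ∈ X.part π β w, (if t = b then 1 else 0) ≤ 1 := by
        rw [Finset.sum_ite_eq']; split_ifs <;> simp
      rw [h1] at t1
      simp only [Store.time_put] at t1; omega

/-- The pairs that the search with last vertex `v` has to treat. -/
def Todo (X : Ctx) (π : ℕ → ℕ) (β v s w : ℕ) : Prop :=
  s ∈ X.nb v ∧ π s = β ∧ s < v ∧ w ∈ X.nb s ∧ π w = π v ∧ w ≠ v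

/-- Each pair `(s, w)` costs two units: its own round, and the round `t = s` within `searchPath`.
All other rounds are paid for by the potential, which starts at no more than the size of the class
plus one. -/
theorem wp_searchFrom {v : ℕ} (hR : Ready X π) (hI : Inv X s) (hL : HasLists X π β s)
    (hπ : s.arr .next = π) (hv : s.var .v = v) (hvn : v < X.n)
    (hV : ∀ w < X.n, s.arr .parV w ≤ v ∧ s.arr .seenV w ≤ v)
    (ht : s.time + (({t ∈ Finset.range X.n | π t = β} : Finset ℕ).card + 1 +
      ∑ u ∈ X.part π β v, (1 + if u < v then 2 * (X.nb u).card else 0)) ≤ X.tmax) :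
    searchFrom.wp X.env (fun s' => Inv X s' ∧ Good X π β v (Todo X π β v) s' ∧
      s'.time ≤ s.time + (({t ∈ Finset.range X.n | π t = β} : Finset ℕ).card + 1 +
        ∑ u ∈ X.part π β v, (1 + if u < v then 2 * (X.nb u).card else 0))) s := by
  have hnN := X.n_lt
  have hen := X.en_le v hvn
  obtain ⟨hfin, hseg⟩ := hL v hvn
  have hΦ : unseen X π β v s.arr ≤ ({t ∈ Finset.range X.n | π t = β} : Finset ℕ).card + 1 := by
    refine Nat.succ_le_succ (Finset.card_le_card fun t h => ?_)
    simp only [Finset.mem_filter] at h ⊢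
    exact ⟨h.1, h.2.1⟩
  refine Stmt.wp_each (S := X.part π β v) (l := X.st v) (r := s.arr .fin v) (fun P s' => Inv X s' ∧
    Good X π β v (fun b w => b ∈ P ∧ Todo X π β v b w) s') (unseen X π β v)
    (fun u => 1 + if u < v then 2 * (X.nb u).card else 0) ?_ ?_ ?_ ?_ ?_ ?_ ?_ ?_ ?_ ?_ ?_ ?_ ?_
  · simpa using hseg
  · simp [hI.st, hv]
  · simp [hv]
  · simp [hv]; omega
  · simp [hv]; omega
  · simp; omega
  · simp; omega
  · intro t ht
    have := X.graph.lt (Finset.mem_filter.1 ht).1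
    simp; omega
  · decide
  · simp only [Ctx.env_tmax]; omega
  · refine ⟨(hI.set (by decide) _).set (by decide) _, ?_⟩
    constructor
    · rintro _ _ ⟨h, -⟩; simp at h
    · rintro _ _ ⟨h, -⟩; simp at h
    · intro w hw h; have := (hV w hw).1; simp at h; omega
    · intro w hw h; have := (hV w hw).2; simp at h; omega
    · rintro _ _ _ ⟨h, -⟩; simp at h
    · intro w hw; have := hV w hw; simp; omega
  · rintro P b s1 - hb hbP ⟨hI1, hG1⟩ f1 t1
    obtain ⟨hbv, hπb⟩ := Finset.mem_filter.1 hb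
    have hbn := X.graph.lt hbv
    have hv1 : s1.var .v = v := (f1.var .v (by decide)).trans (by simp [hv])
    have hπ1 : s1.arr .next = π := (f1.arr .next (by decide)).trans hπ
    have hL1 : HasLists X π β s1 := by
      intro w hw
      rw [f1.arr .fin (by decide), f1.arr .list (by decide)]; exact hL w hw
    simp only [Stmt.wp_ite, Expr.safe_lt, Expr.eval_lt_eq_zero, ne_eq, not_le, Expr.safe_var, Expr.eval_var,
      Store.var_set, Store.var_tick, hv1, reduceCtorEq, if_true, if_false, true_and, Stmt.wp_skip]
    refine ⟨fun hbv' => ?_, fun hvb => ⟨fun j => ⟨(hI1.tick.set (by decide) _).set (by decide) _,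
      hG1.of_eq (fun b' w => ?_) rfl rfl rfl rfl⟩, ?_⟩⟩
    · rw [if_pos hbv'] at t1 ⊢
      refine wp_forNbr (fun P' s' => Inv X s' ∧ Good X π β v (fun b' w => (b' ∈ P ∧ Todo X π β v b' w) ∨
        (b' = b ∧ w ∈ P' ∧ Todo X π β v b' w)) s') (unseen X π β v) (fun _ => 2) b
        (hI1.tick.set (by decide) _) (by simp) hbn (by decide) ?_ ?_ ?_ ?_
      · simp only [Store.time_set, Store.time_tick, Store.arr_set, Store.arr_tick, Finset.sum_const, smul_eq_mul,
          Ctx.env_tmax] at t1 ⊢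
        omega
      · exact ⟨((hI1.tick.set (by decide) _).set (by decide) _).set (by decide) _,
          hG1.of_eq (fun b' w => by simp) rfl rfl rfl rfl⟩
      · rintro P' w s2 - hw hwP ⟨hI2, hG2⟩ f2 t2
        have hv2 : s2.var .v = v := (f2.var .v (by decide)).trans (by simp [hv1])
        have hb2 : s2.var .s = b := (f2.var .s (by decide)).trans (by simp)
        have hπ2 : s2.arr .next = π := (f2.arr .next (by decide)).trans hπ1
        have hL2 : HasLists X π β s2 := by
          intro w hw
          rw [f2.arr .fin (by decide), f2.arr .list (by decide)]; exact hL1 w hw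
        have hwn := X.graph.lt hw
        have hskip : ¬ Todo X π β v b w → ∀ b' w', ((b' ∈ P ∧ Todo X π β v b' w') ∨
            (b' = b ∧ w' ∈ P' ∧ Todo X π β v b' w')) ↔ ((b' ∈ P ∧ Todo X π β v b' w') ∨
            (b' = b ∧ w' ∈ insert w P' ∧ Todo X π β v b' w')) := by
          intro h b' w'
          refine or_congr_right (and_congr_right fun hbb => and_congr_left fun hT => ?_)
          rw [Finset.mem_insert, or_iff_right]
          rintro rfl
          exact h (hbb ▸ hT)
        simp only [Stmt.wp_ite, Expr.safe_ne, Expr.eval_ne_eq_zero, ne_eq, Expr.safe_var, Expr.safe_get,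
          Expr.eval_var, Expr.eval_get, Ctx.env_size,
          Store.var_set, Store.var_tick, Store.arr_set, Store.arr_tick, hv2, hπ2, reduceCtorEq, if_true, if_false,
          true_and, Stmt.wp_skip]
        refine ⟨by omega, fun hπw => ⟨fun j => ⟨(hI2.tick.set (by decide) _).set (by decide) _,
          hG2.of_eq (hskip fun h => hπw h.2.2.2.2.1) rfl rfl rfl rfl⟩, ?_⟩, fun hπw =>
          ⟨fun hwv => ?_, fun hwv => ⟨fun j => ⟨(hI2.tick.set (by decide) _).set (by decide) _,
          hG2.of_eq (hskip fun h => h.2.2.2.2.2 hwv) rfl rfl rfl rfl⟩, ?_⟩⟩⟩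
        · simp only [Store.time_set, Store.time_tick, Store.arr_set, Store.arr_tick]; omega
        · have hD : ∀ b', ¬ ((b' ∈ P ∧ Todo X π β v b' w) ∨ (b' = b ∧ w ∈ P' ∧ Todo X π β v b' w)) := by
            rintro b' (⟨h1, h2, h3, h4, h5, -⟩ | ⟨-, h, -⟩)
            · exact X.graph.next_unique hR.next hR.ndC4 (v := v) (w := w) (s := b) (t := b') hbv h2
                (X.graph.symm hw) (X.graph.symm h5) (Ne.symm hwv)
                (by rintro rfl; exact hbP h1) hπw.symm (hπb.trans h3.symm)
            · exact hwP h
          refine Stmt.wp_mono (wp_searchPath (s := s2.tick.set .w w) hR (hI2.tick.set (by decide) _) hL2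
            (hG2.of_eq (fun _ _ => Iff.rfl) rfl rfl rfl rfl) (by simp [hv2]) (by simp) (by simp [hb2]) hbv
            hπb hbv' hw hπw hwv hD ?_) ?_
          · simp only [Store.time_set, Store.time_tick, Store.arr_set, Store.arr_tick] at t2 ⊢; omega
          · rintro s3 ⟨hI3, hG3, t3⟩
            refine ⟨fun j => ⟨hI3.set (by decide) _, hG3.of_eq (fun b' w' => ?_) rfl rfl rfl rfl⟩, ?_⟩
            · rw [or_assoc]
              refine or_congr_right ⟨?_, ?_⟩
              · rintro (⟨h1, h2, h3⟩ | ⟨rfl, rfl⟩)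
                · exact ⟨h1, Finset.mem_insert_of_mem h2, h3⟩
                · exact ⟨rfl, Finset.mem_insert_self _ _, hbv, hπb, hbv', hw, hπw, hwv⟩
              · rintro ⟨h1, h2, h3⟩
                rcases Finset.mem_insert.1 h2 with h | h
                exacts [.inr ⟨h1, h⟩, .inl ⟨h1, h, h3⟩]
            · simp only [Store.time_set, Store.time_tick, Store.arr_set, Store.arr_tick] at t3 ⊢; omega
        · simp only [Store.time_set, Store.time_tick, Store.arr_set, Store.arr_tick]; omega
      · rintro s2 ⟨hI2, hG2⟩ - t2
        refine ⟨fun j => ⟨hI2.set (by decide) _, hG2.of_eq (fun b' w => ?_) rfl rfl rfl rfl⟩, ?_⟩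
        · rw [Finset.mem_insert]
          constructor
          · rintro (⟨h1, h2⟩ | ⟨h1, h2, h3⟩)
            exacts [⟨.inr h1, h2⟩, ⟨.inl h1, h3⟩]
          · rintro ⟨rfl | h1, h2⟩
            exacts [.inr ⟨rfl, h2.2.2.2.1, h2⟩, .inl ⟨h1, h2⟩]
        · simp only [Store.time_set, Store.time_tick, Store.arr_set, Store.arr_tick, Finset.sum_const,
            smul_eq_mul] at t2 ⊢
          omega
    · rw [Finset.mem_insert]
      refine and_congr_left fun hT => ⟨.inr, ?_⟩
      rintro (rfl | h)
      · exact absurd hT.2.2.1 (by omega)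
      · exact h
    · simp only [Store.time_set, Store.time_tick, Store.arr_set, Store.arr_tick]; omega
  · rintro s1 ⟨hI1, hG1⟩ - t1
    refine ⟨hI1, hG1.of_eq (fun b w => ⟨fun h => h.2, fun h => ⟨?_, h⟩⟩) rfl rfl rfl rfl, by omega⟩
    exact Finset.mem_filter.2 ⟨h.1, h.2.1⟩

/-- The time for the search with next dominating vertex `β`. -/
def Ctx.cost (X : Ctx) (π : ℕ → ℕ) (β : ℕ) : ℕ :=
  1 + (2 * X.n + ∑ t ∈ Finset.range X.n with π t = β, (X.nb t).card) +
    ∑ v ∈ Finset.range X.n, (1 + (({t ∈ Finset.range X.n | π t = β} : Finset ℕ).card + 1 +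
      ∑ u ∈ X.part π β v, (1 + if u < v then 2 * (X.nb u).card else 0)))

/-- The classes run up to `n` inclusive, the value for vertices without later dominator. A `C₅` may
be assumed to lie in class `n` and to start at a local maximum `a`: the path `a b c` then demands
that `d` be unstamped, whereas the path `a e d` stamps it. In a suitable `C₆` the paths `a b c` and
`a f e` both claim to be the one from which `d` was seen, so `c = e`, which contradicts the missing
chord from `b` to `e`. -/
theorem wp_findC5C6 (hR : Ready X π) (hI : Inv X s) (hπ : s.arr .next = π)
    (ht : s.time + ∑ β ∈ Finset.range (X.n + 1), X.cost π β ≤ X.tmax) :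
    findC5C6.wp X.env (fun s' => Inv X s' ∧ (∀ a b c d e, ¬ C5 X.nb a b c d e) ∧
      (∀ a b c d e f, ¬ C6 X.nb a b c d e f) ∧
      s'.time ≤ s.time + ∑ β ∈ Finset.range (X.n + 1), X.cost π β) s := by
  have hnN := X.n_lt
  refine wp_for (fun k s' => Inv X s' ∧ ∀ β < k, ∀ v < X.n, ∃ s'', Good X π β v (Todo X π β v) s'')
    (fun _ => 0) (X.cost π) (X.n + 1) (by simp) (by simp) rfl (by simp [hI.n]) hnN
    (by decide) (by simpa using ht) (by simpa using hI) ?_ ?_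
  · rintro β s1 hβ ⟨hI1, hG1⟩ hβ1 f1 t1
    have hπ1 : s1.arr .next = π := (f1.arr .next (by decide)).trans hπ
    simp only [Ctx.cost] at t1 ⊢
    simp only [Stmt.wp_seq]
    refine Stmt.wp_frame (wp_buildLists (s := s1.tick) hI1.tick hπ1 hβ1
      (by simp only [Store.time_tick]; omega)) ?_
    rintro s2 ⟨hI2, hL2, hV2, t2⟩ f2 -
    have hπ2 : s2.arr .next = π := (f2.arr .next (by decide)).trans hπ1
    simp only [Store.time_tick] at t2
    refine wp_for (fun k s' => Inv X s' ∧ (∀ w < X.n, s'.arr .parV w ≤ k ∧ s'.arr .seenV w ≤ k) ∧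
      ∀ v < k, ∃ s'', Good X π β v (Todo X π β v) s'') (fun _ => 0)
      (fun v => 1 + (({t ∈ Finset.range X.n | π t = β} : Finset ℕ).card + 1 +
        ∑ u ∈ X.part π β v, (1 + if u < v then 2 * (X.nb u).card else 0))) X.n trivial trivial rfl hI2.n
      hnN.le (by decide) (by omega) ?_ ?_ ?_
    · refine ⟨(hI2.set (by decide) _).set (by decide) _, fun w hw => ?_, by omega⟩
      have := hV2 w hw
      simp only [Store.arr_set]; omega
    · rintro v s3 hv ⟨hI3, hV3, hG3⟩ hv3 f3 t3
      have hπ3 : s3.arr .next = π := (f3.arr .next (by decide)).trans hπ2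
      have hL3 : HasLists X π β s3 := by
        intro w hw
        rw [f3.arr .fin (by decide), f3.arr .list (by decide)]; exact hL2 w hw
      refine Stmt.wp_mono (wp_searchFrom (s := s3.tick) hR hI3.tick hL3 hπ3 hv3 hv hV3 ?_) ?_
      · simp only [Store.time_tick]; omega
      · rintro s4 ⟨hI4, hG4, t4⟩
        refine ⟨⟨hI4.set (by decide) _, hG4.le, fun v' hv' => ?_⟩, ?_⟩
        · rcases Nat.lt_succ_iff_lt_or_eq.1 hv' with h | rfl
          exacts [hG3 v' h, ⟨_, hG4⟩]
        · simp only [Store.time_tick] at t4; omega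
    · rintro s3 ⟨hI3, -, hG3⟩ - t3
      refine ⟨⟨hI3.set (by decide) _, fun β' hβ' => ?_⟩, by omega⟩
      rcases Nat.lt_succ_iff_lt_or_eq.1 hβ' with h | rfl
      exacts [hG1 β' h, hG3]
  · rintro s1 ⟨hI1, hG1⟩ - t1
    refine ⟨hI1, ?_, ?_, by simpa using t1⟩
    · intro a b c d e h
      obtain ⟨a, b, c, d, e, ⟨h1, h2, h3, h4, h5⟩, hb, he, πa, πb, πc, πd, πe⟩ := C5.exists_next X.graph hR.next h
      obtain ⟨s'', hG⟩ := hG1 X.n (by omega) a (X.graph.lt h5)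
      have hc : c ≠ a := by rintro rfl; exact hR.tri _ _ _ ⟨h3, h4, h5⟩
      have hd : d ≠ a := by rintro rfl; exact hR.tri _ _ _ ⟨h1, h2, h3⟩
      have hdb : d ≠ b := by rintro rfl; exact hR.tri _ _ _ ⟨h1, h4, h5⟩
      have k1 : Todo X π X.n a b c := ⟨h1, πb, hb, h2, πc.trans πa.symm, hc⟩
      have k2 : Todo X π X.n a e d := ⟨X.graph.symm h5, πe, he, X.graph.symm h4, πd.trans πa.symm, hd⟩
      exact (hG.cmp b c d k1 h3 πd hdb).1 (hG.parV _ _ k2)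
    · intro a b c d e f h
      obtain ⟨a, b, c, d, e, f, ⟨h1, h2, h3, h4, h5, h6, h7, h8, h9⟩, hb, hf, πc, πe, πd, πf⟩ :=
        C6.exists_next X.graph hR.next hR.ndC4 h
      have hπb := (hR.next b (X.graph.lt h1) ⟨_, h2⟩).2.1
      obtain ⟨s'', hG⟩ := hG1 (π b) (by omega) a (X.graph.lt h6)
      have k1 : Todo X π (π b) a b c := ⟨h1, rfl, hb, h2, πc, by rintro rfl; exact h7 h3⟩
      have k2 : Todo X π (π b) a f e := ⟨X.graph.symm h6, πf, hf, X.graph.symm h5, πe, by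
        rintro rfl; exact h7 (X.graph.symm h4)⟩
      have e1 := (hG.cmp b c d k1 h3 πd (by rintro rfl; exact h7 h1)).2.2
      have e2 := (hG.cmp f e d k2 (X.graph.symm h4) πd (by rintro rfl; exact h7 (X.graph.symm h6))).2.2
      rw [← e1.symm.trans e2] at h8
      exact h8 h2

end

end BicliqueHelly

namespace BicliqueHelly

open RAM SortedGraph

/-! ### Sorting the vertices -/

section
open Var Arr

/-- Sort the vertices by degree, and rename them in the lists of neighbours. -/
def prepare : Prog :=
  .assign r (.add n (.lit 1)) ;;
  .loop v hv (.lit 0) n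
    (.store off v r ;; .assign r (.add r (.get adj (.add v (.lit 1))))) ;;
  .assign t (.lit 0) ;;
  .loop u h₁ (.lit 0) n (.loop v hv (.lit 0) n
    (.ite (.ne (.get adj (.add v (.lit 1))) u) .skip
      (.store ord t v ;; .store rk v t ;; .store st t (.get off v) ;;
        .store en t (.add (.get off v) (.get adj (.add v (.lit 1)))) ;; .assign t (.add t (.lit 1))))) ;;
  .loop x hv (.lit 0) m (.ite (.lt n x) (.store adj x (.get rk (.get adj x))) .skip)

end

/-- A graph on `0, …, n - 1`, represented in memory by adjacency lists, and the requirements on the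
output. -/
structure Raw : Type where
  n : ℕ
  N : ℕ
  tmax : ℕ
  nbr : ℕ → Finset ℕ
  inp : ℕ → ℕ
  ok : List ℕ → Prop
  symm : ∀ {u v}, u ∈ nbr v → v ∈ nbr u
  irrefl : ∀ v, v ∉ nbr v
  lt : ∀ {u v}, u ∈ nbr v → u < n
  inp_deg : ∀ v < n, inp (v + 1) = (nbr v).card
  N_eq : N = n + 1 + ∑ v ∈ Finset.range n, (nbr v).card
  seg : ∀ v < n, IsSeg inp (n + 1 + ∑ j ∈ Finset.range v, (nbr j).card)
    (n + 1 + ∑ j ∈ Finset.range (v + 1), (nbr j).card) (nbr v)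
  ok_tri : ∀ a b c, Tri nbr a b c → ok [a, b, c]
  ok_ndC4 : ∀ a b c d, NdC4 nbr a b c d → ok [a, b, c, d]
  ok_C5 : (∀ a b c, ¬ Tri nbr a b c) → ∀ a b c d e, C5 nbr a b c d e → ok [a, b, c, d, e]
  ok_C6 : (∀ a b c, ¬ Tri nbr a b c) → ∀ a b c d e f, C6 nbr a b c d e f → ok [a, b, c, d, e, f]

namespace Raw

/-- The environment of a graph. -/
def env (W : Raw) : Env Arr where
  size := fun _ => W.N
  bd := W.N + 1
  tmax := W.tmax
  ok := W.ok

/-- The beginning of the list of neighbours of `v`. -/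
def off (W : Raw) (v : ℕ) : ℕ := W.n + 1 + ∑ j ∈ Finset.range v, (W.nbr j).card

/-- `ord` and `rk` are inverse bijections, and `ord` sorts the vertices by degree. -/
structure Sorted (W : Raw) (ord rk : ℕ → ℕ) : Prop where
  ord_lt : ∀ r < W.n, ord r < W.n
  rk_lt : ∀ v < W.n, rk v < W.n
  rk_ord : ∀ r < W.n, rk (ord r) = r
  ord_rk : ∀ v < W.n, ord (rk v) = v
  mono : ∀ r r', r ≤ r' → r' < W.n → (W.nbr (ord r)).card ≤ (W.nbr (ord r')).card

variable {W : Raw}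

theorem off_succ (v : ℕ) : W.off (v + 1) = W.off v + (W.nbr v).card := by
  simp [off, Finset.sum_range_succ, add_assoc]

theorem off_mono {v w : ℕ} (h : v ≤ w) : W.off v ≤ W.off w :=
  Nat.add_le_add_left (Finset.sum_le_sum_of_subset (Finset.range_subset_range.2 h)) _

theorem off_n (W : Raw) : W.off W.n = W.N := W.N_eq.symm

theorem lt_off (v : ℕ) : W.n < W.off v := by simp [off]; omega

theorem card_lt {v : ℕ} (hv : v < W.n) : (W.nbr v).card < W.n := by
  have h : W.nbr v ⊂ Finset.range W.n := by
    rw [Finset.ssubset_iff_of_subset fun u hu => Finset.mem_range.2 (W.lt hu)]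
    exact ⟨v, Finset.mem_range.2 hv, W.irrefl v⟩
  simpa using Finset.card_lt_card h

theorem inp_lt {i : ℕ} (h1 : W.n < i) (h2 : i < W.N) : W.inp i < W.n := by
  have key : ∀ k ≤ W.n, i < W.off k → W.inp i < W.n := by
    intro k
    induction k with
    | zero => intro _ h; simp [off] at h; omega
    | succ k ih =>
      intro hk h
      by_cases h' : i < W.off k
      · exact ih (by omega) h'
      · exact W.lt ((W.seg k hk).mem (not_lt.1 h') h)
  exact key W.n le_rfl (W.off_n ▸ h2)

/-- The vertices that have been sorted when the vertices of degree `d` before `v` have been treated. -/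
def done (W : Raw) (d v : ℕ) : Finset ℕ :=
  {w ∈ Finset.range W.n | (W.nbr w).card < d ∨ ((W.nbr w).card = d ∧ w < v)}

/-- The store while sorting. -/
structure Sorting (W : Raw) (d v : ℕ) (s : Mem) : Prop where
  n : s.var .n = W.n
  m : s.var .m = W.N
  adj : s.arr .adj = W.inp
  mark : ∀ a : Arr, a.isMark → ∀ y, s.arr a y = 0
  off : ∀ v < W.n, s.arr .off v = W.off v
  seg : IsSeg (s.arr .ord) 0 (s.var .t) (W.done d v)
  rk : ∀ r < s.var .t, s.arr .rk (s.arr .ord r) = r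
  st : ∀ r < s.var .t, s.arr .st r = W.off (s.arr .ord r)
  en : ∀ r < s.var .t, s.arr .en r = W.off (s.arr .ord r + 1)
  mono : ∀ r r', r ≤ r' → r' < s.var .t →
    (W.nbr (s.arr .ord r)).card ≤ (W.nbr (s.arr .ord r')).card

/-- Quadratic time permits the simplest sorting: round `d` runs through all vertices and appends
those of degree `d`. Neighbours are renamed in place; the first `n + 1` input words are not
neighbours and are skipped. -/
theorem wp_prepare {s : Mem} (hn : s.var .n = W.n) (hm : s.var .m = W.N) (hadj : s.arr .adj = W.inp)
    (hmark : ∀ a : Arr, a.isMark → ∀ y, s.arr a y = 0)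
    (ht : s.time + (W.n + W.n * (1 + W.n) + W.N) ≤ W.tmax) :
    prepare.wp W.env (fun s' => s'.var .n = W.n ∧ Sorted W (s'.arr .ord) (s'.arr .rk) ∧
      (∀ a : Arr, a.isMark → ∀ y, s'.arr a y = 0) ∧
      (∀ r < W.n, s'.arr .st r = W.off (s'.arr .ord r) ∧ s'.arr .en r = W.off (s'.arr .ord r + 1)) ∧
      (∀ i, W.n < i → i < W.N → s'.arr .adj i = s'.arr .rk (W.inp i)) ∧
      s'.time ≤ s.time + (W.n + W.n * (1 + W.n) + W.N)) s := by
  have hnN : W.n < W.N := W.off_n ▸ lt_off W.n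
  have hofN : ∀ v, v ≤ W.n → W.off v ≤ W.N := fun v hv => W.off_n ▸ off_mono hv
  simp only [prepare, Stmt.wp_seq, Stmt.wp_assign]
  refine ⟨by simp, by simp [hn, env]; omega, ?_⟩
  refine Stmt.wp_for (fun k s' => s'.var .n = W.n ∧ s'.var .m = W.N ∧ s'.arr .adj = W.inp ∧
    (∀ a : Arr, a.isMark → ∀ y, s'.arr a y = 0) ∧ s'.var .r = W.off k ∧
    ∀ v < k, s'.arr .off v = W.off v) (fun _ => 0) (fun _ => 1) (l := 0) (r := W.n) rfl
    (by simp [hn]) trivial trivial (Nat.zero_le _) (by simp [env]; omega) (by decide)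
    (by simp [env]; omega) ?_ ?_ ?_
  · simpa [hn, hm, hadj, off] using hmark
  · rintro v s1 - hv ⟨hn1, hm1, hadj1, hmark1, hr1, hoff1⟩ hv1 f1 t1
    have h1 := hofN v hv.le
    have h2 := hofN (v + 1) hv
    simp only [Stmt.wp_seq, Stmt.wp_assign, Stmt.wp_store]
    simp [hn1, hm1, hadj1, hr1, hv1, env, W.inp_deg v hv, off_succ] at h2 ⊢
    refine ⟨by omega, by omega, by omega, by omega, fun a ha y => ?_, fun v' hv' => ?_⟩
    · rw [if_neg (by rintro rfl; cases ha)]; exact hmark1 a ha y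
    · rw [Function.update_apply]
      split_ifs with h
      exacts [by rw [h], hoff1 v' (by omega)]
  rintro s1 ⟨hn1, hm1, hadj1, hmark1, hr1, hoff1⟩ f1 t1
  simp at t1
  refine ⟨trivial, by simp [env], ?_⟩
  refine Stmt.wp_for (fun k s' => Sorting W k 0 s') (fun _ => 0) (fun _ => 1 + W.n) (l := 0) (r := W.n)
    rfl (by simp [hn1]) trivial trivial (Nat.zero_le _) (by simp [env]; omega) (by decide)
    (by simp [env]; omega) ?_ ?_ ?_
  · constructor <;> simp [hn1, hm1, hadj1, hmark1]
    · exact hmark1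
    · exact hoff1
    · rw [show W.done 0 0 = ∅ by ext; simp [done]]
      exact IsSeg.empty _ _
  · rintro d s2 - hd h2 hd2 f2 t2
    refine Stmt.wp_for (fun k s' => Sorting W d k s') (fun _ => 0) (fun _ => 1) (l := 0) (r := W.n)
      rfl (by simp [h2.n]) trivial trivial (Nat.zero_le _) (by simp [env]; omega) (by decide)
      (by simp [env] at t2 ⊢; omega) ?_ ?_ ?_
    · obtain ⟨a1, a2, a3, a4, a5, a6, a7, a8, a9, a10⟩ := h2
      constructor <;> simpa
    · rintro v s3 - hv h3 hv3 f3 t3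
      have hd3 : s3.var .u = d := (f3.var .u (by decide)).trans hd2
      obtain ⟨a1, a2, a3, a4, a5, a6, a7, a8, a9, a10⟩ := h3
      have h1 := hofN v hv.le
      have h2 := hofN (v + 1) hv
      simp only [Stmt.wp_seq, Stmt.wp_assign, Stmt.wp_store, Stmt.wp_ite, Expr.safe_ne,
        Expr.eval_ne_eq_zero, ne_eq]
      simp only [Expr.safe_get, Expr.safe_add, Expr.safe_var, Expr.safe_lit, Expr.eval_get, Expr.eval_add, Expr.eval_var,
        Expr.eval_lit, Store.var_tick, Store.arr_tick, Store.var_put, Store.arr_put, a3, hv3, hd3, W.inp_deg v hv, reduceCtorEq,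
        if_true, if_false, a5 v hv, true_and, and_true, Stmt.wp_skip]
      refine ⟨by simp [env]; omega, fun hne => ⟨?_, by simp⟩, fun heq => ?_⟩
      · have : W.done d (v + 1) = W.done d v := by
          ext w
          simp only [done, Finset.mem_filter]
          refine and_congr_right fun _ => or_congr_right (and_congr_right fun h => ?_)
          have : w ≠ v := by rintro rfl; exact hne h
          omega
        constructor <;> simpa [this]
      · have hvd : v ∉ W.done d v := by simp [done, heq]
        have hins : W.done d (v + 1) = insert v (W.done d v) := by
          ext w
          simp only [done, Finset.mem_filter, Finset.mem_insert, Finset.mem_range]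
          constructor
          · rintro ⟨h1, h2 | ⟨h2, h3⟩⟩
            · exact .inr ⟨h1, .inl h2⟩
            · rcases Nat.lt_succ_iff_lt_or_eq.1 h3 with h | h
              exacts [.inr ⟨h1, .inr ⟨h2, h⟩⟩, .inl h]
          · rintro (rfl | ⟨h1, h2 | ⟨h2, h3⟩⟩)
            exacts [⟨hv, .inr ⟨heq, Nat.lt_succ_self _⟩⟩, ⟨h1, .inl h2⟩,
              ⟨h1, .inr ⟨h2, h3.trans (Nat.lt_succ_self _)⟩⟩]
        have hcard : s3.var .t < W.n := by
          have h1 := a6.card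
          have h2 : (insert v (W.done d v)).card ≤ W.n := by
            have : insert v (W.done d v) ⊆ Finset.range W.n := by
              intro w hw
              rcases Finset.mem_insert.1 hw with rfl | h
              exacts [Finset.mem_range.2 hv, (Finset.mem_filter.1 h).1]
            simpa using Finset.card_le_card this
          rw [Finset.card_insert_of_notMem hvd] at h2
          omega
        have hmem : ∀ r < s3.var .t, s3.arr .ord r ∈ W.done d v := fun r hr => a6.mem (Nat.zero_le _) hr
        have hdeg : ∀ r < s3.var .t, (W.nbr (s3.arr .ord r)).card ≤ d := fun r hr => by
          have := (Finset.mem_filter.1 (hmem r hr)).2; omega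
        rw [off_succ] at h2
        simp only [env, Store.time_set, Store.time_put, Store.time_tick]
        refine ⟨by omega, by omega, by omega, by omega, by omega, by omega, by omega, by omega, by omega, ?_⟩
        have hordv : ∀ r < s3.var .t, s3.arr .ord r ≠ v := fun r hr h => hvd (h ▸ hmem r hr)
        have hseg := a6.snoc hvd
        rw [← hins] at hseg
        repeat refine ⟨by omega, ?_⟩
        refine ⟨⟨?_, ?_, ?_, ?_, ?_, ?_, ?_, ?_, ?_, ?_⟩, by omega⟩
        any_goals simp [a1, a2, a3, a5]
        · intro a ha y
          rw [if_neg (by rintro rfl; cases ha), if_neg (by rintro rfl; cases ha),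
            if_neg (by rintro rfl; cases ha), if_neg (by rintro rfl; cases ha)]
          exact a4 a ha y
        · exact a5
        · exact hseg
        · intro r hr
          rcases hr.lt_or_eq with h | rfl
          · simp [h.ne, hordv r h, a7 r h]
          · simp
        · intro r hr
          rcases hr.lt_or_eq with h | rfl
          · simp [h.ne, a8 r h]
          · simp
        · intro r hr
          rcases hr.lt_or_eq with h | rfl
          · simp [h.ne, a9 r h]
          · simp [off_succ]
        · intro r r' hrr hr
          rcases hr.lt_or_eq with h | rfl
          · simpa [h.ne, (hrr.trans_lt h).ne] using a10 r r' hrr h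
          · rcases hrr.lt_or_eq with h | rfl
            · simpa [h.ne, heq] using hdeg r h
            · simp
    · rintro s3 h3 - t3
      simp at t3
      have : W.done (d + 1) 0 = W.done d W.n := by
        ext w
        simp only [done, Finset.mem_filter, Finset.mem_range]
        refine and_congr_right fun h => ?_
        omega
      obtain ⟨a1, a2, a3, a4, a5, a6, a7, a8, a9, a10⟩ := h3
      refine ⟨?_, by omega⟩
      constructor <;> simpa [this]
  · rintro s2 ⟨a1, a2, a3, a4, a5, a6, a7, a8, a9, a10⟩ f2 t2
    simp at t2
    -- All degrees are below `n`, so `n` rounds place every vertex.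
    have hdone : W.done W.n 0 = Finset.range W.n := by
      refine Finset.filter_true_of_mem fun w hw => .inl (card_lt (Finset.mem_range.1 hw))
    rw [hdone] at a6
    have htn : s2.var .t = W.n := by have := a6.card; simp at this; omega
    rw [htn] at a6 a7 a8 a9 a10
    have hS : Sorted W (s2.arr .ord) (s2.arr .rk) := by
      have h1 : ∀ r < W.n, s2.arr .ord r < W.n := fun r hr =>
        Finset.mem_range.1 (a6.mem (Nat.zero_le _) hr)
      have h2 : ∀ v < W.n, ∃ r < W.n, s2.arr .ord r = v := fun v hv => by
        obtain ⟨r, hr, h⟩ := a6.bij.surjOn (Finset.mem_coe.2 (Finset.mem_range.2 hv))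
        exact ⟨r, hr.2, h⟩
      refine ⟨h1, fun v hv => ?_, a7, fun v hv => ?_, a10⟩
      · obtain ⟨r, hr, rfl⟩ := h2 v hv
        rwa [a7 r hr]
      · obtain ⟨r, hr, rfl⟩ := h2 v hv
        rw [a7 r hr]
    refine Stmt.wp_for (fun k s' => s'.var .n = W.n ∧ s'.arr .rk = s2.arr .rk ∧
      ∀ i, s'.arr .adj i = if W.n < i ∧ i < k then s2.arr .rk (W.inp i) else W.inp i) (fun _ => 0)
      (fun _ => 1) (l := 0) (r := W.N) rfl (by simp [a2]) trivial trivial (Nat.zero_le _)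
      (by simp [env]) (by decide) (by simp [env]; omega) ?_ ?_ ?_
    · simp [a1, a3]
    · rintro i s3 - hi ⟨hn3, hrk3, hadj3⟩ hi3 f3 t3
      simp only [Stmt.wp_ite, Stmt.wp_store, Expr.safe_lt, Expr.eval_lt_eq_zero, ne_eq, not_le]
      simp [hn3, hi3, hrk3, env]
      refine ⟨fun hni => ?_, fun hni j => ?_⟩
      · have h1 := inp_lt hni hi
        have h2 := hS.rk_lt _ h1
        rw [show s3.arr .adj i = W.inp i by rw [hadj3]; simp]
        refine ⟨by omega, by omega, by omega, fun j => ?_⟩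
        rw [Function.update_apply]
        by_cases hj : j = i
        · subst hj; simp [hni]
        · rw [if_neg hj, hadj3 j]
          refine if_congr ?_ rfl rfl
          omega
      · rw [hadj3 j]
        refine if_congr ?_ rfl rfl
        omega
    · rintro s3 ⟨hn3, hrk3, hadj3⟩ f3 t3
      have hord3 : s3.arr .ord = s2.arr .ord := f3.arr .ord (by decide)
      simp at t3
      refine ⟨hn3, by rw [hord3, hrk3]; exact hS, fun a ha y => ?_, fun r hr => ?_, fun i h1 h2 => ?_, by omega⟩
      · rw [f3.arr a (by simp [Stmt.arrs]; rintro rfl; cases ha)]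
        exact a4 a ha y
      · rw [hord3, f3.arr .st (by decide), f3.arr .en (by decide)]
        exact ⟨a8 r hr, a9 r hr⟩
      · rw [hadj3, hrk3, if_pos ⟨h1, h2⟩]

end Raw

end BicliqueHelly

namespace BicliqueHelly

open RAM SortedGraph Finset

/-! ### The whole search -/

/-- The search for obstructions in a sorted graph. -/
def search : Prog := findTriangle ;; findOracles ;; findC4 ;; findNext ;; findC5C6

/-- A bound for the number of steps of the search. -/
def Ctx.budget (X : Ctx) : ℕ :=
  25 * (X.n * X.n) + 9 * X.n + 1 + 4 * ∑ v ∈ range X.n, (X.nb v).card +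
    7 * ∑ v ∈ range X.n, X.low v

/-- Each `t` belongs to at most one class, so sums over classes do not multiply the work. -/
theorem Ctx.sum_filter_le {X : Ctx} {π : ℕ → ℕ} (S : Finset ℕ) (f : ℕ → ℕ) :
    ∑ β ∈ range (X.n + 1), ∑ t ∈ S with π t = β, f t ≤ ∑ t ∈ S, f t := by
  simp only [sum_filter]
  rw [sum_comm]
  refine sum_le_sum fun t _ => ?_
  rw [sum_ite_eq]
  split_ifs <;> simp

/-- For each of the `n + 1` classes there is linear work to reset arrays and to start at every `v`.
All other terms are sums over a class and collapse to sums over all vertices. -/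
theorem Ctx.sum_cost_le (X : Ctx) (π : ℕ → ℕ) : ∑ β ∈ range (X.n + 1), X.cost π β ≤
    5 * (X.n * X.n) + 5 * X.n + 1 + 2 * ∑ v ∈ range X.n, (X.nb v).card +
      2 * ∑ v ∈ range X.n, X.low v := by
  have h1 := Ctx.sum_filter_le (X := X) (π := π) (range X.n) fun t => (X.nb t).card
  have h2 : ∑ β ∈ range (X.n + 1), ({t ∈ range X.n | π t = β} : Finset ℕ).card ≤ X.n := by
    have := Ctx.sum_filter_le (X := X) (π := π) (range X.n) fun _ => 1
    simpa using this
  have h3 : ∀ v, ∑ β ∈ range (X.n + 1), ∑ u ∈ X.part π β v,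
      (1 + if u < v then 2 * (X.nb u).card else 0) ≤ (X.nb v).card + 2 * X.low v := fun v => by
    refine (Ctx.sum_filter_le (X.nb v) _).trans ?_
    rw [X.low_eq, sum_add_distrib, mul_sum]
    simp
  simp only [Ctx.cost]
  simp only [sum_add_distrib (s := range (X.n + 1))]
  rw [sum_comm]
  simp only [sum_add_distrib (s := range (X.n + 1)), sum_const, card_range, smul_eq_mul]
  have h4 : ∑ v ∈ range X.n, ((X.n + 1) * 1 + (∑ β ∈ range (X.n + 1),
      ({t ∈ range X.n | π t = β} : Finset ℕ).card + (X.n + 1) * 1 + ∑ β ∈ range (X.n + 1),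
        ∑ u ∈ X.part π β v, (1 + if u < v then 2 * (X.nb u).card else 0))) ≤
      ∑ v ∈ range X.n, ((3 * X.n + 2) + ((X.nb v).card + 2 * X.low v)) :=
    sum_le_sum fun v _ => by have := h3 v; omega
  rw [sum_add_distrib (f := fun v => 3 * X.n + 2),
    sum_add_distrib (f := fun v => (X.nb v).card), ← mul_sum] at h4
  simp only [sum_const, card_range, smul_eq_mul] at h4
  nlinarith

theorem wp_search {X : Ctx} {s : Mem} (hI : Inv X s) (ht : s.time + X.budget ≤ X.tmax) :
    search.wp X.env (fun s' => (∀ a b c, ¬ Tri X.nb a b c) ∧ (∀ a b c d, ¬ NdC4 X.nb a b c d) ∧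
      (∀ a b c d e, ¬ C5 X.nb a b c d e) ∧ (∀ a b c d e f, ¬ C6 X.nb a b c d e f) ∧
      s'.time ≤ s.time + X.budget) s := by
  have hb : X.budget = 25 * (X.n * X.n) + 9 * X.n + 1 + 4 * ∑ v ∈ range X.n, (X.nb v).card +
    7 * ∑ v ∈ range X.n, X.low v := rfl
  have e1 : ∑ v ∈ range X.n, (1 + 2 * (X.nb v).card + X.low v) =
      X.n + 2 * ∑ v ∈ range X.n, (X.nb v).card + ∑ v ∈ range X.n, X.low v := by
    simp [sum_add_distrib, mul_sum]
  have e2 : ∑ w ∈ range X.n, (1 + 14 * X.n + 2 * X.low w) =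
      X.n + 14 * (X.n * X.n) + 2 * ∑ v ∈ range X.n, X.low v := by
    simp [sum_add_distrib, mul_sum]; ring
  have e3 : ∑ w ∈ range X.n, (1 + 3 * X.n + 2 * X.low w) =
      X.n + 3 * (X.n * X.n) + 2 * ∑ v ∈ range X.n, X.low v := by
    simp [sum_add_distrib, mul_sum]; ring
  have e4 : ∑ _w ∈ range X.n, (1 + 3 * X.n) = X.n + 3 * (X.n * X.n) := by
    simp; ring
  unfold search
  rw [Stmt.wp_seq]
  refine Stmt.wp_mono (wp_findTriangle hI (by omega)) ?_
  rintro s1 ⟨hI1, hT, t1⟩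
  rw [Stmt.wp_seq]
  refine Stmt.wp_mono (wp_findOracles hI1 (by omega)) ?_
  rintro s2 ⟨hI2, hO2, t2⟩
  rw [Stmt.wp_seq]
  refine Stmt.wp_frame (wp_findC4 hI2 hO2 (by omega)) ?_
  rintro s3 ⟨hI3, hC4, t3⟩ f3 -
  rw [Stmt.wp_seq]
  have hO3 := hO2.of_eq (f3.arr _ (by decide)) (f3.arr _ (by decide))
  refine Stmt.wp_mono (wp_findNext hI3 hO3 (by omega)) ?_
  rintro s4 ⟨hI4, hN, -, t4⟩
  have e5 := X.sum_cost_le (s4.arr .next)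
  refine Stmt.wp_mono (wp_findC5C6 ⟨hT, hC4, hN⟩ hI4 rfl (by omega)) ?_
  rintro s5 ⟨-, h5, h6, t5⟩
  exact ⟨hT, hC4, h5, h6, by omega⟩

/-! ### Transfer between the input graph and the sorted graph -/

namespace Raw

variable {W : Raw} {ord rk : ℕ → ℕ}

/-- The neighbours of the vertex at position `r`. -/
def nbs (W : Raw) (ord rk : ℕ → ℕ) (r : ℕ) : Finset ℕ :=
  if r < W.n then (W.nbr (ord r)).image rk else ∅

theorem Sorted.mem_nbs (h : Sorted W ord rk) {q r : ℕ} :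
    q ∈ W.nbs ord rk r ↔ q < W.n ∧ r < W.n ∧ ord q ∈ W.nbr (ord r) := by
  unfold nbs
  split_ifs with hr
  · simp only [mem_image, hr, true_and]
    constructor
    · rintro ⟨v, hv, rfl⟩
      rw [h.ord_rk v (W.lt hv)]
      exact ⟨h.rk_lt v (W.lt hv), hv⟩
    · rintro ⟨h1, h2⟩
      exact ⟨_, h2, h.rk_ord q h1⟩
  · simp [hr]

theorem Sorted.injOn (h : Sorted W ord rk) : Set.InjOn rk {v | v < W.n} := fun v hv w hw e => by
  rw [← h.ord_rk v hv, ← h.ord_rk w hw, e]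

theorem Sorted.card_nbs (h : Sorted W ord rk) {r : ℕ} (hr : r < W.n) :
    (W.nbs ord rk r).card = (W.nbr (ord r)).card := by
  rw [nbs, if_pos hr, card_image_of_injOn (h.injOn.mono fun v hv => W.lt hv)]

theorem Sorted.nbs_rk (h : Sorted W ord rk) {v w : ℕ} (hv : v < W.n) (hw : w < W.n) :
    rk v ∈ W.nbs ord rk (rk w) ↔ v ∈ W.nbr w := by
  rw [h.mem_nbs, h.ord_rk v hv, h.ord_rk w hw]
  exact ⟨fun h => h.2.2, fun h' => ⟨h.rk_lt v hv, h.rk_lt w hw, h'⟩⟩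

theorem Sorted.subset (h : Sorted W ord rk) {q r : ℕ} (hq : q < W.n) (hr : r < W.n) :
    W.nbs ord rk q ⊆ W.nbs ord rk r ↔ W.nbr (ord q) ⊆ W.nbr (ord r) := by
  constructor
  · intro hs v hv
    have hvn := W.lt hv
    have := (h.nbs_rk hvn (h.ord_lt q hq)).2 hv
    rw [h.rk_ord q hq] at this
    replace this := hs this
    rw [h.mem_nbs, h.ord_rk v hvn] at this
    exact this.2.2
  · intro hs v hv
    rw [h.mem_nbs] at hv ⊢
    exact ⟨hv.1, hr, hs hv.2.2⟩

theorem Sorted.tri (h : Sorted W ord rk) :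
    (∃ a b c, Tri (W.nbs ord rk) a b c) ↔ ∃ a b c, Tri W.nbr a b c := by
  constructor
  · rintro ⟨a, b, c, h1, h2, h3⟩
    rw [h.mem_nbs] at h1 h2 h3
    exact ⟨_, _, _, h1.2.2, h2.2.2, h3.2.2⟩
  · rintro ⟨a, b, c, h1, h2, h3⟩
    have ha := W.lt h3
    have hb := W.lt h1
    have hc := W.lt h2
    exact ⟨_, _, _, (h.nbs_rk hb ha).2 h1, (h.nbs_rk hc hb).2 h2, (h.nbs_rk ha hc).2 h3⟩

/-- The sorted graph in memory. -/
def ctx (h : Sorted W ord rk) {adj st en : ℕ → ℕ}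
    (hst : ∀ r < W.n, st r = W.off (ord r) ∧ en r = W.off (ord r + 1))
    (hadj : ∀ i, W.n < i → i < W.N → adj i = rk (W.inp i)) : Ctx where
  n := W.n
  N := W.N
  tmax := W.tmax
  nb := W.nbs ord rk
  adj := adj
  st := st
  en := en
  ord := ord
  ok := W.ok
  graph := by
    refine ⟨fun h1 => ?_, fun v h1 => ?_, fun h1 => (h.mem_nbs.1 h1).1, fun {v w} h1 h2 => ?_⟩
    · rw [h.mem_nbs] at h1 ⊢
      exact ⟨h1.2.1, h1.1, W.symm h1.2.2⟩
    · exact W.irrefl _ (h.mem_nbs.1 h1).2.2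
    · rw [h.card_nbs (h1.trans_lt h2), h.card_nbs h2]
      exact h.mono v w h1 h2
  n_lt := W.off_n ▸ lt_off W.n
  seg r hr := by
    have hn := h.ord_lt r hr
    have hseg := W.seg _ hn
    have hN : W.off (ord r + 1) ≤ W.N := W.off_n ▸ off_mono hn
    rw [(hst r hr).1, (hst r hr).2]
    refine IsSeg.congr (f := rk ∘ W.inp) ⟨hseg.le, ?_⟩ fun i h1 h2 =>
      hadj i ((lt_off _).trans_le h1) (h2.trans_le hN)
    rw [nbs, if_pos hr, coe_image]
    exact ((h.injOn.mono fun v hv => W.lt hv).bijOn_image).comp hseg.bij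
  en_le r hr := by
    rw [(hst r hr).2, ← W.off_n]
    exact off_mono (h.ord_lt r hr)
  sep r hr r' hr' i h1 h2 h3 h4 := by
    rw [(hst r hr).1] at h1
    rw [(hst r hr).2] at h2
    rw [(hst r' hr').1] at h3
    rw [(hst r' hr').2] at h4
    have : ord r = ord r' := by
      rcases lt_trichotomy (ord r) (ord r') with h5 | h5 | h5
      · have := off_mono (W := W) (Nat.add_one_le_of_lt h5)
        omega
      · exact h5
      · have := off_mono (W := W) (Nat.add_one_le_of_lt h5)
        omega
    rw [← h.rk_ord r hr, this, h.rk_ord r' hr']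
  ok_tri a b c := by
    rintro ⟨h1, h2, h3⟩
    rw [h.mem_nbs] at h1 h2 h3
    exact W.ok_tri _ _ _ ⟨h1.2.2, h2.2.2, h3.2.2⟩
  ok_ndC4 a b c d := by
    rintro ⟨h1, h2, h3, h4, h5, h6, h7, h8⟩
    rw [h.mem_nbs] at h1 h2 h3 h4
    rw [h.subset] at h5 h6 h7 h8 <;> try tauto
    exact W.ok_ndC4 _ _ _ _ ⟨h1.2.2, h2.2.2, h3.2.2, h4.2.2, h5, h6, h7, h8⟩
  ok_C5 hT a b c d e := by
    rintro ⟨h1, h2, h3, h4, h5⟩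
    rw [h.mem_nbs] at h1 h2 h3 h4 h5
    refine W.ok_C5 (fun a b c hh => ?_) _ _ _ _ _ ⟨h1.2.2, h2.2.2, h3.2.2, h4.2.2, h5.2.2⟩
    obtain ⟨a, b, c, hh⟩ := h.tri.2 ⟨a, b, c, hh⟩
    exact hT a b c hh
  ok_C6 hT a b c d e f := by
    rintro ⟨h1, h2, h3, h4, h5, h6, h7, h8, h9⟩
    rw [h.mem_nbs] at h1 h2 h3 h4 h5 h6 h7 h8 h9
    refine W.ok_C6 (fun a b c hh => ?_) _ _ _ _ _ _ ⟨h1.2.2, h2.2.2, h3.2.2, h4.2.2, h5.2.2, h6.2.2,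
      fun hh => h7 ⟨h3.1, h1.2.1, hh⟩, fun hh => h8 ⟨h4.1, h1.1, hh⟩, fun hh => h9 ⟨h5.1, h2.1, hh⟩⟩
    obtain ⟨a, b, c, hh⟩ := h.tri.2 ⟨a, b, c, hh⟩
    exact hT a b c hh

theorem sum_ord (h : Sorted W ord rk) (f : ℕ → ℕ) :
    ∑ r ∈ range W.n, f (ord r) = ∑ v ∈ range W.n, f v :=
  sum_nbij' ord rk (by simpa using h.ord_lt) (by simpa using h.rk_lt) (by simpa using h.rk_ord)
    (by simpa using h.ord_rk) fun _ _ => rfl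

/-- `B` bounds the number of steps from a vertex to a neighbour before it and then to all
neighbours, when the vertices are sorted by degree. -/
def LowBound (W : Raw) (B : ℕ) : Prop :=
  ∀ rk : ℕ → ℕ, Set.InjOn rk {v | v < W.n} →
    (∀ u < W.n, ∀ v < W.n, rk u < rk v → (W.nbr u).card ≤ (W.nbr v).card) →
    ∑ v ∈ range W.n, ∑ u ∈ W.nbr v with rk u < rk v, (W.nbr u).card ≤ B

/-- The program, after the computation of the bounds of the input. -/
def main : Prog := prepare ;; search

/-- Sorting takes `n² + 3n + 1` rounds plus the sum of the degrees; the rest of the bound is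
`Ctx.budget`. Obstructions are carried back to the input graph along the bijection `ord`. -/
theorem wp_main {s : Mem} {B : ℕ} (hn : s.var .n = W.n) (hm : s.var .m = W.N)
    (hadj : s.arr .adj = W.inp) (hmark : ∀ a : Arr, a.isMark → ∀ y, s.arr a y = 0)
    (hB : W.LowBound B)
    (ht : s.time + (26 * (W.n * W.n) + 12 * W.n + 2 + 5 * ∑ v ∈ range W.n, (W.nbr v).card + 7 * B) ≤
      W.tmax) :
    main.wp W.env (fun s' => (∀ a b c, ¬ Tri W.nbr a b c) ∧ (∀ a b c d, ¬ NdC4 W.nbr a b c d) ∧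
      (∀ a b c d e, ¬ C5 W.nbr a b c d e) ∧ (∀ a b c d e f, ¬ C6 W.nbr a b c d e f) ∧
      s'.time ≤ W.tmax) s := by
  unfold main
  rw [Stmt.wp_seq]
  have hN := W.N_eq
  have hq : W.n * (1 + W.n) = W.n + W.n * W.n := by ring
  refine Stmt.wp_mono (wp_prepare hn hm hadj hmark (by omega)) ?_
  rintro s1 ⟨hn1, hS, hmark1, hst, hadj1, ht1⟩
  -- Positions are translated to vertices, so that `LowBound`, which speaks of an arbitrary ranking
  -- by degree, applies.
  have hlow : ∑ r ∈ range W.n, (ctx hS hst hadj1).low r ≤ B := by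
    have : ∀ r ∈ range W.n, (ctx hS hst hadj1).low r = ∑ u ∈ W.nbr (s1.arr .ord r) with
        s1.arr .rk u < s1.arr .rk (s1.arr .ord r), (W.nbr u).card := by
      intro r hr
      rw [mem_range] at hr
      simp only [Ctx.low, ctx]
      rw [hS.rk_ord r hr]
      refine (sum_nbij (s1.arr .rk) ?_ ?_ ?_ ?_).symm
      · intro u hu
        rw [mem_filter] at hu ⊢
        refine ⟨?_, hu.2⟩
        have := (hS.nbs_rk (W.lt hu.1) (hS.ord_lt r hr)).2 hu.1
        rwa [hS.rk_ord r hr] at this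
      · exact hS.injOn.mono fun u hu => W.lt (mem_filter.1 hu).1
      · intro q hq
        rw [mem_coe, mem_filter, hS.mem_nbs] at hq
        refine ⟨s1.arr .ord q, ?_, hS.rk_ord q hq.1.1⟩
        rw [mem_coe, mem_filter, hS.rk_ord q hq.1.1]
        exact ⟨hq.1.2.2, hq.2⟩
      · intro u hu
        have hun := W.lt (mem_filter.1 hu).1
        rw [hS.card_nbs (hS.rk_lt u hun), hS.ord_rk u hun]
    rw [sum_congr rfl this, sum_ord hS fun v => ∑ u ∈ W.nbr v with s1.arr .rk u < s1.arr .rk v,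
      (W.nbr u).card]
    refine hB _ hS.injOn fun u hu v hv huv => ?_
    have := hS.mono _ _ huv.le (hS.rk_lt v hv)
    rwa [hS.ord_rk u hu, hS.ord_rk v hv] at this
  have hcard : ∑ r ∈ range W.n, ((ctx hS hst hadj1).nb r).card = ∑ v ∈ range W.n, (W.nbr v).card := by
    rw [← sum_ord hS fun v => (W.nbr v).card]
    exact sum_congr rfl fun r hr => hS.card_nbs (mem_range.1 hr)
  have hbud : (ctx hS hst hadj1).budget = 25 * (W.n * W.n) + 9 * W.n + 1 +
      4 * ∑ v ∈ range W.n, (W.nbr v).card + 7 * ∑ r ∈ range W.n, (ctx hS hst hadj1).low r := by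
    rw [← hcard]; rfl
  have hI : Inv (ctx hS hst hadj1) s1 := by
    refine ⟨hn1, rfl, rfl, rfl, rfl, fun a ha y v h => ?_⟩
    rw [hmark1 a ha y] at h
    cases h
  refine Stmt.wp_mono (wp_search (X := ctx hS hst hadj1) hI (?_ : _ ≤ W.tmax)) ?_
  · omega
  rintro s2 ⟨hT, h4, h5, h6, t2⟩
  have key : ∀ {u v}, u < W.n → v < W.n →
    (s1.arr .rk u ∈ (ctx hS hst hadj1).nb (s1.arr .rk v) ↔ u ∈ W.nbr v) := fun hu hv => hS.nbs_rk hu hv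
  have keys : ∀ {u v}, u < W.n → v < W.n → ((ctx hS hst hadj1).nb (s1.arr .rk u) ⊆
      (ctx hS hst hadj1).nb (s1.arr .rk v) ↔ W.nbr u ⊆ W.nbr v) := fun {u v} hu hv => by
    have := hS.subset (hS.rk_lt u hu) (hS.rk_lt v hv)
    rwa [hS.ord_rk u hu, hS.ord_rk v hv] at this
  refine ⟨fun a b c hh => ?_, fun a b c d hh => ?_, fun a b c d e hh => ?_, fun a b c d e f hh => ?_,
    by omega⟩
  · obtain ⟨a, b, c, hh⟩ := hS.tri.2 ⟨a, b, c, hh⟩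
    exact hT a b c hh
  · obtain ⟨h1, h2, h3, h4', h5⟩ := hh
    have hb := W.lt h1
    have hc := W.lt h2
    have hd := W.lt h3
    have ha := W.lt h4'
    refine h4 (s1.arr .rk a) (s1.arr .rk b) (s1.arr .rk c) (s1.arr .rk d) ?_
    unfold NdC4
    rw [key hb ha, key hc hb, key hd hc, key ha hd, keys hc ha, keys ha hc, keys hd hb, keys hb hd]
    exact ⟨h1, h2, h3, h4', h5⟩
  · obtain ⟨h1, h2, h3, h4', h5'⟩ := hh
    have hb := W.lt h1
    have hc := W.lt h2
    have hd := W.lt h3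
    have he := W.lt h4'
    have ha := W.lt h5'
    refine h5 (s1.arr .rk a) (s1.arr .rk b) (s1.arr .rk c) (s1.arr .rk d) (s1.arr .rk e) ?_
    unfold C5
    rw [key hb ha, key hc hb, key hd hc, key he hd, key ha he]
    exact ⟨h1, h2, h3, h4', h5'⟩
  · obtain ⟨h1, h2, h3, h4', h5', h6', h7⟩ := hh
    have hb := W.lt h1
    have hc := W.lt h2
    have hd := W.lt h3
    have he := W.lt h4'
    have hf := W.lt h5'
    have ha := W.lt h6'
    refine h6 (s1.arr .rk a) (s1.arr .rk b) (s1.arr .rk c) (s1.arr .rk d) (s1.arr .rk e)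
      (s1.arr .rk f) ?_
    unfold C6
    rw [key hb ha, key hc hb, key hd hc, key he hd, key hf he, key ha hf, key hd ha, key he hb,
      key hf hc]
    exact ⟨h1, h2, h3, h4', h5', h6', h7⟩

end Raw

end BicliqueHelly

/-! ## The program for the machine -/

namespace RAM

section
variable {V A : Type} {L L' : Layout V A}

theorem Expr.compile_congr (h : L.code = L'.code) (ha : L.codeArr = L'.codeArr) (e : Expr V A)
    (d : ℕ) : e.compile L d = e.compile L' d := by
  induction e generalizing d <;> simp_all [Expr.compile, Layout.reg, Layout.regArr]

theorem compileList_congr (h : L.code = L'.code) (ha : L.codeArr = L'.codeArr)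
    (es : List (Expr V A)) (r : ℕ) : compileList L es r = compileList L' es r := by
  induction es generalizing r with
  | nil => rfl
  | cons e es ih => simp [compileList, ih, e.compile_congr h ha]

/-- The code does not depend on the base addresses of the arrays. -/
theorem Stmt.compile_congr (h : L.code = L'.code) (ha : L.codeArr = L'.codeArr) (c : Stmt V A) :
    c.compile L = c.compile L' := by
  induction c <;> simp_all [Stmt.compile, Expr.compile_congr h ha, compileList_congr h ha,
    Layout.reg, Layout.regArr, gap, loopBody]

end

/-- The program does not write to the memory. -/
def Cmd.StoreFree : Cmd → Prop
  | .store _ _ => False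
  | .seq c d => c.StoreFree ∧ d.StoreFree
  | .branch _ c d => c.StoreFree ∧ d.StoreFree
  | .loop _ c => c.StoreFree
  | _ => True

/-- Reading the bounds must leave the memory untouched: the positions of the arrays are not known
before. -/
theorem Exec.mem_eq {S t : ℕ} {c : Cmd} {σ σ' : State} (h : Exec S c σ t σ') (hc : c.StoreFree) :
    σ'.mem = σ.mem := by
  induction h with
  | skip | const | add | sub | load | loop_false => rfl
  | store => exact hc.elim
  | seq _ _ ih1 ih2 => rw [ih2 hc.2, ih1 hc.1]
  | branch_true _ _ ih => exact ih hc.1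
  | branch_false _ _ ih => exact ih hc.2
  | loop_true _ _ _ ih1 ih2 => rw [ih2 hc, ih1 hc]

/-- Code that computes the base addresses of arrays whose sizes are in register `r`. -/
def setBases (r : ℕ) : ℕ → Cmd
  | 0 => .skip
  | k + 1 => .seq (setBases r k) (.add (7 + 3 * (k + 1)) (7 + 3 * k) r)

theorem exec_setBases {S r : ℕ} {σ : State} (h0 : σ.reg 7 = 0) (hr : ∀ j, r ≠ 7 + 3 * j) (k : ℕ)
    (hS : k * σ.reg r < S) :
    ∃ σ', Exec S (setBases r k) σ (k + 1) σ' ∧ σ'.mem = σ.mem ∧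
      (∀ q, (∀ j, q ≠ 7 + 3 * j) → σ'.reg q = σ.reg q) ∧
      ∀ j, σ'.reg (7 + 3 * j) = if j ≤ k then j * σ.reg r else σ.reg (7 + 3 * j) := by
  induction k with
  | zero =>
    refine ⟨σ, .skip σ, rfl, fun _ _ => rfl, fun j => ?_⟩
    split_ifs with h
    · obtain rfl : j = 0 := by omega
      simpa using h0
    · rfl
  | succ k ih =>
    rw [Nat.succ_mul] at hS
    obtain ⟨σ1, x1, m1, r1, b1⟩ := ih (by omega)
    have hk := b1 k
    rw [if_pos le_rfl] at hk
    refine ⟨_, .seq x1 (.add σ1 _ _ _ (by rw [hk, r1 r hr]; omega)), m1, fun q hq => ?_, fun j => ?_⟩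
    · simp only [State.setReg]
      rw [Function.update_of_ne (hq _), r1 q hq]
    · simp only [State.setReg, hk, r1 r hr, Function.update_apply]
      by_cases hj : j = k + 1
      · subst hj
        rw [if_pos rfl, if_pos le_rfl, Nat.succ_mul]
      · rw [if_neg (by omega), b1]
        exact if_congr (by omega) rfl rfl

end RAM

/-! ### The complete machine program -/

namespace BicliqueHelly

open RAM SortedGraph Finset

section
open Var Arr

/-- Compute the number of vertices and the length of the input. -/
def readBounds : Prog :=
  .assign n (.get adj (.lit 0)) ;; .assign m (.add n (.lit 1)) ;;
    .loop v hv (.lit 0) n (.assign m (.add m (.get adj (.add v (.lit 1)))))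

end

/-- The variables and arrays in the machine, when all arrays have length `N`. -/
def layout (N : ℕ) : Layout Var Arr where
  code := Var.ctorIdx
  codeArr := Arr.ctorIdx
  base a := a.ctorIdx * N

/-- The program for the machine. -/
def program : Cmd :=
  .seq (readBounds.compile (layout 0))
    (.seq (setBases ((layout 0).reg .m) 19) (Raw.main.compile (layout 0)))

/-- The constant factor in the bounds for time and space. -/
def factor : ℕ := readBounds.cost + Raw.main.cost + readBounds.weight + Raw.main.weight + 20

theorem var_code_injective : Function.Injective Var.ctorIdx :=
  Function.LeftInverse.injective (g := Var.ofNat) Var.ofNat_ctorIdx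

theorem arr_code_injective : Function.Injective Arr.ctorIdx :=
  Function.LeftInverse.injective (g := Arr.ofNat) Arr.ofNat_ctorIdx

theorem arr_code_lt (a : Arr) : a.ctorIdx < 20 := by cases a <;> decide

namespace Raw

variable {W : Raw}

/-- The environment in which only the input is accessible. -/
def inputEnv (W : Raw) : Env Arr where
  size a := if a = .adj then W.N else 0
  bd := W.N + 1
  tmax := W.n
  ok _ := False

theorem n_lt (W : Raw) : W.n < W.N := W.off_n ▸ lt_off W.n

theorem inp_le (h0 : W.inp 0 = W.n) {i : ℕ} (hi : i < W.N) : W.inp i ≤ W.N := by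
  have := W.n_lt
  rcases Nat.lt_or_ge W.n i with h | h
  · exact ((inp_lt h hi).trans this).le
  · cases i with
    | zero => omega
    | succ i => rw [W.inp_deg i h]; exact ((card_lt h).trans this).le

/-- The running sum `m` passes through the offsets of the adjacency lists and ends at the input
length. Since `inputEnv` accepts no output, this stage cannot report. -/
theorem wp_readBounds {s : Mem} (h0 : W.inp 0 = W.n) (hadj : s.arr .adj = W.inp)
    (ht : s.time = 0) :
    readBounds.wp W.inputEnv (fun s' => s'.var .n = W.n ∧ s'.var .m = W.N ∧ s'.time ≤ W.n) s := by
  have hnN := W.n_lt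
  have hofN : ∀ v, v ≤ W.n → W.off v ≤ W.N := fun v hv => W.off_n ▸ off_mono hv
  simp only [readBounds, Stmt.wp_seq, Stmt.wp_assign]
  refine ⟨by simp [inputEnv]; omega, by simp [inputEnv, hadj, h0]; omega, by simp,
    by simp [inputEnv, hadj, h0]; omega, ?_⟩
  refine Stmt.wp_for (fun k s' => s'.var .n = W.n ∧ s'.arr .adj = W.inp ∧ s'.var .m = W.off k)
    (fun _ => 0) (fun _ => 1) (l := 0) (r := W.n) rfl (by simp [hadj, h0]) trivial trivial
    (Nat.zero_le _) (by simp [inputEnv]; omega) (by decide) (by simp [inputEnv, ht]) ?_ ?_ ?_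
  · simp [hadj, h0, off]
  · rintro v s1 - hv ⟨hn1, hadj1, hm1⟩ hv1 - t1
    have h2 := hofN (v + 1) hv
    simp [hn1, hadj1, hm1, hv1, inputEnv, W.inp_deg v hv, off_succ] at h2 ⊢
    omega
  · rintro s1 ⟨hn1, hadj1, hm1⟩ - t1
    simp [ht] at t1
    exact ⟨hn1, hm1.trans W.off_n, t1⟩

/-- The arrays are as long as the input, a length that the program has to compute itself. So it
reads the bounds with `adj` at address `0`, computes the other base addresses by repeated addition,
and then runs the main part. The `20` in `factor` covers the twenty arrays and the twenty steps of
`setBases`. -/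
theorem exec_program (h0 : W.inp 0 = W.n) (hz : ∀ i, W.N ≤ i → W.inp i = 0) {B S : ℕ}
    (hB : W.LowBound B)
    (ht : 26 * (W.n * W.n) + 12 * W.n + 2 + 5 * ∑ v ∈ range W.n, (W.nbr v).card + 7 * B ≤ W.tmax)
    (hS : factor * (W.N + 1) ≤ S) :
    ∃ t σ', Exec S program ⟨fun _ => 0, W.inp⟩ t σ' ∧ t ≤ factor * (W.n + W.tmax + 1) ∧
      (W.ok σ'.output ∨ (σ'.output = [] ∧ (∀ a b c, ¬ Tri W.nbr a b c) ∧
        (∀ a b c d, ¬ NdC4 W.nbr a b c d) ∧ (∀ a b c d e, ¬ C5 W.nbr a b c d e) ∧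
        (∀ a b c d e f, ¬ C6 W.nbr a b c d e f))) := by
  have hf : factor = readBounds.cost + main.cost + readBounds.weight + main.weight + 20 := rfl
  simp only [hf, add_mul] at hS ⊢
  have hnN := W.n_lt
  have hw2 : 0 < readBounds.weight := by decide
  have hL1 : (layout 0).Good W.inputEnv S := by
    refine ⟨var_code_injective, fun a ha => ?_, fun a b i j hi hj _ => ?_, Nat.succ_pos _⟩
    · obtain rfl : a = .adj := by by_contra h; simp [inputEnv, h] at ha
      simp only [layout, inputEnv, if_true]; omega
    · have : ∀ {a : Arr} {i}, i < W.inputEnv.size a → a = .adj := fun {a i} h => by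
        by_contra h'; simp [inputEnv, h'] at h
      rw [this hi, this hj]
  have hR1 : Rel W.inputEnv (layout 0) ⟨fun _ => 0, W.inp⟩
      ⟨fun _ => 0, fun a => if a = .adj then W.inp else 0, 0⟩ := by
    refine ⟨rfl, fun _ => rfl, fun _ => Nat.succ_pos _, fun a => by simp [layout], fun a i hi => ?_,
      fun a i hi => ?_⟩ <;>
    · obtain rfl : a = .adj := by by_contra h; simp [inputEnv, h] at hi
      simp [layout, inputEnv] at hi ⊢
      try have := inp_le h0 hi
      try omega
  obtain ⟨t1, σ1, x1, o1⟩ := Stmt.exec hL1 readBounds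
    (wp_readBounds (s := ⟨fun _ => 0, fun a => if a = .adj then W.inp else 0, 0⟩) h0 (by simp) rfl)
    hR1 (by simp only [inputEnv]; omega)
  obtain ⟨s1, hR, ⟨hn1, hm1, ht1⟩, -, htt1⟩ | ⟨-, -, hF, -⟩ := o1
  swap
  · exact hF.elim
  have hm := x1.mem_eq (by simp [readBounds, Stmt.compile, Expr.compile, move, gap, loopBody, Cmd.StoreFree])
  have hregm : σ1.reg ((layout 0).reg .m) = W.N := (hR.var .m).trans hm1
  obtain ⟨σ2, x2, m2, r2, b2⟩ := exec_setBases (S := S) (σ := σ1) (r := (layout 0).reg .m)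
    ((hR.base .adj).trans (by simp [layout])) (fun j => by unfold Layout.reg; omega) 19
    (by rw [hregm]; omega)
  have hmem : σ2.mem = W.inp := m2.trans hm
  have hdiv : ∀ {c i}, i < W.N → (c * W.N + i) / W.N = c := fun {c i} hi => by
    rw [mul_comm, Nat.mul_add_div (by omega), Nat.div_eq_of_lt hi, add_zero]
  have hL2 : (layout W.N).Good W.env S := by
    refine ⟨var_code_injective, fun a _ => ?_, fun a b i j hi hj h => ?_, Nat.succ_pos _⟩
    · have := Nat.mul_le_mul_right W.N (Nat.le_of_lt_succ (arr_code_lt a))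
      simp only [layout, env]; omega
    · simp only [layout] at h
      have := congrArg (· / W.N) h
      simp only [hdiv hi, hdiv hj] at this
      exact arr_code_injective this
  -- The memory is still the initial one, so array `a` consists of the words from `a.ctorIdx * W.N`
  -- on: the input for `adj`, zeros for the others.
  have hR2 : Rel W.env (layout W.N) σ2 ⟨s1.var, fun a i => W.inp (a.ctorIdx * W.N + i), 0⟩ := by
    refine ⟨?_, fun x => ?_, hR.var_lt, fun a => ?_, fun a i _ => by rw [hmem]; rfl, fun a i hi => ?_⟩
    · rw [r2 0 (fun j => by omega)]; exact hR.flag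
    · rw [r2 _ (fun j => by unfold Layout.reg; omega)]; exact hR.var x
    · have := b2 a.ctorIdx
      rw [if_pos (Nat.le_of_lt_succ (arr_code_lt a)), hregm] at this
      exact this
    · simp only [env]
      rcases Nat.lt_or_ge (a.ctorIdx * W.N + i) W.N with h | h
      · exact Nat.lt_succ_of_le (inp_le h0 h)
      · rw [hz _ h]; exact Nat.succ_pos _
  have hmark : ∀ a : Arr, a.isMark → ∀ y, W.inp (a.ctorIdx * W.N + y) = 0 := fun a ha y => by
    have : 1 ≤ a.ctorIdx := Nat.one_le_iff_ne_zero.2 fun h => by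
      obtain rfl : a = .adj := arr_code_injective h
      cases ha
    have := Nat.mul_le_mul_right W.N this
    exact hz _ (by omega)
  obtain ⟨t3, σ3, x3, o3⟩ := Stmt.exec hL2 main (wp_main (B := B) (W := W)
    (s := ⟨s1.var, fun a i => W.inp (a.ctorIdx * W.N + i), 0⟩) hn1 hm1 (by ext i; simp [Arr.ctorIdx])
    hmark hB (by simpa using ht)) hR2 (by simp only [env]; omega)
  -- The layout for the correct array length and the layout with length `0` yield the same code,
  -- which makes the program independent of the input.
  rw [Stmt.compile_congr (L := layout W.N) (L' := layout 0) rfl rfl] at x3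
  refine ⟨_, σ3, .seq x1 (.seq x2 x3), ?_, ?_⟩
  · have e1 : t1 ≤ readBounds.cost * (W.n + W.tmax + 1) :=
      htt1.trans (Nat.mul_le_mul_left _ (by omega))
    have e3 : t3 ≤ main.cost * (W.n + W.tmax + 1) := by
      obtain ⟨s3, -, ⟨-, -, -, -, h⟩, -, h'⟩ | ⟨-, -, -, -, h'⟩ := o3
      · exact h'.trans (Nat.mul_le_mul_left _ (by simp only at *; omega))
      · exact h'.trans (Nat.mul_le_mul_left _ (by simp only [env]; omega))
    omega
  · obtain ⟨s3, hR3, ⟨h1, h2, h3, h4, -⟩, -⟩ | ⟨-, -, h, -⟩ := o3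
    · exact .inr ⟨by simp [State.output, hR3.flag], h1, h2, h3, h4⟩
    · exact .inl h

end Raw

end BicliqueHelly

/-! ## Graphs given by adjacency lists -/

namespace RAM

theorem IsSeg.of_list {l : List ℕ} (hl : l.Nodup) {f : ℕ → ℕ} {a : ℕ}
    (h : ∀ i (hi : i < l.length), f (a + i) = l[i]) : IsSeg f a (a + l.length) l.toFinset := by
  have h' : ∀ j, a ≤ j → (hj : j - a < l.length) → f j = l[j - a] := fun j hj hjl => by
    rw [← h _ hjl, Nat.add_sub_cancel' hj]
  refine ⟨Nat.le_add_right _ _, fun j hj => ?_, fun j hj k hk hjk => ?_, fun x hx => ?_⟩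
  · obtain ⟨h1, h2⟩ := hj
    rw [h' j h1 (by omega)]
    simp
  · obtain ⟨h1, h2⟩ := hj
    obtain ⟨h3, h4⟩ := hk
    rw [h' j h1 (by omega), h' k h3 (by omega), hl.getElem_inj_iff] at hjk
    omega
  · obtain ⟨i, hi, rfl⟩ := List.mem_iff_getElem.1 (List.mem_toFinset.1 (Finset.mem_coe.1 hx))
    exact ⟨a + i, ⟨Nat.le_add_right _ _, Nat.add_lt_add_left hi _⟩, h i hi⟩

theorem length_flatten_map_range (l : ℕ → List ℕ) (n : ℕ) :
    ((List.range n).map l).flatten.length = ∑ j ∈ Finset.range n, (l j).length := by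
  induction n with
  | zero => rfl
  | succ n ih => simp [List.range_succ, Finset.sum_range_succ, ← ih]

theorem getD_flatten_map_range (l : ℕ → List ℕ) {n v i : ℕ} (hv : v < n) (hi : i < (l v).length) :
    ((List.range n).map l).flatten.getD (∑ j ∈ Finset.range v, (l j).length + i) 0 = (l v)[i] := by
  induction n with
  | zero => omega
  | succ n ih =>
    rw [List.range_succ, List.map_append, List.flatten_append]
    have hlen := length_flatten_map_range l n
    rcases Nat.lt_succ_iff_lt_or_eq.1 hv with h | rfl
    · have h1 : ∑ j ∈ Finset.range (v + 1), (l j).length ≤ ∑ j ∈ Finset.range n, (l j).length :=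
        Finset.sum_le_sum_of_subset (Finset.range_subset_range.2 h)
      rw [Finset.sum_range_succ] at h1
      rw [List.getD_append _ _ _ _ (by omega)]
      exact ih h
    · rw [List.getD_append_right _ _ _ _ (by omega), hlen, Nat.add_sub_cancel_left]
      simp [hi]

end RAM

namespace SimpleGraph

open Finset

variable {n : ℕ} (G : SimpleGraph (Fin n))

open Classical in
/-- The neighbourhood of a vertex, as a set of numbers. -/
noncomputable def natNbr (v : ℕ) : Finset ℕ :=
  ({u : Fin n | ∃ a : Fin n, a.val = v ∧ G.Adj a u} : Finset (Fin n)).map Fin.valEmbedding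

variable {G}

theorem mem_natNbr {u v : ℕ} :
    u ∈ G.natNbr v ↔ ∃ a b : Fin n, a.val = v ∧ b.val = u ∧ G.Adj a b := by
  simp only [natNbr, mem_map, mem_filter, mem_univ, true_and, Fin.valEmbedding_apply]
  tauto

@[simp] theorem coe_mem_natNbr {u v : Fin n} : u.val ∈ G.natNbr v.val ↔ G.Adj v u := by
  rw [mem_natNbr]
  constructor
  · rintro ⟨a, b, h1, h2, h⟩
    rwa [Fin.ext h1, Fin.ext h2] at h
  · exact fun h => ⟨v, u, rfl, rfl, h⟩

theorem lt_of_mem_natNbr {u v : ℕ} (h : u ∈ G.natNbr v) : u < n := by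
  obtain ⟨a, b, -, rfl, -⟩ := mem_natNbr.1 h
  exact b.isLt

theorem symm_natNbr {u v : ℕ} (h : u ∈ G.natNbr v) : v ∈ G.natNbr u := by
  obtain ⟨a, b, rfl, rfl, hab⟩ := mem_natNbr.1 h
  exact coe_mem_natNbr.2 hab.symm

theorem natNbr_subset {u v : Fin n} : G.natNbr u ⊆ G.natNbr v ↔ G.Dominates v u := by
  constructor
  · intro h x hx
    exact coe_mem_natNbr.1 (h (coe_mem_natNbr.2 hx))
  · intro h x hx
    lift x to Fin n using lt_of_mem_natNbr hx
    exact coe_mem_natNbr.2 (h (coe_mem_natNbr.1 hx))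

open SortedGraph

theorem tri_natNbr {a b c : Fin n} :
    Tri G.natNbr a b c ↔ G.Adj a b ∧ G.Adj b c ∧ G.Adj c a := by simp [Tri]

theorem ndC4_natNbr {a b c d : Fin n} : NdC4 G.natNbr a b c d ↔ G.IsNonDominatedC4 a b c d := by
  simp [NdC4, IsNonDominatedC4, natNbr_subset]

theorem c5_natNbr {a b c d e : Fin n} : C5 G.natNbr a b c d e ↔ G.IsC5 a b c d e := by
  simp [C5, IsC5]

theorem c6_natNbr {a b c d e f : Fin n} : C6 G.natNbr a b c d e f ↔ G.IsC6 a b c d e f := by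
  simp [C6, IsC6]

theorem triangleFree_of_natNbr (h : ∀ a b c, ¬ Tri G.natNbr a b c) : G.TriangleFree :=
  fun a b c h1 h2 h3 => h a b c (tri_natNbr.2 ⟨h1, h2, h3⟩)

theorem sum_card_natNbr : ∑ v ∈ range n, (G.natNbr v).card = 2 * G.edgeSet.ncard := by
  classical
  rw [Set.ncard_eq_toFinset_card', ← edgeFinset, ← sum_degrees_eq_twice_card_edges, ← Fin.sum_univ_eq_sum_range
    fun v => (G.natNbr v).card]
  refine sum_congr rfl fun v _ => ?_
  rw [← card_neighborFinset_eq_degree, natNbr, card_map]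
  congr 1
  ext u
  simp [Fin.val_inj]

/-- A graph with an edge has positive arboricity. This absorbs the terms linear in the number of
edges. -/
theorem edgeSet_ncard_le : G.edgeSet.ncard ≤ G.arboricity * G.edgeSet.ncard := by
  rcases Set.eq_empty_or_nonempty G.edgeSet with h | ⟨e, he⟩
  · simp [h]
  · induction e with
    | h u v => exact Nat.le_mul_of_pos_left _ (arboricity_pos (G.mem_edgeSet.1 he))

/-- The number of steps from a vertex to a neighbour of smaller degree and on to all its
neighbours. -/
theorem sum_low_le (rk : ℕ → ℕ)
    (hrk : ∀ u < n, ∀ v < n, rk u < rk v → (G.natNbr u).card ≤ (G.natNbr v).card) :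
    ∑ v ∈ range n, ∑ u ∈ G.natNbr v with rk u < rk v, (G.natNbr u).card ≤
      2 * (G.arboricity * G.edgeSet.ncard) := by
  classical
  let d : Fin n → ℕ := fun v => (G.natNbr v).card
  -- Each edge is directed from its lower to its higher rank; by `hrk` the lower end then carries
  -- the smaller degree.
  have h1 := G.sum_min_le_arboricity_mul
    {p : Fin n × Fin n | G.Adj p.2 p.1 ∧ rk p.1 < rk p.2}
    (fun p hp => by
      simp only [mem_filter, mem_univ, true_and, Prod.fst_swap, Prod.snd_swap] at hp ⊢
      exact ⟨hp.1.symm, fun h => lt_asymm h.2 hp.2⟩) d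
  have h2 : ∑ v, d v = 2 * G.edgeSet.ncard := by
    rw [← sum_card_natNbr, ← Fin.sum_univ_eq_sum_range fun v => (G.natNbr v).card]
  rw [h2, mul_left_comm] at h1
  refine le_trans (le_of_eq ?_) h1
  rw [← Fin.sum_univ_eq_sum_range fun v => ∑ u ∈ G.natNbr v with rk u < rk v, (G.natNbr u).card,
    sum_filter, ← univ_product_univ, sum_product_right]
  refine sum_congr rfl fun v _ => ?_
  rw [← sum_filter]
  symm
  refine sum_bij (fun u _ => u.val) (fun u hu => ?_) (fun u _ w _ h => Fin.ext h) (fun u hu => ?_)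
    fun u hu => ?_
  · simpa using hu
  · obtain ⟨h3, h4⟩ := mem_filter.1 hu
    lift u to Fin n using lt_of_mem_natNbr h3
    exact ⟨u, by simpa [coe_mem_natNbr.1 h3] using h4, rfl⟩
  · have h3 := (mem_filter.1 hu).2.2
    exact min_eq_left (hrk u u.isLt v v.isLt h3)

end SimpleGraph

/-! ### From the encoded adjacency lists to a graph in memory -/

namespace BicliqueHelly

open RAM SortedGraph SimpleGraph Finset

variable {n : ℕ} {G : SimpleGraph (Fin n)} {N : Fin n → List (Fin n)}

/-- The adjacency lists, as lists of numbers. -/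
def natList (N : Fin n → List (Fin n)) (v : ℕ) : List ℕ :=
  if h : v < n then (N ⟨v, h⟩).map Fin.val else []

theorem natList_coe (v : Fin n) : natList N v = (N v).map Fin.val := by
  simp [natList]

theorem nodup_natList (hN : G.IsAdjacencyLists N) (v : Fin n) : (natList N v).Nodup := by
  rw [natList_coe]
  exact (hN v).1.map Fin.val_injective

theorem toFinset_natList (hN : G.IsAdjacencyLists N) (v : Fin n) :
    (natList N v).toFinset = G.natNbr v := by
  ext u
  rw [natList_coe, List.mem_toFinset, List.mem_map]
  constructor
  · rintro ⟨u, hu, rfl⟩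
    exact coe_mem_natNbr.2 (((hN v).2 u).1 hu)
  · intro hu
    lift u to Fin n using lt_of_mem_natNbr hu
    exact ⟨u, ((hN v).2 u).2 (coe_mem_natNbr.1 hu), rfl⟩

theorem length_natList (hN : G.IsAdjacencyLists N) {v : ℕ} (hv : v < n) :
    (natList N v).length = (G.natNbr v).card := by
  lift v to Fin n using hv
  rw [← toFinset_natList hN, List.toFinset_card_of_nodup (nodup_natList hN v)]

theorem encode_eq : encode N =
    n :: (List.ofFn fun v => (N v).length) ++ ((List.range n).map (natList N)).flatten := by
  have : (List.ofFn fun v => (N v).map Fin.val) = (List.range n).map (natList N) := by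
    refine List.ext_getElem (by simp) fun i h1 h2 => ?_
    simp at h1
    simp [natList, h1]
  rw [encode, this]

theorem length_encode (hN : G.IsAdjacencyLists N) :
    (encode N).length = n + 1 + ∑ v ∈ range n, (G.natNbr v).card := by
  rw [encode_eq, List.length_append, length_flatten_map_range]
  simp only [List.length_cons, List.length_ofFn]
  rw [sum_congr rfl fun v hv => length_natList hN (mem_range.1 hv)]

/-- A graph given by adjacency lists. -/
noncomputable def raw (hN : G.IsAdjacencyLists N) (tmax : ℕ) : Raw where
  n := n
  N := n + 1 + ∑ v ∈ range n, (G.natNbr v).card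
  tmax := tmax
  nbr := G.natNbr
  inp i := (encode N).getD i 0
  ok l := ∃ l', G.IsObstruction l' ∧ l = l'.map Fin.val
  symm := symm_natNbr
  irrefl v h := by
    lift v to Fin n using lt_of_mem_natNbr h
    exact G.irrefl (coe_mem_natNbr.1 h)
  lt := lt_of_mem_natNbr
  inp_deg v hv := by
    rw [← length_natList hN hv, encode_eq, List.getD_append _ _ _ _ (by simpa using hv),
      List.getD_cons_succ]
    simp [natList, hv]
  N_eq := rfl
  seg v hv := by
    have hs : ∀ {w}, w ≤ n → ∑ j ∈ range w, (G.natNbr j).card =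
        ∑ j ∈ range w, (natList N j).length := fun {w} hw =>
      sum_congr rfl fun j hj => (length_natList hN ((mem_range.1 hj).trans_le hw)).symm
    have hf := toFinset_natList hN ⟨v, hv⟩
    simp only at hf
    rw [← hf, hs hv, hs hv.le, sum_range_succ, ← add_assoc]
    refine IsSeg.of_list (nodup_natList hN ⟨v, hv⟩) fun i hi => ?_
    rw [← getD_flatten_map_range _ hv hi, encode_eq, List.getD_append_right _ _ _ _ (by simp; omega)]
    congr 1
    simp; omega
  ok_tri a b c h := by
    lift a to Fin n using lt_of_mem_natNbr h.2.2
    lift b to Fin n using lt_of_mem_natNbr h.1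
    lift c to Fin n using lt_of_mem_natNbr h.2.1
    obtain ⟨h1, h2, h3⟩ := tri_natNbr.1 h
    exact ⟨_, isObstruction_of_triangle h1 h2 h3, rfl⟩
  ok_ndC4 a b c d h := by
    lift a to Fin n using lt_of_mem_natNbr h.2.2.2.1
    lift b to Fin n using lt_of_mem_natNbr h.1
    lift c to Fin n using lt_of_mem_natNbr h.2.1
    lift d to Fin n using lt_of_mem_natNbr h.2.2.1
    exact ⟨_, (ndC4_natNbr.1 h).isObstruction, rfl⟩
  ok_C5 hT a b c d e h := by
    lift a to Fin n using lt_of_mem_natNbr h.2.2.2.2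
    lift b to Fin n using lt_of_mem_natNbr h.1
    lift c to Fin n using lt_of_mem_natNbr h.2.1
    lift d to Fin n using lt_of_mem_natNbr h.2.2.1
    lift e to Fin n using lt_of_mem_natNbr h.2.2.2.1
    exact ⟨_, (c5_natNbr.1 h).isObstruction (triangleFree_of_natNbr hT), rfl⟩
  ok_C6 hT a b c d e f h := by
    lift a to Fin n using lt_of_mem_natNbr h.2.2.2.2.2.1
    lift b to Fin n using lt_of_mem_natNbr h.1
    lift c to Fin n using lt_of_mem_natNbr h.2.1
    lift d to Fin n using lt_of_mem_natNbr h.2.2.1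
    lift e to Fin n using lt_of_mem_natNbr h.2.2.2.1
    lift f to Fin n using lt_of_mem_natNbr h.2.2.2.2.1
    exact ⟨_, (c6_natNbr.1 h).isObstruction (triangleFree_of_natNbr hT), rfl⟩

end BicliqueHelly

/-- One program recognizes hereditary biclique-Helly graphs, given by adjacency lists, in
`O(n² + α(G) m)` time and `O(n + m)` space; it outputs a triangle, a non-dominated `C₄`, an
induced `C₅` or an induced `C₆` when there is one, and the empty list (the message that `G` is
hereditary biclique-Helly) otherwise. The summand `1` in the bounds matters for `n = 0` only. -/
theorem mainTheorem2 :
    ∃ (P : RAM.Cmd) (C : ℕ), ∀ (n : ℕ) (G : SimpleGraph (Fin n)) (N : Fin n → List (Fin n)),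
      G.IsAdjacencyLists N →
      ∃ (t : ℕ) (s : RAM.State),
        RAM.Exec (C * (n + G.edgeSet.ncard + 1)) P (RAM.initial (RAM.encode N)) t s ∧
        t ≤ C * (n ^ 2 + G.arboricity * G.edgeSet.ncard + 1) ∧
        ((G.IsHereditaryBicliqueHelly ∧ (¬ ∃ l, G.IsObstruction l) ∧ s.output = []) ∨
          (¬ G.IsHereditaryBicliqueHelly ∧
            ∃ l, G.IsObstruction l ∧ s.output = l.map Fin.val)) := by
  open BicliqueHelly SimpleGraph in
  -- With `n ≤ n²` and `m ≤ α m`, the time limit plus `n + 1` is at most `39 n² + 24 α m + 3`; the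
  -- `39` also suffices for the memory, of `factor * (n + 2 m + 2)` words.
  refine ⟨program, 39 * factor, fun n G N hN => ?_⟩
  have hcard := G.sum_card_natNbr
  have hm := G.edgeSet_ncard_le
  have hn : n ≤ n * n := Nat.le_mul_self n
  have hlen := length_encode hN
  obtain ⟨t, s, hx, ht, hs⟩ := Raw.exec_program (W := raw hN (26 * (n * n) + 12 * n + 2 +
      5 * (2 * G.edgeSet.ncard) + 7 * (2 * (G.arboricity * G.edgeSet.ncard))))
    (B := 2 * (G.arboricity * G.edgeSet.ncard)) (S := 39 * factor * (n + G.edgeSet.ncard + 1))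
    (by simp [raw, encode_eq])
    (fun i hi => List.getD_eq_default _ _ (by rw [hlen]; exact hi))
    (fun rk _ hrk => sum_low_le rk hrk) (by simp only [raw, hcard]; exact le_rfl)
    (by
      rw [mul_comm 39, mul_assoc]
      refine Nat.mul_le_mul_left _ ?_
      simp only [raw, hcard]
      omega)
  refine ⟨t, s, hx, ht.trans ?_, ?_⟩
  · rw [mul_comm 39, mul_assoc, sq]
    refine Nat.mul_le_mul_left _ ?_
    simp only [raw]
    omega
  · rcases hs with ⟨l, hl, hs⟩ | ⟨hs, h3, h4, h5, h6⟩
    · exact .inr ⟨hl.not_isHereditaryBicliqueHelly, l, hl, hs⟩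
    · have hG : G.IsObstructionFree := ⟨triangleFree_of_natNbr h3,
        fun a b c d h => h4 a b c d (ndC4_natNbr.2 h),
        fun a b c d e h => h5 a b c d e (c5_natNbr.2 h),
        fun a b c d e f h => h6 a b c d e f (c6_natNbr.2 h)⟩
      exact .inl ⟨hG.isHereditaryBicliqueHelly, hG.not_isObstruction, hs⟩
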